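/- Let $P=\sum_{(i,j)}c_{i,j}X^iY^j\in\mathbb{C}[X^{\pm1},Y^{\pm1}]$ be a squarefree (in particular non-zero) Laurent polynomial. Let $C=\{(x,y)\in(\mathbb{C}^*)^2: P(x,y)=0,\ dP(x,y)\neq0\}$, let $\overline{C}$ be the normalization of the zero set of $P$ in $(\mathbb{C}^*)^2$ (its points are the local analytic branches of this zero set), with its coordinate map $(x,y):\overline C\to(\mathbb{C}^*)^2$, and put $\mu=(\log|x|,\log|y|):\overline{C}\to\mathbb{R}^2$. Let $\gamma:\overline{C}\to\mathbb{P}^1(\mathbb{C})=\mathbb{C}\cup\{\infty\}$ be the continuous extension of the logarithmic Gauss map $[x\partial_xP:y\partial_yP]=\frac{x\partial_xP}{y\partial_yP}$ on $C$. Assume that $P$ is exact: there is a function $V:C\to\mathbb{R}$ with $dV=\log|y|\,d\arg x-\log|x|\,d\arg y$ on $C$; fix any such $V$. Assume moreover that $P$ is regular: $\gamma(z)\notin\mathbb{P}^1(\mathbb{R})$ for every $z\in\overline{C}$ with $\mu(z)=(0,0)$. For such $z$ let $k(z)\ge1$ be the ramification order at $z$ of $(x,y):\overline{C}\to(\mathbb{C}^*)^2$,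 and let $\epsilon(z)\in\{\pm1\}$ be minus the sign of $\operatorname{Im}\gamma(z)$. Then $\log|P|$ is integrable on the torus $|x|=|y|=1$, the set $\mu^{-1}(0,0)\subset\overline{C}$ is finite, $V$ extends continuously to $\overline{C}$ (the extension is still denoted by $V$), every $z\in\mu^{-1}(0,0)$ is a local maximum of $V$ if $\epsilon(z)=1$ and a local minimum of $V$ if $\epsilon(z)=-1$, the coefficients $c_{i,j}$ at all corners $(i,j)$ of the Newton polygon of $P$ have the same absolute value $c(P)>0$, and the logarithmic Mahler measure $$m(P)=\frac{1}{(2\pi)^2}\int_0^{2\pi}\int_0^{2\pi}\log|P(e^{i\theta},e^{i\phi})|\,d\theta\,d\phi$$ is given by $$m(P)=\log c(P)+\frac{1}{2\pi}\sum_{z\in\mu^{-1}(0,0)}k(z)\,\epsilon(z)\,V(z).$$ -/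

import Mathlib

open Filter Topology

noncomputable section

namespace MahlerVolume

/-- Laurent polynomials `ℂ[X^{±1}, Y^{±1}]`; the monomial `X^i Y^j` is indexed by `(i, j)`. -/
abbrev Laurent : Type := AddMonoidAlgebra ℂ (ℤ × ℤ)

/-- The value `P(x, y)` at `p = (x, y)` (meaningful for `x, y ≠ 0`). -/
def eval (P : Laurent) (p : ℂ × ℂ) : ℂ :=
  P.coeff.sum fun n c => c * p.1 ^ n.1 * p.2 ^ n.2

/-- The value of `x ∂P/∂x` at `p = (x, y)`. -/
def xDx (P : Laurent) (p : ℂ × ℂ) : ℂ :=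
  P.coeff.sum fun n c => (n.1 : ℂ) * c * p.1 ^ n.1 * p.2 ^ n.2

/-- The value of `y ∂P/∂y` at `p = (x, y)`. -/
def yDy (P : Laurent) (p : ℂ × ℂ) : ℂ :=
  P.coeff.sum fun n c => (n.2 : ℂ) * c * p.1 ^ n.1 * p.2 ^ n.2

/-- The curve `C`: the points of `(ℂ^*)²` with `P = 0` and `dP ≠ 0`. -/
def smoothLocus (P : Laurent) : Set (ℂ × ℂ) :=
  {p | p.1 ≠ 0 ∧ p.2 ≠ 0 ∧ eval P p = 0 ∧ (xDx P p ≠ 0 ∨ yDy P p ≠ 0)}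

/-- The real 1-form `η = log|y| d arg x - log|x| d arg y` on `(ℂ^*)²`, with
`d arg x = Im (dx / x)` and `d arg y = Im (dy / y)`. -/
def eta (p : ℂ × ℂ) : (ℂ × ℂ) →L[ℝ] ℝ :=
  Real.log ‖p.2‖ • Complex.imCLM.comp (p.1⁻¹ • ContinuousLinearMap.fst ℝ ℂ ℂ) -
    Real.log ‖p.1‖ • Complex.imCLM.comp (p.2⁻¹ • ContinuousLinearMap.snd ℝ ℂ ℂ)

theorem eta_apply (p v : ℂ × ℂ) :
    eta p v = Real.log ‖p.2‖ * (v.1 / p.1).im - Real.log ‖p.1‖ * (v.2 / p.2).im := by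
  simp [eta, div_eq_inv_mul]

/-- `V` is a volume function of `P`: a function on `C` which is differentiable along `C` with
`dV = η|_C`. Only the restriction of `V` to `C` matters. -/
def IsVolumeFunction (P : Laurent) (V : ℂ × ℂ → ℝ) : Prop :=
  ∀ p ∈ smoothLocus P, HasFDerivWithinAt V (eta p) (smoothLocus P) p

/-! ### The normalization of the zero set of `P` in `(ℂ^*)²`

Its points are the local analytic branches of the curve: primitive (that is, injective) germs of
holomorphic parametrizations `t ↦ (x(t), y(t))`, up to a change of the local coordinate `t`. -/

/-- A primitive local parametrization, around `t = 0`, of a branch of the zero set of `P`. -/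
structure BranchParam (P : Laurent) where
  toFun : ℂ → ℂ × ℂ
  analytic : AnalyticAt ℂ toFun 0
  fst_ne_zero : (toFun 0).1 ≠ 0
  snd_ne_zero : (toFun 0).2 ≠ 0
  eval_eq_zero : ∀ᶠ t in 𝓝 (0 : ℂ), eval P (toFun t) = 0
  injective : ∃ U ∈ 𝓝 (0 : ℂ), Set.InjOn toFun U

/-- Two parametrizations are equivalent if their germs at `0` differ by an invertible
holomorphic change of coordinate fixing `0`. -/
def BranchParam.Equivalent {P : Laurent} (φ ψ : BranchParam P) : Prop :=
  ∃ h : ℂ → ℂ, AnalyticAt ℂ h 0 ∧ h 0 = 0 ∧ deriv h 0 ≠ 0 ∧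
    ∀ᶠ t in 𝓝 (0 : ℂ), ψ.toFun t = φ.toFun (h t)

theorem BranchParam.Equivalent.refl {P : Laurent} (φ : BranchParam P) : φ.Equivalent φ :=
  ⟨id, analyticAt_id, rfl, by simp, Eventually.of_forall fun _ => rfl⟩

theorem BranchParam.Equivalent.symm {P : Laurent} {φ ψ : BranchParam P}
    (H : φ.Equivalent ψ) : ψ.Equivalent φ := by
  obtain ⟨h, ha, h0, hd, he⟩ := H
  have hs := ha.hasStrictDerivAt
  set g := hs.localInverse _ _ _ hd with hg
  have ga : AnalyticAt ℂ g (h 0) := ha.analyticAt_localInverse hd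
  have g0 : g (h 0) = 0 := HasStrictFDerivAt.localInverse_apply_image ..
  have gd : HasStrictDerivAt g (deriv h 0)⁻¹ (h 0) := hs.to_localInverse hd
  have gr : ∀ᶠ t in 𝓝 (h 0), h (g t) = t := hs.eventually_right_inverse hd
  rw [h0] at ga g0 gd gr
  refine ⟨g, ga, g0, by rw [gd.hasDerivAt.deriv]; exact inv_ne_zero hd, ?_⟩
  have gt : Tendsto g (𝓝 0) (𝓝 0) := by simpa [g0] using ga.continuousAt.tendsto
  filter_upwards [gt.eventually he, gr] with t h1 h2
  rw [h1, h2]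

theorem BranchParam.Equivalent.trans {P : Laurent} {φ ψ χ : BranchParam P}
    (H : φ.Equivalent ψ) (K : ψ.Equivalent χ) : φ.Equivalent χ := by
  obtain ⟨h, ha, h0, hd, he⟩ := H
  obtain ⟨k, ka, k0, kd, ke⟩ := K
  have ha' : AnalyticAt ℂ h (k 0) := by rwa [k0]
  have kt : Tendsto k (𝓝 0) (𝓝 0) := by simpa [k0] using ka.continuousAt.tendsto
  refine ⟨h ∘ k, ha'.comp ka, by simp [k0, h0], ?_, ?_⟩
  · rw [deriv_comp _ ha'.differentiableAt ka.differentiableAt, k0]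
    exact mul_ne_zero hd kd
  · filter_upwards [kt.eventually he, ke] with t h1 h2
    rw [h2, h1, Function.comp]

instance branchSetoid (P : Laurent) : Setoid (BranchParam P) where
  r := BranchParam.Equivalent
  iseqv := ⟨BranchParam.Equivalent.refl, BranchParam.Equivalent.symm,
    BranchParam.Equivalent.trans⟩

/-- The (points of the) normalization of the zero set of `P` in `(ℂ^*)²`. -/
def Normalization (P : Laurent) : Type := Quotient (branchSetoid P)

/-- The point of the normalization given by a local parametrization. -/
def BranchParam.point {P : Laurent} (φ : BranchParam P) : Normalization P :=
  Quotient.mk (branchSetoid P) φ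

/-- The coordinate map `(x, y)` from the normalization to `(ℂ^*)²`. -/
def coords {P : Laurent} (z : Normalization P) : ℂ × ℂ :=
  Quotient.lift (fun φ : BranchParam P => φ.toFun 0)
    (by
      rintro φ ψ ⟨h, -, h0, -, he⟩
      have := he.self_of_nhds
      simp only [this, h0]) z

/-- The ramification order `k(z)` of the coordinate map `(x, y)` at `z`: the order of vanishing
of `(x(t) - x(0), y(t) - y(0))` at `t = 0`. -/
def ramification {P : Laurent} (z : Normalization P) : ℕ :=
  Quotient.lift
    (fun φ : BranchParam P => analyticOrderNatAt (fun t => φ.toFun t - φ.toFun 0) 0)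
    (by
      rintro φ ψ ⟨h, ha, h0, hd, he⟩
      have e0 : ψ.toFun 0 = φ.toFun 0 := by rw [he.self_of_nhds, h0]
      have key : (fun t => ψ.toFun t - ψ.toFun 0) =ᶠ[𝓝 0]
          ((fun t => φ.toFun t - φ.toFun 0) ∘ h) := by
        filter_upwards [he] with t ht
        simp [ht, e0]
      simp only [analyticOrderNatAt]
      rw [analyticOrderAt_congr key, analyticOrderAt_comp_of_deriv_ne_zero ha hd, h0]) z

/-- The map `μ = (log|x|, log|y|)` on the normalization, whose image is the amoeba. -/
def mu {P : Laurent} (z : Normalization P) : ℝ × ℝ :=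
  (Real.log ‖(coords z).1‖, Real.log ‖(coords z).2‖)

/-- The logarithmic Gauss map `[x ∂P/∂x : y ∂P/∂y]` on `C`, in `ℙ¹(ℂ) = ℂ ∪ {∞}` where
`[u : v]` is identified with `u / v`. -/
def gauss (P : Laurent) (p : ℂ × ℂ) : OnePoint ℂ :=
  open Classical in
  if yDy P p = 0 then OnePoint.infty else ((xDx P p / yDy P p : ℂ) : OnePoint ℂ)

theorem map_punctured_nhds {h : ℂ → ℂ} (ha : AnalyticAt ℂ h 0) (h0 : h 0 = 0)
    (hd : deriv h 0 ≠ 0) : map h (𝓝[≠] 0) = 𝓝[≠] 0 := by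
  have hs := ha.hasStrictDerivAt
  set g := hs.localInverse _ _ _ hd with hg
  have ga : AnalyticAt ℂ g (h 0) := ha.analyticAt_localInverse hd
  have g0 : g (h 0) = 0 := HasStrictFDerivAt.localInverse_apply_image ..
  have gd : HasStrictDerivAt g (deriv h 0)⁻¹ (h 0) := hs.to_localInverse hd
  have gr : ∀ᶠ t in 𝓝 (h 0), h (g t) = t := hs.eventually_right_inverse hd
  rw [h0] at ga g0 gd gr
  have h1 : Tendsto h (𝓝[≠] 0) (𝓝[≠] 0) := by
    simpa [h0] using hs.hasDerivAt.tendsto_nhdsNE hd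
  have h2 : Tendsto g (𝓝[≠] 0) (𝓝[≠] 0) := by
    simpa [g0] using gd.hasDerivAt.tendsto_nhdsNE (inv_ne_zero hd)
  refine le_antisymm h1 ?_
  have h3 : map (h ∘ g) (𝓝[≠] 0) = 𝓝[≠] 0 := by
    rw [map_congr (show (h ∘ g) =ᶠ[𝓝[≠] 0] id from gr.filter_mono nhdsWithin_le_nhds), map_id]
  calc 𝓝[≠] (0 : ℂ) = map h (map g (𝓝[≠] 0)) := by rw [map_map, h3]
    _ ≤ map h (𝓝[≠] 0) := map_mono h2

/-- The continuous extension `γ` of the logarithmic Gauss map to the normalization. -/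
def gaussExt {P : Laurent} (z : Normalization P) : OnePoint ℂ :=
  Quotient.lift
    (fun φ : BranchParam P => limUnder (𝓝[≠] (0 : ℂ)) fun t => gauss P (φ.toFun t))
    (by
      rintro φ ψ ⟨h, ha, h0, hd, he⟩
      have key : (fun t => gauss P (ψ.toFun t)) =ᶠ[𝓝[≠] 0]
          ((fun t => gauss P (φ.toFun t)) ∘ h) := by
        filter_upwards [he.filter_mono nhdsWithin_le_nhds] with t ht
        simp [ht]
      simp only [limUnder]
      rw [map_congr key, ← map_map, map_punctured_nhds ha h0 hd]) z

/-- `μ⁻¹(0, 0)`: the points of the normalization lying over the torus `|x| = |y| = 1`. -/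
def toricPoints (P : Laurent) : Set (Normalization P) := {z | mu z = (0, 0)}

/-- `P` is regular: `γ(z) ∉ ℙ¹(ℝ)` at every point `z` of the normalization over the torus. -/
def IsLogRegular (P : Laurent) : Prop :=
  ∀ z ∈ toricPoints P, gaussExt z ∉ Set.range (OnePoint.map ((↑) : ℝ → ℂ))

/-- `ε(z)`: minus the sign of `Im γ(z)` (for `γ(z) ≠ ∞`; the value at `∞` is irrelevant). -/
def epsilon {P : Laurent} (z : Normalization P) : ℝ :=
  -Real.sign ((gaussExt z).elim 0 Complex.im)

/-- `W` is the continuous extension of `V` from `C` to the normalization. -/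
def IsExtension (P : Laurent) (V : ℂ × ℂ → ℝ) (W : Normalization P → ℝ) : Prop :=
  ∀ φ : BranchParam P, Tendsto (fun t => V (φ.toFun t)) (𝓝[≠] 0) (𝓝 (W φ.point))

/-- `z` is a local maximum of the extension `W` of `V` to the normalization. -/
def IsLocalMaxAt {P : Laurent} (V : ℂ × ℂ → ℝ) (W : Normalization P → ℝ)
    (z : Normalization P) : Prop :=
  ∀ φ : BranchParam P, φ.point = z → ∀ᶠ t in 𝓝[≠] (0 : ℂ), V (φ.toFun t) ≤ W z

/-- `z` is a local minimum of the extension `W` of `V` to the normalization. -/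
def IsLocalMinAt {P : Laurent} (V : ℂ × ℂ → ℝ) (W : Normalization P → ℝ)
    (z : Normalization P) : Prop :=
  ∀ φ : BranchParam P, φ.point = z → ∀ᶠ t in 𝓝[≠] (0 : ℂ), W z ≤ V (φ.toFun t)

/-- `(i, j)` is a corner of the Newton polygon of `P`. -/
def IsCorner (P : Laurent) (n : ℤ × ℤ) : Prop :=
  ((n.1 : ℝ), (n.2 : ℝ)) ∈ Set.extremePoints ℝ
    (convexHull ℝ ((fun m : ℤ × ℤ => ((m.1 : ℝ), (m.2 : ℝ))) '' {m | P.coeff m ≠ 0}))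

/-- `log|P(e^{iθ}, e^{iφ})|` at `(θ, φ)`. -/
def logAbsOnTorus (P : Laurent) (a : ℝ × ℝ) : ℝ :=
  Real.log ‖eval P (Complex.exp (Complex.I * a.1), Complex.exp (Complex.I * a.2))‖

/-- The logarithmic Mahler measure `m(P)`. -/
def mahler (P : Laurent) : ℝ :=
  1 / (2 * Real.pi) ^ 2 *
    ∫ θ in (0 : ℝ)..(2 * Real.pi), ∫ φ in (0 : ℝ)..(2 * Real.pi), logAbsOnTorus P (θ, φ)

end MahlerVolume

end

/-! Let `n` be a corner of the Newton polygon. It is the unique maximum of a primitive integral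
linear form (`IsCorner.exists_int`). Completing that form to a matrix of determinant 1 gives
monomial coordinates `(X, Y)` in which `P` is a monomial times a polynomial in `X` over `ℂ[Y]` with
leading coefficient `c Y^m`, where `c` is the coefficient of `P` at `n`
(`exists_chart_of_forall_lt`). Such a change of coordinates preserves the torus, its Haar measure,
the form `η` and the sign of `Im γ`. On `|Y| = 1` the leading coefficient has constant modulus, so
Jensen's formula in `X` followed by integration over `Y` gives `m(P) = log |c| + (1/2π) ∫ Σ
log⁺|X|`, the sum being over the roots `X` above `Y = e^{is}` (`Chart.mahler_eq`).

On the circle `|Y| = 1` the form `η` reduces to `-log|X| d arg Y`. Hence the sum of `V` over the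
roots with `|X| > 1` has derivative `-Σ log⁺|X|` (`Chart.hasDerivAt_contribution`). This sum is a
periodic function of `s` that is differentiable away from finitely many jumps, and so the integral
is the sum of the jumps (`integral_eq_neg_sum_jumps`). A jump requires a root tending to the unit
circle, that is, a point `z` over the torus. There regularity says that `d log X / d log Y` has a
non-real limit `β`. Since `log|X|` is then about `-δ Im β` over `Y = y e^{iδ}`, the root crosses the
circle in the direction given by `ε(z) = -sign (Im β)` and contributes `ε(z) V(z)`
(`Chart.exists_tendsto_contribution`). Exactly `k(z)` roots tend to `z` along its branch, which
produces the factor `k(z)` (`Chart.sum_toricPoint`).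

The local statements rest on Puiseux parametrizations. The roots over a punctured disc form a
covering, they become single-valued on a half-plane, and the cycles of the monodromy correspond to
the branches (`PuiseuxData.exists_equivalent`, `Chart.branch_point_eq_iff`). The differential of `V`
along a branch is bounded, so `V` extends (`exists_tendsto_volume`). Integration of `η` along rays
from the centre shows that the extension has an extremum of the kind prescribed by `ε`
(`Chart.eventually_extension_le`).

Finally, the sum over the points of the torus does not involve the corner. Comparing the formulas
for two corners therefore shows that their coefficients have the same absolute value. -/

noncomputable section

/-! ### Roots of a holomorphic family of polynomials as a covering space. -/

namespace MahlerVolume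

open Polynomial in
/-- A family of complex polynomials of constant degree `d` whose coefficients are entire functions
of a parameter. -/
structure EntireFamily (b : ℂ → ℂ[X]) (d : ℕ) : Prop where
  differentiable_coeff : ∀ i, Differentiable ℂ fun w => (b w).coeff i
  natDegree_eq : ∀ w, (b w).natDegree = d
  ne_zero : ∀ w, b w ≠ 0

namespace EntireFamily

open Polynomial

variable {b : ℂ → ℂ[X]} {d : ℕ}

theorem contDiff_eval (hb : EntireFamily b d) :
    ContDiff ℂ 1 fun p : ℂ × ℂ => (b p.1).eval p.2 := by
  have : (fun p : ℂ × ℂ => (b p.1).eval p.2) =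
      fun p : ℂ × ℂ => ∑ i ∈ Finset.range (d + 1), (b p.1).coeff i * p.2 ^ i := by
    ext p
    rw [eval_eq_sum_range, hb.natDegree_eq]
  rw [this]
  refine ContDiff.sum fun i _ => ?_
  exact ((hb.differentiable_coeff i).contDiff.comp contDiff_fst).mul (contDiff_snd.pow i)

theorem continuous_eval (hb : EntireFamily b d) :
    Continuous fun p : ℂ × ℂ => (b p.1).eval p.2 := hb.contDiff_eval.continuous

/-- The Cauchy bound controls the roots. Replacing the supremum of the lower coefficients in it by
their sum gives a continuous function of `w`, because constant degree keeps the leading coefficient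
away from zero. -/
theorem exists_root_bound (hb : EntireFamily b d) {K : Set ℂ} (hK : IsCompact K) :
    ∃ R : ℝ, ∀ w ∈ K, ∀ x, (b w).eval x = 0 → ‖x‖ ≤ R := by
  have hl : ∀ w, (b w).leadingCoeff = (b w).coeff d := fun w => by
    rw [leadingCoeff, hb.natDegree_eq]
  have hl0 : ∀ w, (b w).coeff d ≠ 0 := fun w => by
    rw [← hl]; exact leadingCoeff_ne_zero.2 (hb.ne_zero w)
  have hc : Continuous fun w =>
      (∑ i ∈ Finset.range d, ‖(b w).coeff i‖) / ‖(b w).coeff d‖ + 1 := by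
    refine Continuous.add (Continuous.div ?_ ?_ ?_) continuous_const
    · exact continuous_finsetSum _ fun i _ => (hb.differentiable_coeff i).continuous.norm
    · exact (hb.differentiable_coeff d).continuous.norm
    · exact fun w => norm_ne_zero_iff.2 (hl0 w)
  obtain ⟨R, hR⟩ := hK.exists_bound_of_continuousOn hc.continuousOn
  refine ⟨R, fun w hw x hx => ?_⟩
  have h1 := IsRoot.norm_lt_cauchyBound (hb.ne_zero w) (a := x) hx
  refine (le_trans ?_ ((le_abs_self _).trans (hR w hw)))
  refine (show ‖x‖ ≤ cauchyBound (b w) from h1.le).trans ?_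
  rw [cauchyBound, hb.natDegree_eq, hl]
  push_cast
  gcongr
  have h2 : (Finset.range d).sup (fun i => ‖(b w).coeff i‖₊) ≤
      ∑ i ∈ Finset.range d, ‖(b w).coeff i‖₊ :=
    Finset.sup_le fun i hi =>
      Finset.single_le_sum (f := fun i => ‖(b w).coeff i‖₊) (fun _ _ => zero_le) hi
  simpa using NNReal.coe_le_coe.2 h2

/-- The total space of the roots of the family. -/
abbrev zeroSet (b : ℂ → ℂ[X]) : Set (ℂ × ℂ) := {p | (b p.1).eval p.2 = 0}

/-- The projection is proper: over a compact set the roots are bounded, so its preimage is closed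
and bounded. -/
theorem isClosedMap_fst (hb : EntireFamily b d) :
    IsClosedMap fun p : zeroSet b => p.1.1 := by
  have hcont : Continuous fun p : zeroSet b => p.1.1 := by fun_prop
  refine IsProperMap.isClosedMap ?_
  refine isProperMap_iff_isCompact_preimage.2 ⟨hcont, fun {K} hK => ?_⟩
  obtain ⟨R, hR⟩ := hb.exists_root_bound hK
  rw [Subtype.isCompact_iff]
  have hc : IsCompact ((K ×ˢ Metric.closedBall (0 : ℂ) R) ∩ zeroSet b) :=
    (hK.prod (isCompact_closedBall _ _)).inter_right
      (isClosed_eq hb.continuous_eval continuous_const)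
  convert hc using 1
  ext p
  simp only [Set.mem_image, Set.mem_preimage, Subtype.exists, Set.mem_inter_iff, Set.mem_prod,
    Metric.mem_closedBall, dist_zero_right]
  constructor
  · rintro ⟨a, ha, haK, rfl⟩
    exact ⟨⟨haK, hR _ haK _ ha⟩, ha⟩
  · rintro ⟨⟨h1, h2⟩, h3⟩
    exact ⟨p, h3, h1, rfl⟩

/-- The set of parameters for which all roots are simple. -/
def simpleSet (b : ℂ → ℂ[X]) : Set ℂ :=
  {w | ∀ x, (b w).eval x = 0 → (b w).derivative.eval x ≠ 0}

theorem hasStrictFDerivAt_eval (hb : EntireFamily b d) (p : ℂ × ℂ) :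
    HasStrictFDerivAt (fun p : ℂ × ℂ => (b p.1).eval p.2)
      (fderiv ℂ (fun p : ℂ × ℂ => (b p.1).eval p.2) p) p :=
  hb.contDiff_eval.contDiffAt.hasStrictFDerivAt one_ne_zero

theorem fderiv_eval_inr (hb : EntireFamily b d) (p : ℂ × ℂ) :
    (fderiv ℂ (fun p : ℂ × ℂ => (b p.1).eval p.2) p) (0, 1) = (b p.1).derivative.eval p.2 := by
  have h1 : HasDerivAt (fun x : ℂ => (p.1, x)) ((0, 1) : ℂ × ℂ) p.2 :=
    (hasDerivAt_const _ _).prodMk (hasDerivAt_id _)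
  have h2 := (hb.hasStrictFDerivAt_eval p).hasFDerivAt.comp_hasDerivAt p.2 h1
  exact h2.unique ((b p.1).hasDerivAt p.2)

theorem isInvertible_fderiv_comp_inr (hb : EntireFamily b d) {p : ℂ × ℂ}
    (hp : (b p.1).derivative.eval p.2 ≠ 0) :
    ((fderiv ℂ (fun p : ℂ × ℂ => (b p.1).eval p.2) p) ∘L .inr ℂ ℂ ℂ).IsInvertible := by
  refine ⟨ContinuousLinearEquiv.smulLeft (Units.mk0 _ hp), ?_⟩
  ext
  simp [hb.fderiv_eval_inr]

/-- This is the implicit function theorem at a simple root: `(w, x) ↦ (b_w(x), w)` is a local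
homeomorphism, and restricting it to first coordinate `0` gives a chart of the total space. -/
theorem isLocalHomeomorphOn_fst (hb : EntireFamily b d) :
    IsLocalHomeomorphOn (fun p : zeroSet b => p.1.1)
      ((fun p : zeroSet b => p.1.1) ⁻¹' simpleSet b) := by
  rintro e he
  have hinv := hb.isInvertible_fderiv_comp_inr (he e.1.2 e.2)
  set D := (hb.hasStrictFDerivAt_eval e.1).implicitFunctionDataOfProdDomain hinv with hD
  set Φ := D.toOpenPartialHomeomorph with hΦ
  have hΦa : ∀ v, Φ v = ((b v.1).eval v.2, v.1) := fun v => rfl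
  have hs : ∀ w, (0, w) ∈ Φ.target → (Φ.symm (0, w)).1 = w ∧ Φ.symm (0, w) ∈ zeroSet b := by
    intro w hw
    have := Φ.right_inv hw
    rw [hΦa, Prod.mk.injEq] at this
    exact ⟨this.2, this.1⟩
  classical
  let g : ℂ → zeroSet b := fun w => if h : (0, w) ∈ Φ.target then ⟨_, (hs w h).2⟩ else e
  refine ⟨{ toFun := fun p => p.1.1
            invFun := g
            source := {p | p.1 ∈ Φ.source}
            target := {w | (0, w) ∈ Φ.target}
            map_source' := ?_
            map_target' := ?_
            left_inv' := ?_
            right_inv' := ?_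
            open_source := Φ.open_source.preimage continuous_subtype_val
            open_target := Φ.open_target.preimage (by fun_prop)
            continuousOn_toFun := by fun_prop
            continuousOn_invFun := ?_ }, ?_, rfl⟩
  · intro p hp
    have := Φ.map_source hp
    rw [hΦa] at this
    have hp0 : (b p.1.1).eval p.1.2 = 0 := p.2
    rwa [hp0] at this
  · intro w hw
    have hw' : (0, w) ∈ Φ.target := hw
    simp only [g, dif_pos hw', Set.mem_ofPred_eq]
    exact Φ.map_target hw
  · intro p hp
    have h1 := Φ.map_source hp
    have h2 := Φ.left_inv hp
    have hp0 : (b p.1.1).eval p.1.2 = 0 := p.2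
    rw [hΦa, hp0] at h1 h2
    simp only [g, dif_pos h1]
    exact Subtype.ext h2
  · intro w hw
    have hw' : (0, w) ∈ Φ.target := hw
    simp only [g, dif_pos hw']
    exact (hs w hw).1
  · rw [Topology.IsInducing.subtypeVal.continuousOn_iff]
    have : ContinuousOn (fun w : ℂ => Φ.symm (0, w)) {w | (0, w) ∈ Φ.target} :=
      Φ.continuousOn_symm.comp (by fun_prop) fun w hw => hw
    refine this.congr fun w hw => ?_
    have hw' : (0, w) ∈ Φ.target := hw
    simp only [g, Function.comp, dif_pos hw']
  · exact D.pt_mem_toOpenPartialHomeomorph_source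

/-- A closed local homeomorphism with finite fibres is a covering map. -/
theorem isCoveringMapOn_fst (hb : EntireFamily b d) :
    IsCoveringMapOn (fun p : zeroSet b => p.1.1) (simpleSet b) := by
  refine hb.isClosedMap_fst.isCoveringMapOn_of_isLocalHomeomorphOn (fun w _ => ?_)
    hb.isLocalHomeomorphOn_fst
  have hf : {x | (b w).eval x = 0}.Finite := by
    refine (b w).roots.toFinset.finite_toSet.subset fun x hx => ?_
    simpa [hb.ne_zero w] using hx
  refine Set.Finite.of_finite_image (f := fun p : zeroSet b => p.1.2) (hf.subset ?_) ?_
  · rintro _ ⟨p, hp, rfl⟩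
    have hp' : p.1.1 = w := hp
    have := p.2
    rw [← hp']
    exact this
  · intro p hp q hq h
    exact Subtype.ext (Prod.ext (hp.trans hq.symm) h)

theorem differentiableAt_root (hb : EntireFamily b d) {ω x : ℂ → ℂ} {τ : ℂ}
    (hω : DifferentiableAt ℂ ω τ) (hx : ContinuousAt x τ)
    (hroot : ∀ᶠ t in 𝓝 τ, (b (ω t)).eval (x t) = 0) (hs : ω τ ∈ simpleSet b) :
    DifferentiableAt ℂ x τ := by
  have h0 := hroot.self_of_nhds
  have hinv := hb.isInvertible_fderiv_comp_inr (p := (ω τ, x τ)) (hs _ h0)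
  have hf := hb.hasStrictFDerivAt_eval (ω τ, x τ)
  have hψ := (hf.hasStrictFDerivAt_implicitFunctionOfProdDomain hinv).hasFDerivAt.differentiableAt
  have hev := hf.eventually_apply_eq_iff_implicitFunctionOfProdDomain hinv
  refine (hψ.comp τ hω).congr_of_eventuallyEq ?_
  have ht : Tendsto (fun t => (ω t, x t)) (𝓝 τ) (𝓝 (ω τ, x τ)) :=
    (hω.continuousAt.prodMk hx).tendsto
  filter_upwards [ht.eventually hev, hroot] with t h1 h2
  exact (h1.1 (h2.trans h0.symm)).symm

/-- An open convex set is simply connected and locally path connected, so `ω` lifts to the covering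
of roots from any prescribed starting point. -/
theorem exists_root_through (hb : EntireFamily b d) {S : Set ℂ} (hS : IsOpen S) (hc : Convex ℝ S)
    {ω : ℂ → ℂ} (hω : Differentiable ℂ ω) (hs : ∀ τ ∈ S, ω τ ∈ simpleSet b)
    {τ₀ x₀ : ℂ} (h₀ : τ₀ ∈ S) (hx₀ : (b (ω τ₀)).eval x₀ = 0) :
    ∃ x : ℂ → ℂ, ContinuousOn x S ∧ (∀ τ ∈ S, (b (ω τ)).eval (x τ) = 0) ∧ x τ₀ = x₀ := by
  have : ContractibleSpace S := hc.contractibleSpace ⟨τ₀, h₀⟩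
  have : LocallyPathConnectedSpace S := hS.locallyPathConnectedSpace
  obtain ⟨F, ⟨hF0, hF⟩, -⟩ := hb.isCoveringMapOn_fst.existsUnique_continuousMap_lifts
    (⟨fun τ : S => ω τ, by have := hω.continuous; fun_prop⟩ : C(S, ℂ)) (a₀ := ⟨τ₀, h₀⟩)
    (e₀ := ⟨(ω τ₀, x₀), hx₀⟩) rfl (fun a => hs _ a.2)
  classical
  have hF' : ∀ a : S, (F a).1.1 = ω a := fun a => congrFun hF a
  refine ⟨fun τ => if h : τ ∈ S then (F ⟨τ, h⟩).1.2 else 0, ?_, fun τ hτ => ?_, ?_⟩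
  · rw [continuousOn_iff_continuous_domRestrict]
    have : Continuous fun a : S => (F a).1.2 := by fun_prop
    convert this using 2 with a
    simp
  · simp only [dif_pos hτ]
    have := (F ⟨τ, hτ⟩).2
    rw [← hF' ⟨τ, hτ⟩]
    exact this
  · simp only [dif_pos h₀, hF0]

/-- Uniqueness of lifts: two continuous choices of root that agree at one point are the same lift.
-/
theorem eqOn_of_roots (hb : EntireFamily b d) {S : Set ℂ} (hS : IsOpen S) (hc : Convex ℝ S)
    {ω : ℂ → ℂ} (hω : Differentiable ℂ ω) (hs : ∀ τ ∈ S, ω τ ∈ simpleSet b)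
    {x y : ℂ → ℂ} (hx : ContinuousOn x S) (hy : ContinuousOn y S)
    (hxr : ∀ τ ∈ S, (b (ω τ)).eval (x τ) = 0) (hyr : ∀ τ ∈ S, (b (ω τ)).eval (y τ) = 0)
    {τ₀ : ℂ} (h₀ : τ₀ ∈ S) (h : x τ₀ = y τ₀) : Set.EqOn x y S := by
  have : ContractibleSpace S := hc.contractibleSpace ⟨τ₀, h₀⟩
  have : LocallyPathConnectedSpace S := hS.locallyPathConnectedSpace
  obtain ⟨F, -, hF⟩ := hb.isCoveringMapOn_fst.existsUnique_continuousMap_lifts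
    (⟨fun τ : S => ω τ, by have := hω.continuous; fun_prop⟩ : C(S, ℂ)) (a₀ := ⟨τ₀, h₀⟩)
    (e₀ := ⟨(ω τ₀, x τ₀), hxr _ h₀⟩) rfl (fun a => hs _ a.2)
  have key : ∀ z : ℂ → ℂ, ContinuousOn z S → (hz : ∀ τ ∈ S, (b (ω τ)).eval (z τ) = 0) →
      z τ₀ = x τ₀ → ∀ a : S, z a = (F a).1.2 := by
    intro z hzc hz hz0 a
    have hcont : Continuous fun a : S => (⟨(ω a, z a), hz a a.2⟩ : zeroSet b) := by
      have h1 := hω.continuous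
      have h2 : Continuous fun a : S => z a := continuousOn_iff_continuous_domRestrict.1 hzc
      exact Continuous.subtype_mk ((h1.comp continuous_subtype_val).prodMk h2) _
    have := hF ⟨_, hcont⟩ ⟨Subtype.ext (Prod.ext rfl hz0), rfl⟩
    rw [← this]
    rfl
  intro τ hτ
  rw [key x hx hxr rfl ⟨τ, hτ⟩, key y hy hyr h.symm ⟨τ, hτ⟩]

theorem card_roots_of_simple (hb : EntireFamily b d) {w : ℂ} (hw : w ∈ simpleSet b) :
    (b w).roots.Nodup ∧ (b w).roots.toFinset.card = d := by
  have hn : (b w).roots.Nodup := by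
    rw [Multiset.nodup_iff_count_le_one]
    intro x
    rw [count_roots]
    by_contra! h
    have h1 := (one_lt_rootMultiplicity_iff_isRoot (hb.ne_zero w)).1 h
    exact hw x h1.1 h1.2
  refine ⟨hn, ?_⟩
  rw [Multiset.toFinset_card_of_nodup hn, ← hb.natDegree_eq w]
  exact (IsAlgClosed.splits (b w)).natDegree_eq_card_roots.symm

/-- On an open convex set where all the roots are simple, the roots are given by holomorphic
functions. -/
theorem exists_root_functions (hb : EntireFamily b d) {S : Set ℂ} (hS : IsOpen S)
    (hc : Convex ℝ S) {ω : ℂ → ℂ} (hω : Differentiable ℂ ω)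
    (hs : ∀ τ ∈ S, ω τ ∈ simpleSet b) :
    ∃ x : Fin d → ℂ → ℂ, (∀ j, DifferentiableOn ℂ (x j) S) ∧
      (∀ τ ∈ S, Function.Injective fun j => x j τ) ∧
      ∀ τ ∈ S, ∀ z, (b (ω τ)).eval z = 0 ↔ ∃ j, x j τ = z := by
  rcases S.eq_empty_or_nonempty with rfl | ⟨τ₀, h₀⟩
  · exact ⟨fun _ _ => 0, by simp⟩
  have e : (b (ω τ₀)).roots.toFinset ≃ Fin d :=
    Finset.equivFinOfCardEq (hb.card_roots_of_simple (hs τ₀ h₀)).2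
  have hroot : ∀ j, (b (ω τ₀)).eval (e.symm j : ℂ) = 0 := fun j => by
    have := (e.symm j).2
    rw [Multiset.mem_toFinset, mem_roots (hb.ne_zero _)] at this
    exact this
  choose x hxc hxr hx0 using fun j => hb.exists_root_through hS hc hω hs h₀ (hroot j)
  have hinj : ∀ τ ∈ S, Function.Injective fun j => x j τ := by
    intro τ hτ i j hij
    have := hb.eqOn_of_roots hS hc hω hs (hxc i) (hxc j) (hxr i) (hxr j) hτ hij h₀
    rw [hx0, hx0] at this
    exact e.symm.injective (Subtype.ext this)
  refine ⟨x, fun j τ hτ => ?_, hinj, fun τ hτ z => ⟨fun hz => ?_, ?_⟩⟩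
  · refine (hb.differentiableAt_root (hω τ) ((hxc j).continuousAt (hS.mem_nhds hτ)) ?_
      (hs τ hτ)).differentiableWithinAt
    filter_upwards [hS.mem_nhds hτ] with t ht using hxr j t ht
  · have h1 : Finset.univ.image (fun j => x j τ) = (b (ω τ)).roots.toFinset := by
      refine Finset.eq_of_subset_of_card_le ?_ ?_
      · intro y hy
        obtain ⟨j, -, rfl⟩ := Finset.mem_image.1 hy
        rw [Multiset.mem_toFinset, mem_roots (hb.ne_zero _)]
        exact hxr j τ hτ
      · rw [(hb.card_roots_of_simple (hs τ hτ)).2, Finset.card_image_of_injective _ (hinj τ hτ)]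
        simp
    have h2 : z ∈ (b (ω τ)).roots.toFinset := by
      rw [Multiset.mem_toFinset, mem_roots (hb.ne_zero _)]
      exact hz
    rw [← h1] at h2
    simpa using h2
  · rintro ⟨j, rfl⟩
    exact hxr j τ hτ

end EntireFamily

end MahlerVolume

/-! ### Puiseux parametrizations and monodromy. -/

namespace MahlerVolume

open Polynomial Function.Periodic

local notation "I∞" => comap Complex.im atTop

/-- The roots of a family of polynomials as multivalued holomorphic functions of `w ≠ 0` close to
`0`, in terms of `τ` with `w = exp (2πiτ)`; the permutation `σ` is the monodromy. -/
structure PuiseuxData (b : ℂ → ℂ[X]) (d : ℕ) where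
  A : ℝ
  x : Fin d → ℂ → ℂ
  σ : Equiv.Perm (Fin d)
  simple : ∀ τ : ℂ, A < τ.im → qParam 1 τ ∈ EntireFamily.simpleSet b
  differentiableAt : ∀ j, ∀ τ : ℂ, A < τ.im → DifferentiableAt ℂ (x j) τ
  injective : ∀ τ : ℂ, A < τ.im → Function.Injective fun j => x j τ
  eval_eq_zero_iff : ∀ τ : ℂ, A < τ.im → ∀ z, (b (qParam 1 τ)).eval z = 0 ↔ ∃ j, x j τ = z
  shift : ∀ j τ, x j (τ + 1) = x (σ j) τ

theorem isOpen_lt_im (A : ℝ) : IsOpen {τ : ℂ | A < τ.im} :=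
  isOpen_lt continuous_const Complex.continuous_im

/-- A half-plane `Im τ > A` is the universal cover of a punctured disc through `w = exp(2πiτ)`, so
the roots are single-valued there. Translation by 1 is the loop around `w = 0`; by uniqueness of
lifts it permutes the root functions. -/
theorem EntireFamily.exists_puiseuxData {b : ℂ → ℂ[X]} {d : ℕ} (hb : EntireFamily b d)
    (hs : ∀ᶠ w in 𝓝[≠] 0, w ∈ EntireFamily.simpleSet b) : Nonempty (PuiseuxData b d) := by
  obtain ⟨A, -, hA⟩ := (atTop_basis_Ioi.comap Complex.im).eventually_iff.1
    ((qParam_tendsto (h := 1) one_pos).eventually hs)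
  have hA' : ∀ τ : ℂ, A < τ.im → qParam 1 τ ∈ EntireFamily.simpleSet b := fun τ h => hA h
  set S : Set ℂ := {τ : ℂ | A < τ.im} with hSdef
  have hS : IsOpen S := isOpen_lt_im A
  have hc : Convex ℝ S := convex_halfSpace_im_gt A
  have hω : Differentiable ℂ (qParam 1) := differentiable_qParam
  obtain ⟨x, hxd, hxi, hxr⟩ := hb.exists_root_functions hS hc hω hA'
  have hper : ∀ τ, qParam 1 (τ + 1) = qParam 1 τ := by
    intro τ
    simp only [qParam]
    rw [Complex.exp_eq_exp_iff_exists_int]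
    exact ⟨1, by push_cast; ring⟩
  have hmem : ∀ τ ∈ S, τ + 1 ∈ S := fun τ hτ => by simpa [S] using hτ
  set τ₀ : ℂ := (A + 1) * Complex.I
  have h₀ : τ₀ ∈ S := by simp [S, τ₀]
  have hex : ∀ j, ∃ i, Set.EqOn (fun τ => x j (τ + 1)) (x i) S := by
    intro j
    have hr : ∀ τ ∈ S, (b (qParam 1 τ)).eval (x j (τ + 1)) = 0 := fun τ hτ => by
      rw [← hper]
      exact (hxr _ (hmem τ hτ) _).2 ⟨j, rfl⟩
    obtain ⟨i, hi⟩ := (hxr τ₀ h₀ _).1 (hr τ₀ h₀)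
    refine ⟨i, hb.eqOn_of_roots hS hc hω hA' ?_ (hxd i).continuousOn hr
      (fun τ hτ => (hxr τ hτ _).2 ⟨i, rfl⟩) h₀ hi.symm⟩
    exact (hxd j).continuousOn.comp (by fun_prop) hmem
  choose s hs using hex
  have hsi : Function.Injective s := by
    intro i j hij
    have h1 := hs i h₀
    have h2 := hs j h₀
    rw [← hij] at h2
    exact hxi _ (hmem _ h₀) (h1.trans h2.symm)
  classical
  -- The root functions are set to `0` outside the half-plane. As the half-plane and its complement
  -- are both stable under `τ ↦ τ + 1`, the shift relation then holds for every `τ`.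
  have hif : ∀ j, ∀ τ ∈ S, (fun τ => if τ ∈ S then x j τ else 0) τ = x j τ := fun j τ h => if_pos h
  refine ⟨{ A := A
            x := fun j τ => if τ ∈ S then x j τ else 0
            σ := Equiv.ofBijective s (Finite.injective_iff_bijective.1 hsi)
            simple := hA'
            differentiableAt := fun j τ hτ => ?_
            injective := fun τ hτ i j hij => ?_
            eval_eq_zero_iff := fun τ hτ z => ?_
            shift := fun j τ => ?_ }⟩
  · refine ((hxd j).differentiableAt (hS.mem_nhds hτ)).congr_of_eventuallyEq ?_
    filter_upwards [hS.mem_nhds hτ] with t ht using hif j t ht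
  · have h1 := hif i τ hτ
    have h2 := hif j τ hτ
    exact hxi τ hτ (h1.symm.trans (hij.trans h2))
  · rw [hxr τ hτ z]
    have : τ ∈ S := hτ
    simp [this]
  · by_cases h : τ ∈ S
    · have h' := hmem τ h
      simp only [h, h', if_true]
      exact hs j h
    · have h' : τ + 1 ∉ S := by simpa [S] using h
      simp only [h, h', if_false]

namespace PuiseuxData

variable {b : ℂ → ℂ[X]} {d : ℕ} (D : PuiseuxData b d)

/-- The ramification index of the `j`-th root. -/
def k (j : Fin d) : ℕ := Function.minimalPeriod D.σ j

theorem k_pos (j : Fin d) : 0 < D.k j :=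
  Function.minimalPeriod_pos_of_mem_periodicPts
    (Function.Injective.mem_periodicPts D.σ.injective j)

theorem shift_nat (j : Fin d) (τ : ℂ) (n : ℕ) : D.x j (τ + n) = D.x (D.σ^[n] j) τ := by
  induction n generalizing j with
  | zero => simp
  | succ n ih => rw [Nat.cast_add, Nat.cast_one, ← add_assoc, D.shift, ih, Function.iterate_succ_apply]

theorem periodic (j : Fin d) : Function.Periodic (D.x j) ((D.k j : ℝ) : ℂ) := by
  intro τ
  have := D.shift_nat j τ (D.k j)
  rw [show D.σ^[D.k j] j = j from Function.iterate_minimalPeriod] at this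
  exact_mod_cast this

/-- The `j`-th root as a holomorphic function of `w ^ (1 / k)`. -/
def X (j : Fin d) : ℂ → ℂ := cuspFunction (D.k j) (D.x j)

theorem k_pos' (j : Fin d) : (0 : ℝ) < D.k j := Nat.cast_pos.2 (D.k_pos j)

theorem X_qParam (j : Fin d) (τ : ℂ) : D.X j (qParam (D.k j) τ) = D.x j τ :=
  eq_cuspFunction (D.k_pos' j).ne' (D.periodic j) τ

theorem qParam_pow (j : Fin d) (τ : ℂ) : qParam (D.k j) τ ^ D.k j = qParam 1 τ := by
  have := (D.k_pos' j).ne'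
  simp only [qParam]
  rw [← Complex.exp_nat_mul]
  congr 1
  have : ((D.k j : ℝ) : ℂ) ≠ 0 := by exact_mod_cast this
  push_cast at this ⊢
  field_simp

theorem eventually_lt_im (A : ℝ) : ∀ᶠ τ : ℂ in I∞, A < τ.im :=
  tendsto_comap.eventually (eventually_gt_atTop A)

/-- The `j`-th root is holomorphic and `k`-periodic on the half-plane, hence a holomorphic function
of `exp(2πiτ/k)` on a punctured disc. It is bounded, so the singularity at the centre is removable.
-/
theorem analyticAt_X (hb : EntireFamily b d) (j : Fin d) : AnalyticAt ℂ (D.X j) 0 := by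
  have h1 : ∀ᶠ τ in I∞, DifferentiableAt ℂ (D.x j) τ :=
    (eventually_lt_im D.A).mono fun τ hτ => D.differentiableAt j τ hτ
  obtain ⟨R, hR⟩ := hb.exists_root_bound (isCompact_closedBall (0 : ℂ) 1)
  have h2 : BoundedAtFilter I∞ (D.x j) := by
    refine Asymptotics.IsBigO.of_bound R ?_
    filter_upwards [eventually_lt_im D.A, eventually_lt_im 0] with τ h3 h4
    simp only [Pi.one_apply, norm_one, mul_one]
    refine hR (qParam 1 τ) ?_ _ ((D.eval_eq_zero_iff τ h3 _).2 ⟨j, rfl⟩)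
    simpa using (norm_qParam_lt_one (h := 1) one_pos h4).le
  rw [Complex.analyticAt_iff_eventually_differentiableAt]
  have h3 := differentiableAt_cuspFunction_zero (D.k_pos' j) (D.periodic j) h1 h2
  have h4 := eventually_differentiableAt_cuspFunction_nhds_ne_zero (D.k_pos' j) (D.periodic j) h1
  rw [eventually_nhdsWithin_iff] at h4
  filter_upwards [h4] with t ht
  by_cases h : t = 0
  · rw [h]; exact h3
  · exact ht h

/-- A small punctured disc is parametrized by a half-plane. -/
theorem eventually_exists_qParam (j : Fin d) (A : ℝ) :
    ∀ᶠ t in 𝓝[≠] (0 : ℂ), ∃ τ : ℂ, A < τ.im ∧ qParam (D.k j) τ = t := by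
  filter_upwards [(invQParam_tendsto (D.k_pos' j)).eventually (eventually_lt_im A),
    self_mem_nhdsWithin] with t h1 h2
  exact ⟨_, h1, qParam_right_inv (D.k_pos' j).ne' h2⟩

theorem eval_X (hb : EntireFamily b d) (j : Fin d) :
    ∀ᶠ t in 𝓝 (0 : ℂ), (b (t ^ D.k j)).eval (D.X j t) = 0 := by
  have h1 : ∀ᶠ t in 𝓝[≠] (0 : ℂ), (b (t ^ D.k j)).eval (D.X j t) = 0 := by
    filter_upwards [D.eventually_exists_qParam j D.A] with t ⟨τ, hτ, ht⟩
    rw [← ht, D.qParam_pow, D.X_qParam]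
    exact (D.eval_eq_zero_iff τ hτ _).2 ⟨j, rfl⟩
  have hc : ContinuousAt (fun t => (b (t ^ D.k j)).eval (D.X j t)) 0 :=
    ContinuousAt.comp (f := fun t => (t ^ D.k j, D.X j t)) hb.continuous_eval.continuousAt
      ((continuous_pow _).continuousAt.prodMk (D.analyticAt_X hb j).continuousAt)
  have h0 : (b (0 ^ D.k j)).eval (D.X j 0) = 0 := by
    refine tendsto_nhds_unique (hc.tendsto.mono_left nhdsWithin_le_nhds) ?_ (l := 𝓝[≠] (0 : ℂ))
    exact tendsto_const_nhds.congr' (h1.mono fun t ht => ht.symm)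
  rw [eventually_nhdsWithin_iff] at h1
  filter_upwards [h1] with t ht
  by_cases h : t = 0
  · rw [h]; exact h0
  · exact ht h

theorem eventually_simple (j : Fin d) :
    ∀ᶠ t in 𝓝[≠] (0 : ℂ), t ^ D.k j ∈ EntireFamily.simpleSet b := by
  filter_upwards [D.eventually_exists_qParam j D.A] with t ⟨τ, hτ, ht⟩
  rw [← ht, D.qParam_pow]
  exact D.simple τ hτ

theorem qParam_eq_iff {h : ℝ} (hh : h ≠ 0) {τ τ' : ℂ} :
    qParam h τ = qParam h τ' ↔ ∃ n : ℤ, τ = τ' + n * h := by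
  have hh' : (h : ℂ) ≠ 0 := by exact_mod_cast hh
  have hp : (2 * Real.pi * Complex.I : ℂ) ≠ 0 := Complex.two_pi_I_ne_zero
  simp only [qParam]
  rw [Complex.exp_eq_exp_iff_exists_int]
  refine exists_congr fun n => ?_
  rw [div_eq_iff hh', add_mul, div_mul_cancel₀ _ hh']
  constructor
  · intro h
    apply mul_left_cancel₀ hp
    linear_combination h
  · rintro rfl
    ring

theorem shift_int (j : Fin d) (τ : ℂ) (n : ℤ) : D.x j (τ + n) = D.x ((D.σ ^ n) j) τ := by
  obtain ⟨n, rfl | rfl⟩ := n.eq_nat_or_neg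
  · rw [zpow_natCast, ← Equiv.Perm.iterate_eq_pow]
    exact_mod_cast D.shift_nat j τ n
  · have h1 := D.shift_nat ((D.σ ^ (-(n : ℤ))) j) (τ + (-(n : ℤ) : ℤ)) n
    rw [Equiv.Perm.iterate_eq_pow, ← zpow_natCast, ← Equiv.Perm.mul_apply, ← zpow_add] at h1
    simpa using h1.symm

theorem minimalPeriod_dvd_of_zpow {σ : Equiv.Perm (Fin d)} {j : Fin d} {n : ℤ}
    (h : (σ ^ n) j = j) : (Function.minimalPeriod σ j : ℤ) ∣ n := by
  have h2 : (σ ^ n.natAbs) j = j := by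
    rcases Int.natAbs_eq n with hn | hn
    · rw [hn, zpow_natCast] at h
      exact h
    · rw [hn, zpow_neg, zpow_natCast, Equiv.Perm.inv_eq_iff_eq] at h
      exact h.symm
  rw [← Int.dvd_natAbs, Int.natCast_dvd_natCast]
  refine Function.IsPeriodicPt.minimalPeriod_dvd ?_
  rw [Function.IsPeriodicPt, Equiv.Perm.iterate_eq_pow]
  exact h2

/-- `(w, x)` determines the parameter `t` on the branch. -/
theorem eventually_injOn (j : Fin d) :
    ∃ U ∈ 𝓝 (0 : ℂ), Set.InjOn (fun t => (D.X j t, t ^ D.k j)) U := by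
  obtain ⟨U, hU⟩ : ∃ U ∈ 𝓝 (0 : ℂ), ∀ t ∈ U, t ≠ 0 →
      ∃ τ : ℂ, D.A < τ.im ∧ qParam (D.k j) τ = t := by
    have := D.eventually_exists_qParam j D.A
    rw [eventually_nhdsWithin_iff] at this
    exact ⟨_, this, fun t ht h => ht h⟩
  refine ⟨U, hU.1, fun t ht t' ht' h => ?_⟩
  simp only [Prod.mk.injEq] at h
  have hk := (D.k_pos j).ne'
  by_cases h0 : t = 0
  · rw [h0, zero_pow hk] at h
    rw [h0, eq_comm]
    exact pow_eq_zero_iff hk |>.1 h.2.symm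
  have h0' : t' ≠ 0 := by
    rintro rfl
    rw [zero_pow hk] at h
    exact h0 (pow_eq_zero_iff hk |>.1 h.2)
  obtain ⟨τ, hτ, rfl⟩ := hU.2 t ht h0
  obtain ⟨τ', hτ', rfl⟩ := hU.2 t' ht' h0'
  rw [D.qParam_pow, D.qParam_pow, qParam_eq_iff one_ne_zero, D.X_qParam, D.X_qParam] at h
  obtain ⟨h1, n, rfl⟩ := h
  simp only [Complex.ofReal_one, mul_one] at h1 hτ ⊢
  rw [D.shift_int] at h1
  -- The two values of `τ` differ by an integer `n` and give the same root. The roots being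
  -- distinct, `σ^n` fixes `j`, so `k` divides `n` and the two parameters `exp(2πiτ/k)` coincide.
  obtain ⟨l, hl⟩ := minimalPeriod_dvd_of_zpow (D.injective τ' hτ' h1)
  rw [qParam_eq_iff (D.k_pos' j).ne']
  exact ⟨l, by rw [hl]; push_cast; rw [k]; ring⟩

end PuiseuxData

end MahlerVolume

/-! ### Classification of local parametrizations. -/

namespace MahlerVolume

open Polynomial Function.Periodic

local notation "I∞" => comap Complex.im atTop

/-- A germ vanishing to finite positive order is a power of a local coordinate. -/
theorem exists_pow_eq {w : ℂ → ℂ} (hw : AnalyticAt ℂ w 0) (h0 : w 0 = 0)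
    (hne : ¬ ∀ᶠ t in 𝓝 0, w t = 0) :
    ∃ (e : ℕ) (s : ℂ → ℂ), 0 < e ∧ AnalyticAt ℂ s 0 ∧ s 0 = 0 ∧ deriv s 0 ≠ 0 ∧
      ∀ᶠ t in 𝓝 0, s t ^ e = w t := by
  obtain ⟨e, g, hg, hg0, hgw⟩ := hw.exists_eventuallyEq_pow_smul_nonzero_iff.2 hne
  have he : e ≠ 0 := by
    rintro rfl
    have := hgw.self_of_nhds
    simp only [h0, pow_zero, one_smul] at this
    exact hg0 this.symm
  obtain ⟨c, hc⟩ := IsAlgClosed.exists_pow_nat_eq (g 0) (Nat.pos_of_ne_zero he)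
  have hc0 : c ≠ 0 := by
    rintro rfl
    rw [zero_pow he] at hc
    exact hg0 hc.symm
  -- The quotient `g / g(0)` is near `1`, where the principal branch of the `e`-th root is analytic;
  -- the constant `c` restores the value `g(0)`.
  have hr : AnalyticAt ℂ (fun t => c * (g t / g 0) ^ ((e : ℂ)⁻¹)) 0 := by
    refine analyticAt_const.mul ((hg.div analyticAt_const hg0).cpow analyticAt_const ?_)
    simp [hg0]
  refine ⟨e, fun t => t * (c * (g t / g 0) ^ ((e : ℂ)⁻¹)), Nat.pos_of_ne_zero he,
    analyticAt_id.mul hr, by simp, ?_, ?_⟩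
  · have := (hasDerivAt_id (0 : ℂ)).mul hr.differentiableAt.hasDerivAt
    rw [show deriv (fun t => t * (c * (g t / g 0) ^ ((e : ℂ)⁻¹))) 0 = _ from HasDerivAt.deriv this]
    simp [hg0, hc0]
  · filter_upwards [hgw] with t ht
    rw [ht, mul_pow, mul_pow, Complex.cpow_nat_inv_pow _ he, hc, sub_zero, smul_eq_mul,
      mul_div_cancel₀ _ hg0]

/-- A local coordinate has a local inverse. -/
theorem exists_local_inverse {h : ℂ → ℂ} (ha : AnalyticAt ℂ h 0) (h0 : h 0 = 0)
    (hd : deriv h 0 ≠ 0) : ∃ g : ℂ → ℂ, AnalyticAt ℂ g 0 ∧ g 0 = 0 ∧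
      (∀ᶠ t in 𝓝 0, h (g t) = t) ∧ ∀ᶠ t in 𝓝 0, g (h t) = t := by
  have hs := ha.hasStrictDerivAt
  refine ⟨hs.localInverse _ _ _ hd, ?_, ?_, ?_, ?_⟩
  · simpa only [h0] using ha.analyticAt_localInverse hd
  · have : hs.localInverse _ _ _ hd (h 0) = 0 := HasStrictFDerivAt.localInverse_apply_image ..
    rwa [h0] at this
  · simpa only [h0] using hs.eventually_right_inverse hd
  · exact (hs.hasStrictFDerivAt_equiv hd).eventually_left_inverse

namespace PuiseuxData

variable {b : ℂ → ℂ[X]} {d : ℕ} (D : PuiseuxData b d)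

theorem qParam_pow' {e : ℕ} (he : 0 < e) (τ : ℂ) : qParam e τ ^ e = qParam 1 τ := by
  have : ((e : ℝ) : ℂ) ≠ 0 := by exact_mod_cast he.ne'
  simp only [qParam]
  rw [← Complex.exp_nat_mul]
  congr 1
  push_cast at this ⊢
  field_simp

/-- Every primitive parametrization of a curve germ of roots is equivalent to one of the
Puiseux parametrizations. -/
theorem exists_equivalent (hb : EntireFamily b d) {ξ w : ℂ → ℂ} (hξ : AnalyticAt ℂ ξ 0)
    (hw : AnalyticAt ℂ w 0) (hw0 : w 0 = 0)
    (hroot : ∀ᶠ t in 𝓝 0, (b (w t)).eval (ξ t) = 0)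
    (hinj : ∃ U ∈ 𝓝 (0 : ℂ), Set.InjOn (fun t => (ξ t, w t)) U) :
    ∃ (j : Fin d) (h : ℂ → ℂ), AnalyticAt ℂ h 0 ∧ h 0 = 0 ∧ deriv h 0 ≠ 0 ∧
      ∀ᶠ t in 𝓝 0, ξ t = D.X j (h t) ∧ w t = h t ^ D.k j := by
  obtain ⟨U, hU, hUinj⟩ := hinj
  -- If `w` vanished identically, `ξ` would take values among the finitely many roots of `b 0`,
  -- against injectivity of the parametrization.
  have hne : ¬ ∀ᶠ t in 𝓝 0, w t = 0 := by
    intro hz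
    have h1 : ∀ᶠ t in 𝓝 (0 : ℂ), t ∈ U ∧ w t = 0 ∧ (b (w t)).eval (ξ t) = 0 :=
      (eventually_of_mem hU fun _ h => h).and (hz.and hroot)
    have hinf : Set.Infinite {t | t ∈ U ∧ w t = 0 ∧ (b (w t)).eval (ξ t) = 0} :=
      infinite_of_mem_nhds 0 h1
    have hfin : {x | (b 0).eval x = 0}.Finite := by
      refine (b 0).roots.toFinset.finite_toSet.subset fun x hx => ?_
      simpa [hb.ne_zero 0] using hx
    refine hinf (Set.Finite.of_finite_image (f := ξ) (hfin.subset ?_) ?_)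
    · rintro _ ⟨t, ⟨-, ht, hr⟩, rfl⟩
      rwa [ht] at hr
    · intro t ht t' ht' h
      exact hUinj ht.1 ht'.1 (Prod.ext h (ht.2.1.trans ht'.2.1.symm))
  obtain ⟨e, s, he, hs, hs0, hsd, hse⟩ := exists_pow_eq hw hw0 hne
  obtain ⟨ρ, hρ, hρ0, hsρ, hρs⟩ := exists_local_inverse hs hs0 hsd
  have hρt : Tendsto ρ (𝓝 0) (𝓝 0) := by simpa [hρ0] using hρ.continuousAt.tendsto
  have hst : Tendsto s (𝓝 0) (𝓝 0) := by simpa [hs0] using hs.continuousAt.tendsto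
  have hev : ∀ᶠ u in 𝓝 (0 : ℂ), ContinuousAt (fun u => ξ (ρ u)) u ∧ w (ρ u) = u ^ e ∧
      (b (w (ρ u))).eval (ξ (ρ u)) = 0 ∧ ρ u ∈ U ∧ s (ρ u) = u := by
    have hξρ : AnalyticAt ℂ (fun u => ξ (ρ u)) 0 := AnalyticAt.fun_comp (by rwa [hρ0]) hρ
    filter_upwards [hξρ.eventually_analyticAt, hρt.eventually hse, hsρ, hρt.eventually hroot,
      hρt.eventually hU] with u h1 h2 h3 h4 h5
    exact ⟨h1.continuousAt, by rw [← h2, h3], h4, h5, h3⟩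
  have he' : (0 : ℝ) < e := Nat.cast_pos.2 he
  obtain ⟨A', -, hA'⟩ := (atTop_basis_Ioi.comap Complex.im).eventually_iff.1
    (((qParam_tendsto he').mono_right nhdsWithin_le_nhds).eventually hev)
  set S : Set ℂ := {τ : ℂ | max D.A A' < τ.im} with hSdef
  have hSA : ∀ τ ∈ S, D.A < τ.im := fun τ hτ => (le_max_left _ _).trans_lt hτ
  have hSA' : ∀ τ ∈ S, A' < τ.im := fun τ hτ => (le_max_right _ _).trans_lt hτ
  have hP := fun τ (hτ : τ ∈ S) => hA' (hSA' τ hτ)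
  set f : ℂ → ℂ := fun τ => ξ (ρ (qParam e τ)) with hf
  have hfr : ∀ τ ∈ S, (b (qParam 1 τ)).eval (f τ) = 0 := by
    intro τ hτ
    rw [← qParam_pow' he, ← (hP τ hτ).2.1]
    exact (hP τ hτ).2.2.1
  have hfc : ContinuousOn f S := fun τ hτ =>
    (ContinuousAt.comp (g := fun u => ξ (ρ u)) (hP τ hτ).1
      continuous_qParam.continuousAt).continuousWithinAt
  set τ₀ : ℂ := (max D.A A' + 1 : ℝ) * Complex.I
  have hlt := lt_add_one (max D.A A')
  have h₀ : τ₀ ∈ S := by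
    simp only [S, τ₀, Set.mem_ofPred_eq, Complex.mul_I_im, Complex.ofReal_re]
    exact hlt
  obtain ⟨j, hj⟩ := (D.eval_eq_zero_iff τ₀ (hSA _ h₀) _).1 (hfr τ₀ h₀)
  have hfx : Set.EqOn (D.x j) f S := by
    refine hb.eqOn_of_roots (isOpen_lt_im _) (convex_halfSpace_im_gt _) differentiable_qParam
      (fun τ hτ => D.simple τ (hSA τ hτ)) ?_ hfc ?_ hfr h₀ hj
    · exact fun τ hτ => (D.differentiableAt j τ (hSA τ hτ)).continuousAt.continuousWithinAt
    · exact fun τ hτ => (D.eval_eq_zero_iff τ (hSA τ hτ) _).2 ⟨j, rfl⟩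
  have hmem : ∀ n : ℕ, τ₀ + n ∈ S := fun n => by
    simp only [S, τ₀, Set.mem_ofPred_eq, Complex.add_im, Complex.mul_I_im, Complex.ofReal_re,
      Complex.natCast_im, add_zero]
    exact hlt
  -- After `e` turns the parameter `exp(2πiτ/e)` returns, hence so does the root, so `σ^e` fixes
  -- `j`.
  have hke : D.k j ∣ e := by
    have h1 : f (τ₀ + e) = f τ₀ := by
      simp only [hf]
      rw [(qParam_eq_iff he'.ne').2 ⟨1, by push_cast; ring_nf⟩]
    rw [← hfx (hmem e), ← hfx h₀, D.shift_nat] at h1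
    exact Function.IsPeriodicPt.minimalPeriod_dvd (D.injective τ₀ (hSA _ h₀) h1)
  -- Conversely, after `k` turns both the root and `w` return. The parametrization is primitive, so
  -- its parameter must also return. Together with `hke` this identifies the order of vanishing of
  -- `w` with the cycle length.
  have hek : e ∣ D.k j := by
    have h1 : f (τ₀ + D.k j) = f τ₀ := by
      rw [← hfx (hmem _), ← hfx h₀]
      exact_mod_cast D.periodic j τ₀
    have h2 := hP _ (hmem (D.k j))
    have h3 := hP _ h₀
    have h4 : w (ρ (qParam e (τ₀ + D.k j))) = w (ρ (qParam e τ₀)) := by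
      rw [h2.2.1, h3.2.1, qParam_pow' he, qParam_pow' he, qParam_eq_iff one_ne_zero]
      exact ⟨D.k j, by push_cast; ring⟩
    have h5 := hUinj h2.2.2.2.1 h3.2.2.2.1 (Prod.ext h1 h4)
    have h6 : qParam e (τ₀ + D.k j) = qParam e τ₀ := by
      rw [← h2.2.2.2.2, ← h3.2.2.2.2, h5]
    obtain ⟨n, hn⟩ := (qParam_eq_iff he'.ne').1 h6
    have h7 : ((D.k j : ℤ) : ℂ) = ((n * e : ℤ) : ℂ) := by
      push_cast at hn ⊢
      exact add_left_cancel hn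
    have h8 := Int.cast_injective h7
    exact Int.natCast_dvd_natCast.1 ⟨n, by rw [h8, mul_comm]⟩
  obtain rfl : e = D.k j := Nat.dvd_antisymm hek hke
  have hX : ∀ᶠ u in 𝓝[≠] (0 : ℂ), ξ (ρ u) = D.X j u := by
    filter_upwards [D.eventually_exists_qParam j (max D.A A')] with u ⟨τ, hτ, hu⟩
    rw [← hu, D.X_qParam, hfx hτ]
  have hX' : ∀ᶠ u in 𝓝 (0 : ℂ), ξ (ρ u) = D.X j u := by
    refine (ContinuousAt.eventuallyEq_nhds_iff_eventuallyEq_nhdsNE ?_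
      (D.analyticAt_X hb j).continuousAt).1 hX
    exact hev.self_of_nhds.1
  refine ⟨j, s, hs, hs0, hsd, ?_⟩
  filter_upwards [hst.eventually hX', hρs, hse] with t h1 h2 h3
  rw [h2] at h1
  exact ⟨h1, h3.symm⟩

/-- Equivalent Puiseux parametrizations belong to the same cycle of the monodromy. -/
theorem exists_zpow_of_equivalent {i j : Fin d} {h : ℂ → ℂ}
    (ht : Tendsto h (𝓝[≠] 0) (𝓝[≠] 0))
    (he : ∀ᶠ t in 𝓝[≠] (0 : ℂ), D.X i t = D.X j (h t) ∧ t ^ D.k i = h t ^ D.k j) :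
    ∃ n : ℤ, (D.σ ^ n) j = i := by
  obtain ⟨t, ⟨h1, h2⟩, ⟨τ, hτ, rfl⟩, τ', hτ', h3⟩ := (he.and
    ((D.eventually_exists_qParam i D.A).and
      (ht.eventually (D.eventually_exists_qParam j D.A)))).exists
  rw [← h3, D.X_qParam, D.X_qParam] at h1
  rw [← h3, D.qParam_pow, D.qParam_pow, eq_comm, qParam_eq_iff one_ne_zero] at h2
  obtain ⟨n, rfl⟩ := h2
  rw [Complex.ofReal_one, mul_one, D.shift_int] at h1
  exact ⟨n, (D.injective τ hτ h1).symm⟩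

theorem k_zpow (j : Fin d) (n : ℤ) : D.k ((D.σ ^ n) j) = D.k j := by
  have hp : ∀ (i : Fin d) (m : ℕ), Function.IsPeriodicPt D.σ m ((D.σ ^ n) i) ↔
      Function.IsPeriodicPt D.σ m i := by
    intro i m
    simp only [Function.IsPeriodicPt, Function.IsFixedPt, Equiv.Perm.iterate_eq_pow]
    rw [← Equiv.Perm.mul_apply, ← zpow_natCast, ← zpow_add, add_comm, zpow_add,
      Equiv.Perm.mul_apply, (D.σ ^ n).injective.eq_iff]
  exact Function.minimalPeriod_eq_minimalPeriod_iff.2 (hp j)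

/-- Translating `τ` by `n` multiplies `exp(2πiτ/k)` by the `k`-th root of unity `exp(2πin/k)`, so
roots in one cycle are reparametrizations of a single branch. -/
theorem exists_rotation (hb : EntireFamily b d) (j : Fin d) (n : ℤ) :
    ∃ ζ : ℂ, ζ ≠ 0 ∧ ζ ^ D.k j = 1 ∧ ∀ᶠ t in 𝓝 (0 : ℂ), D.X ((D.σ ^ n) j) t = D.X j (ζ * t) := by
  refine ⟨qParam (D.k j) n, qParam_ne_zero _, ?_, ?_⟩
  · rw [D.qParam_pow, ← show qParam 1 0 = 1 by simp [qParam], qParam_eq_iff one_ne_zero]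
    exact ⟨n, by simp⟩
  · refine (ContinuousAt.eventuallyEq_nhds_iff_eventuallyEq_nhdsNE
      (D.analyticAt_X hb _).continuousAt ?_).1 ?_
    · have h1 : ContinuousAt (D.X j) (qParam (D.k j) n * 0) := by
        rw [mul_zero]; exact (D.analyticAt_X hb _).continuousAt
      exact ContinuousAt.comp (f := fun t => qParam (D.k j) n * t) h1 (by fun_prop)
    · filter_upwards [D.eventually_exists_qParam ((D.σ ^ n) j) D.A] with t ⟨τ, hτ, ht⟩
      have h2 : qParam (D.k j) n * t = qParam (D.k j) (τ + n) := by
        rw [← ht, D.k_zpow]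
        simp only [qParam]
        rw [← Complex.exp_add]
        ring_nf
      rw [h2, D.X_qParam, D.shift_int, ← ht, D.X_qParam]

/-- The cycle of `j` under the monodromy has length `k j`. -/
theorem card_cycle (j : Fin d) [DecidablePred fun i => ∃ n : ℤ, (D.σ ^ n) j = i] :
    (Finset.univ.filter fun i => ∃ n : ℤ, (D.σ ^ n) j = i).card = D.k j := by
  have hk := D.k_pos j
  rw [← Finset.card_range (D.k j)]
  symm
  refine Finset.card_bij (fun m _ => D.σ^[m] j) ?_ ?_ ?_
  · intro m _
    rw [Finset.mem_filter]
    exact ⟨Finset.mem_univ _, m, by rw [zpow_natCast, Equiv.Perm.iterate_eq_pow]⟩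
  · intro m hm m' hm' h
    exact Function.iterate_injOn_Iio_minimalPeriod (Finset.mem_range.1 hm)
      (Finset.mem_range.1 hm') h
  · intro i hi
    obtain ⟨-, n, rfl⟩ := Finset.mem_filter.1 hi
    have h1 : 0 ≤ n % D.k j := Int.emod_nonneg _ (by exact_mod_cast hk.ne')
    have h2 : n % D.k j < D.k j := Int.emod_lt_of_pos _ (by exact_mod_cast hk)
    refine ⟨(n % D.k j).toNat, Finset.mem_range.2 (by omega), ?_⟩
    have h3 : (D.σ ^ D.k j) j = j := by
      rw [← Equiv.Perm.iterate_eq_pow]; exact Function.iterate_minimalPeriod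
    rw [Equiv.Perm.iterate_eq_pow, ← zpow_natCast, Int.toNat_of_nonneg h1]
    conv_rhs => rw [← Int.emod_add_mul_ediv n (D.k j), zpow_add, zpow_mul, zpow_natCast,
      Equiv.Perm.mul_apply, Equiv.Perm.zpow_apply_eq_self_of_apply_eq_self h3]

end PuiseuxData

end MahlerVolume

/-! ### Monomial charts and the branches seen in them. -/

namespace MahlerVolume

open Polynomial Function.Periodic

theorem eval_eq_sum (P : Laurent) (z : ℂ × ℂ) :
    eval P z = ∑ n ∈ P.coeff.support, P.coeff n * z.1 ^ n.1 * z.2 ^ n.2 := rfl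

/-- The derivative of `P` along a curve, in logarithmic coordinates. -/
theorem hasDerivAt_eval (P : Laurent) {x y : ℂ → ℂ} {x' y' t : ℂ} (hx : HasDerivAt x x' t)
    (hy : HasDerivAt y y' t) (hx0 : x t ≠ 0) (hy0 : y t ≠ 0) :
    HasDerivAt (fun t => eval P (x t, y t))
      (xDx P (x t, y t) * (x' / x t) + yDy P (x t, y t) * (y' / y t)) t := by
  have h1 : ∀ n : ℤ × ℤ, HasDerivAt (fun t => P.coeff n * x t ^ n.1 * y t ^ n.2)
      (n.1 * P.coeff n * x t ^ n.1 * y t ^ n.2 * (x' / x t) +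
        n.2 * P.coeff n * x t ^ n.1 * y t ^ n.2 * (y' / y t)) t := by
    intro n
    have hxn := (hasDerivAt_zpow n.1 (x t) (Or.inl hx0)).comp t hx
    have hyn := (hasDerivAt_zpow n.2 (y t) (Or.inl hy0)).comp t hy
    refine ((hxn.const_mul (P.coeff n)).mul hyn).congr_deriv ?_
    simp only [Function.comp]
    rw [zpow_sub_one₀ hx0, zpow_sub_one₀ hy0]
    field_simp
  have h2 := HasDerivAt.fun_sum (u := P.coeff.support) fun n _ => h1 n
  refine h2.congr_deriv ?_
  simp only [xDx, yDy, Finsupp.sum, Finset.sum_mul]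
  rw [← Finset.sum_add_distrib]

/-- The monomial map `(X, Y) ↦ (X ^ p Y ^ q, X ^ r Y ^ s)`. -/
def monomialMap (p q r s : ℤ) (z : ℂ × ℂ) : ℂ × ℂ := (z.1 ^ p * z.2 ^ q, z.1 ^ r * z.2 ^ s)

/-- Monomial coordinates `(X, Y)` on the torus in which `P` is, up to a monomial factor, a polynomial
in `X` over `ℂ[Y]` whose leading coefficient is a monomial. -/
structure Chart (P : Laurent) where
  p : ℤ
  q : ℤ
  r : ℤ
  s : ℤ
  det : p * s - q * r = 1
  B : ℂ[X][X]
  c : ℂ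
  c_ne_zero : c ≠ 0
  m : ℕ
  leadingCoeff_eq : B.leadingCoeff = C c * X ^ m
  e : ℤ
  f : ℤ
  eval_map : ∀ x y : ℂ, x ≠ 0 → y ≠ 0 →
    (B.map (evalRingHom y)).eval x = x ^ e * y ^ f * eval P (monomialMap p q r s (x, y))
  disc : ℂ[X]
  disc_ne_zero : disc ≠ 0
  simple : ∀ y : ℂ, y ≠ 0 → disc.eval y ≠ 0 → ∀ x, (B.map (evalRingHom y)).eval x = 0 →
    (B.map (evalRingHom y)).derivative.eval x ≠ 0

namespace Chart

variable {P : Laurent} (ch : Chart P)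

/-- The monomial map from the coordinates of the chart to the coordinates of the torus. -/
def M (z : ℂ × ℂ) : ℂ × ℂ := monomialMap ch.p ch.q ch.r ch.s z

/-- The monomial map from the coordinates of the torus to the coordinates of the chart. -/
def N (z : ℂ × ℂ) : ℂ × ℂ := monomialMap ch.s (-ch.q) (-ch.r) ch.p z

theorem M_N {z : ℂ × ℂ} (h1 : z.1 ≠ 0) (h2 : z.2 ≠ 0) : ch.M (ch.N z) = z := by
  have hd := ch.det
  simp only [M, N, monomialMap, mul_zpow, ← zpow_mul]
  ext
  · calc _ = z.1 ^ (ch.s * ch.p + -ch.r * ch.q) * z.2 ^ (-ch.q * ch.p + ch.p * ch.q) := by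
          rw [zpow_add₀ h1, zpow_add₀ h2]; ring
      _ = z.1 := by
          rw [show ch.s * ch.p + -ch.r * ch.q = 1 by linarith,
            show -ch.q * ch.p + ch.p * ch.q = 0 by ring]; simp
  · calc _ = z.1 ^ (ch.s * ch.r + -ch.r * ch.s) * z.2 ^ (-ch.q * ch.r + ch.p * ch.s) := by
          rw [zpow_add₀ h1, zpow_add₀ h2]; ring
      _ = z.2 := by
          rw [show ch.s * ch.r + -ch.r * ch.s = 0 by ring,
            show -ch.q * ch.r + ch.p * ch.s = 1 by linarith]; simp

theorem N_M {z : ℂ × ℂ} (h1 : z.1 ≠ 0) (h2 : z.2 ≠ 0) : ch.N (ch.M z) = z := by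
  have hd := ch.det
  simp only [M, N, monomialMap, mul_zpow, ← zpow_mul]
  ext
  · calc _ = z.1 ^ (ch.p * ch.s + ch.r * -ch.q) * z.2 ^ (ch.q * ch.s + ch.s * -ch.q) := by
          rw [zpow_add₀ h1, zpow_add₀ h2]; ring
      _ = z.1 := by
          rw [show ch.p * ch.s + ch.r * -ch.q = 1 by linarith,
            show ch.q * ch.s + ch.s * -ch.q = 0 by ring]; simp
  · calc _ = z.1 ^ (ch.p * -ch.r + ch.r * ch.p) * z.2 ^ (ch.q * -ch.r + ch.s * ch.p) := by
          rw [zpow_add₀ h1, zpow_add₀ h2]; ring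
      _ = z.2 := by
          rw [show ch.p * -ch.r + ch.r * ch.p = 0 by ring,
            show ch.q * -ch.r + ch.s * ch.p = 1 by linarith]; simp

theorem M_fst_ne_zero {z : ℂ × ℂ} (h1 : z.1 ≠ 0) (h2 : z.2 ≠ 0) : (ch.M z).1 ≠ 0 :=
  mul_ne_zero (zpow_ne_zero _ h1) (zpow_ne_zero _ h2)

theorem M_snd_ne_zero {z : ℂ × ℂ} (h1 : z.1 ≠ 0) (h2 : z.2 ≠ 0) : (ch.M z).2 ≠ 0 :=
  mul_ne_zero (zpow_ne_zero _ h1) (zpow_ne_zero _ h2)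

theorem N_fst_ne_zero {z : ℂ × ℂ} (h1 : z.1 ≠ 0) (h2 : z.2 ≠ 0) : (ch.N z).1 ≠ 0 :=
  mul_ne_zero (zpow_ne_zero _ h1) (zpow_ne_zero _ h2)

theorem N_snd_ne_zero {z : ℂ × ℂ} (h1 : z.1 ≠ 0) (h2 : z.2 ≠ 0) : (ch.N z).2 ≠ 0 :=
  mul_ne_zero (zpow_ne_zero _ h1) (zpow_ne_zero _ h2)

/-- The degree in `X`. -/
def d : ℕ := ch.B.natDegree

/-- The polynomial in `X` obtained from the value `y` of `Y`. -/
def slice (y : ℂ) : ℂ[X] := ch.B.map (evalRingHom y)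

theorem leadingCoeff_eval_ne_zero {y : ℂ} (hy : y ≠ 0) :
    evalRingHom y ch.B.leadingCoeff ≠ 0 := by
  rw [ch.leadingCoeff_eq]
  simp [ch.c_ne_zero, hy]

theorem natDegree_slice {y : ℂ} (hy : y ≠ 0) : (ch.slice y).natDegree = ch.d :=
  natDegree_map_of_leadingCoeff_ne_zero _ (ch.leadingCoeff_eval_ne_zero hy)

theorem leadingCoeff_slice {y : ℂ} (hy : y ≠ 0) : (ch.slice y).leadingCoeff = ch.c * y ^ ch.m := by
  rw [slice, leadingCoeff_map_of_leadingCoeff_ne_zero _ (ch.leadingCoeff_eval_ne_zero hy),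
    ch.leadingCoeff_eq]
  simp

theorem slice_ne_zero {y : ℂ} (hy : y ≠ 0) : ch.slice y ≠ 0 := by
  rw [← leadingCoeff_ne_zero, ch.leadingCoeff_slice hy]
  exact mul_ne_zero ch.c_ne_zero (pow_ne_zero _ hy)

theorem eval_slice {x y : ℂ} (hx : x ≠ 0) (hy : y ≠ 0) :
    (ch.slice y).eval x = x ^ ch.e * y ^ ch.f * eval P (ch.M (x, y)) := ch.eval_map x y hx hy

theorem eval_slice_eq_zero_iff {x y : ℂ} (hx : x ≠ 0) (hy : y ≠ 0) :
    (ch.slice y).eval x = 0 ↔ eval P (ch.M (x, y)) = 0 := by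
  rw [ch.eval_slice hx hy]
  simp [zpow_ne_zero _ hx, zpow_ne_zero _ hy]

/-- Writing `Y = y e^w` keeps `Y` nonzero, so the leading coefficient `c Y^m` never vanishes and the
degree in `X` is constant. It also turns the circle `|Y| = |y|` into the line `w = iδ`. -/
theorem entireFamily {y : ℂ} (hy : y ≠ 0) :
    EntireFamily (fun w => ch.slice (y * Complex.exp w)) ch.d where
  differentiable_coeff i := by
    have : (fun w => (ch.slice (y * Complex.exp w)).coeff i) =
        fun w => (ch.B.coeff i).eval (y * Complex.exp w) := by
      ext w; simp [slice]
    rw [this]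
    exact (ch.B.coeff i).differentiable.comp (by fun_prop)
  natDegree_eq w := ch.natDegree_slice (mul_ne_zero hy (Complex.exp_ne_zero w))
  ne_zero w := ch.slice_ne_zero (mul_ne_zero hy (Complex.exp_ne_zero w))

theorem eventually_simple {y : ℂ} (hy : y ≠ 0) : ∀ᶠ w in 𝓝[≠] (0 : ℂ),
    w ∈ EntireFamily.simpleSet (fun w => ch.slice (y * Complex.exp w)) := by
  have h1 : HasDerivAt (fun w => y * Complex.exp w) (y * Complex.exp 0) 0 :=
    (Complex.hasDerivAt_exp 0).const_mul y
  have h2 := h1.tendsto_nhdsNE (by simpa using hy)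
  simp only [Complex.exp_zero, mul_one] at h2
  have h3 : ∀ᶠ z in 𝓝[≠] y, ch.disc.eval z ≠ 0 := by
    have hf : (ch.disc.roots.toFinset : Set ℂ).Finite := Finset.finite_toSet _
    have := (hf.subset (Set.sdiff_subset (t := {y}))).isClosed.isOpen_compl.mem_nhds (x := y) (by simp)
    filter_upwards [nhdsWithin_le_nhds this, self_mem_nhdsWithin] with z h4 h5 h6
    refine h4 ⟨?_, h5⟩
    simpa [ch.disc_ne_zero] using h6
  filter_upwards [h2.eventually h3] with w hw x hx
  exact ch.simple _ (mul_ne_zero hy (Complex.exp_ne_zero w)) hw x hx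

/-- The Puiseux parametrizations of the roots around `Y = y`. -/
abbrev Local (y : ℂ) : Type := PuiseuxData (fun w => ch.slice (y * Complex.exp w)) ch.d

theorem nonempty_local {y : ℂ} (hy : y ≠ 0) : Nonempty (ch.Local y) :=
  (ch.entireFamily hy).exists_puiseuxData (ch.eventually_simple hy)

/-- If both logarithmic derivatives of `P` vanished at a zero of `P`, the chain rule in `X` would
make the derivative of the slice vanish, contradicting simplicity of the root. -/
theorem mem_smoothLocus {x y : ℂ} (hx : x ≠ 0) (hy : y ≠ 0) (h0 : (ch.slice y).eval x = 0)
    (h1 : (ch.slice y).derivative.eval x ≠ 0) : ch.M (x, y) ∈ smoothLocus P := by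
  refine ⟨ch.M_fst_ne_zero hx hy, ch.M_snd_ne_zero hx hy,
    (ch.eval_slice_eq_zero_iff hx hy).1 h0, ?_⟩
  by_contra! h
  have hu : HasDerivAt (fun x => x ^ ch.p * y ^ ch.q) (ch.p * x ^ (ch.p - 1) * y ^ ch.q) x :=
    (hasDerivAt_zpow _ _ (Or.inl hx)).mul_const _
  have hv : HasDerivAt (fun x => x ^ ch.r * y ^ ch.s) (ch.r * x ^ (ch.r - 1) * y ^ ch.s) x :=
    (hasDerivAt_zpow _ _ (Or.inl hx)).mul_const _
  have h2 := hasDerivAt_eval P hu hv (ch.M_fst_ne_zero (z := (x, y)) hx hy)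
    (ch.M_snd_ne_zero (z := (x, y)) hx hy)
  have h3 : xDx P (x ^ ch.p * y ^ ch.q, x ^ ch.r * y ^ ch.s) = 0 := h.1
  have h4 : yDy P (x ^ ch.p * y ^ ch.q, x ^ ch.r * y ^ ch.s) = 0 := h.2
  rw [h3, h4, zero_mul, zero_mul, add_zero] at h2
  have h5 : HasDerivAt (fun x => x ^ ch.e * y ^ ch.f) (ch.e * x ^ (ch.e - 1) * y ^ ch.f) x :=
    (hasDerivAt_zpow _ _ (Or.inl hx)).mul_const _
  have h6 := h5.mul h2
  have h7 : eval P (x ^ ch.p * y ^ ch.q, x ^ ch.r * y ^ ch.s) = 0 :=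
    (ch.eval_slice_eq_zero_iff hx hy).1 h0
  rw [h7, mul_zero, mul_zero, add_zero] at h6
  refine h1 (((ch.slice y).hasDerivAt x).unique (h6.congr_of_eventuallyEq ?_))
  filter_upwards [isOpen_ne.mem_nhds hx] with x' hx'
  exact ch.eval_slice hx' hy

theorem analyticAt_M {x y : ℂ → ℂ} {t : ℂ} (hx : AnalyticAt ℂ x t) (hy : AnalyticAt ℂ y t)
    (hx0 : x t ≠ 0) (hy0 : y t ≠ 0) : AnalyticAt ℂ (fun t => ch.M (x t, y t)) t :=
  ((hx.fun_zpow hx0).mul (hy.fun_zpow hy0)).prod ((hx.fun_zpow hx0).mul (hy.fun_zpow hy0))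

variable {ch} {y : ℂ}

/-- The point of the chart on the `j`-th Puiseux branch. -/
def chartPoint (y : ℂ) (D : ch.Local y) (j : Fin ch.d) (t : ℂ) : ℂ × ℂ :=
  (D.X j t, y * Complex.exp (t ^ D.k j))

theorem eventually_norm_pow_lt {h : ℂ → ℂ} (hh : Tendsto h (𝓝 0) (𝓝 0)) {k : ℕ} (hk : 0 < k) :
    ∀ᶠ t in 𝓝 (0 : ℂ), ‖h t ^ k‖ < 1 := by
  have h1 : Tendsto (fun t => ‖h t ^ k‖) (𝓝 0) (𝓝 0) := by
    have := (hh.pow k).norm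
    simpa [hk.ne'] using this
  exact h1.eventually_lt_const one_pos

/-- This recovers `w = t^k` from `Y = y e^w` for small `t`, so the injectivity and equivalence
statements in `(X, w)` can be transported to `(X, Y)`. -/
theorem exp_injOn_unitBall {u v : ℂ} (hu : ‖u‖ < 1) (hv : ‖v‖ < 1)
    (h : Complex.exp u = Complex.exp v) : u = v := by
  have hpi := Real.pi_gt_three
  have h1 := abs_lt.1 ((Complex.abs_im_le_norm u).trans_lt hu)
  have h2 := abs_lt.1 ((Complex.abs_im_le_norm v).trans_lt hv)
  exact Complex.exp_inj_of_neg_pi_lt_of_le_pi (by linarith) (by linarith) (by linarith)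
    (by linarith) h

theorem eventually_X_ne_zero (hy : y ≠ 0) (D : ch.Local y) {j : Fin ch.d} (hj : D.X j 0 ≠ 0) :
    ∀ᶠ t in 𝓝 (0 : ℂ), D.X j t ≠ 0 :=
  (D.analyticAt_X (ch.entireFamily hy) j).continuousAt.eventually_ne hj

/-- The Puiseux branches as branches of the curve. -/
def branch (hy : y ≠ 0) (D : ch.Local y) (j : Fin ch.d) (hj : D.X j 0 ≠ 0) : BranchParam P where
  toFun t := ch.M (chartPoint y D j t)
  analytic := ch.analyticAt_M (D.analyticAt_X (ch.entireFamily hy) j) (by fun_prop) hj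
    (mul_ne_zero hy (Complex.exp_ne_zero _))
  fst_ne_zero := ch.M_fst_ne_zero hj (mul_ne_zero hy (Complex.exp_ne_zero _))
  snd_ne_zero := ch.M_snd_ne_zero hj (mul_ne_zero hy (Complex.exp_ne_zero _))
  eval_eq_zero := by
    filter_upwards [D.eval_X (ch.entireFamily hy) j, eventually_X_ne_zero hy D hj] with t h1 h2
    exact (ch.eval_slice_eq_zero_iff h2 (mul_ne_zero hy (Complex.exp_ne_zero _))).1 h1
  injective := by
    obtain ⟨U, hU, hinj⟩ := D.eventually_injOn j
    refine ⟨_, (eventually_of_mem hU fun _ h => h).and ((eventually_X_ne_zero hy D hj).and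
      (eventually_norm_pow_lt tendsto_id (D.k_pos j))), ?_⟩
    intro t ⟨h1, h2, h3⟩ t' ⟨h1', h2', h3'⟩ h
    have h4 := congrArg ch.N h
    rw [ch.N_M h2 (mul_ne_zero hy (Complex.exp_ne_zero _)),
      ch.N_M h2' (mul_ne_zero hy (Complex.exp_ne_zero _)), chartPoint, chartPoint,
      Prod.mk.injEq] at h4
    have h5 := exp_injOn_unitBall h3 h3' (mul_left_cancel₀ hy h4.2)
    exact hinj h1 h1' (Prod.ext h4.1 h5)

/-- Every branch over `Y = y` is equivalent to a Puiseux branch. -/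
theorem exists_branch_equivalent (hy : y ≠ 0) (D : ch.Local y) (ψ : BranchParam P)
    (hψ : (ch.N (ψ.toFun 0)).2 = y) :
    ∃ (j : Fin ch.d) (hj : D.X j 0 ≠ 0), (branch hy D j hj).Equivalent ψ := by
  have ha1 : AnalyticAt ℂ (fun t => (ψ.toFun t).1) 0 :=
    AnalyticAt.fun_comp analyticAt_fst ψ.analytic
  have ha2 : AnalyticAt ℂ (fun t => (ψ.toFun t).2) 0 :=
    AnalyticAt.fun_comp analyticAt_snd ψ.analytic
  have hξ : AnalyticAt ℂ (fun t => (ch.N (ψ.toFun t)).1) 0 :=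
    (ha1.fun_zpow ψ.fst_ne_zero).mul (ha2.fun_zpow ψ.snd_ne_zero)
  have hυ : AnalyticAt ℂ (fun t => (ch.N (ψ.toFun t)).2) 0 :=
    (ha1.fun_zpow ψ.fst_ne_zero).mul (ha2.fun_zpow ψ.snd_ne_zero)
  have hw : AnalyticAt ℂ (fun t => Complex.log ((ch.N (ψ.toFun t)).2 / y)) 0 := by
    refine (hυ.div analyticAt_const hy).clog ?_
    simp [hψ, hy]
  have hne : ∀ᶠ t in 𝓝 (0 : ℂ), (ψ.toFun t).1 ≠ 0 ∧ (ψ.toFun t).2 ≠ 0 :=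
    (ha1.continuousAt.eventually_ne ψ.fst_ne_zero).and
      (ha2.continuousAt.eventually_ne ψ.snd_ne_zero)
  have hexp : ∀ t, (ψ.toFun t).1 ≠ 0 → (ψ.toFun t).2 ≠ 0 →
      y * Complex.exp (Complex.log ((ch.N (ψ.toFun t)).2 / y)) = (ch.N (ψ.toFun t)).2 := by
    intro t h1 h2
    rw [Complex.exp_log (div_ne_zero (ch.N_snd_ne_zero h1 h2) hy), mul_div_cancel₀ _ hy]
  obtain ⟨U, hU, hinj⟩ := ψ.injective
  obtain ⟨j, h, hh, hh0, hhd, he⟩ := D.exists_equivalent (ch.entireFamily hy) hξ hw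
    (by simp [hψ, hy]) (by
      filter_upwards [hne, ψ.eval_eq_zero] with t h1 h2
      rw [hexp t h1.1 h1.2,
        ch.eval_slice_eq_zero_iff (ch.N_fst_ne_zero h1.1 h1.2) (ch.N_snd_ne_zero h1.1 h1.2)]
      rw [Prod.mk.eta, ch.M_N h1.1 h1.2]
      exact h2) (by
      refine ⟨_, (eventually_of_mem hU fun _ h => h).and hne, ?_⟩
      intro t ⟨h1, h2⟩ t' ⟨h1', h2'⟩ h
      simp only [Prod.mk.injEq] at h
      refine hinj h1 h1' ?_
      rw [← ch.M_N h2.1 h2.2, ← ch.M_N h2'.1 h2'.2]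
      congr 1
      refine Prod.ext h.1 ?_
      rw [← hexp t h2.1 h2.2, h.2, hexp t' h2'.1 h2'.2])
  have hX0 : (ch.N (ψ.toFun 0)).1 = D.X j 0 := by
    have := he.self_of_nhds.1
    rwa [hh0] at this
  refine ⟨j, ?_, h, hh, hh0, hhd, ?_⟩
  · rw [← hX0]
    exact ch.N_fst_ne_zero ψ.fst_ne_zero ψ.snd_ne_zero
  · filter_upwards [he, hne] with t h1 h2
    simp only [branch, chartPoint]
    rw [← h1.1, ← h1.2, hexp t h2.1 h2.2, Prod.mk.eta, ch.M_N h2.1 h2.2]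

/-- Points of the normalization correspond to cycles of the monodromy: a coordinate change matches
roots over the same `w`, hence within a cycle, and a cycle is realized by rotations of the
parameter. -/
theorem branch_point_eq_iff (hy : y ≠ 0) (D : ch.Local y) {i j : Fin ch.d} (hi : D.X i 0 ≠ 0)
    (hj : D.X j 0 ≠ 0) :
    (branch hy D j hj).point = (branch hy D i hi).point ↔ ∃ n : ℤ, (D.σ ^ n) j = i := by
  have hexp0 : ∀ w, y * Complex.exp w ≠ 0 := fun w => mul_ne_zero hy (Complex.exp_ne_zero w)
  constructor
  · intro h
    obtain ⟨h, ha, h0, hd, he⟩ := Quotient.exact h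
    have ht : Tendsto h (𝓝 0) (𝓝 0) := by simpa [h0] using ha.continuousAt.tendsto
    refine D.exists_zpow_of_equivalent (h := h) (map_punctured_nhds ha h0 hd).le ?_
    refine Filter.Eventually.filter_mono nhdsWithin_le_nhds ?_
    filter_upwards [he, eventually_X_ne_zero hy D hi, ht.eventually (eventually_X_ne_zero hy D hj),
      eventually_norm_pow_lt tendsto_id (D.k_pos i), eventually_norm_pow_lt ht (D.k_pos j)]
      with t h1 h2 h3 h4 h5
    have h6 := congrArg ch.N h1
    simp only [branch] at h6
    rw [ch.N_M h2 (hexp0 _), ch.N_M h3 (hexp0 _), chartPoint, chartPoint, Prod.mk.injEq] at h6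
    exact ⟨h6.1, exp_injOn_unitBall h4 h5 (mul_left_cancel₀ hy h6.2)⟩
  · rintro ⟨n, rfl⟩
    obtain ⟨ζ, hζ, hζk, he⟩ := D.exists_rotation (ch.entireFamily hy) j n
    refine Quotient.sound ⟨fun t => ζ * t, by fun_prop, by simp, ?_, ?_⟩
    · rw [deriv_const_mul_id']
      exact hζ
    · filter_upwards [he] with t ht
      simp only [branch, chartPoint]
      rw [ht, D.k_zpow, mul_pow, hζk, one_mul]

theorem coords_branch (hy : y ≠ 0) (D : ch.Local y) {j : Fin ch.d} (hj : D.X j 0 ≠ 0) :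
    coords (branch hy D j hj).point = ch.M (D.X j 0, y) := by
  change ch.M (chartPoint y D j 0) = _
  simp [chartPoint, (D.k_pos j).ne']

theorem branch_mem_smoothLocus (hy : y ≠ 0) (D : ch.Local y) {j : Fin ch.d} (hj : D.X j 0 ≠ 0) :
    ∀ᶠ t in 𝓝[≠] (0 : ℂ), (branch hy D j hj).toFun t ∈ smoothLocus P := by
  filter_upwards [D.eventually_simple j, nhdsWithin_le_nhds (D.eval_X (ch.entireFamily hy) j),
    nhdsWithin_le_nhds (eventually_X_ne_zero hy D hj)] with t h1 h2 h3
  exact ch.mem_smoothLocus h3 (mul_ne_zero hy (Complex.exp_ne_zero _)) h2 (h1 _ h2)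

end Chart

end MahlerVolume

/-! ### Extension of the volume function to the normalization. -/

namespace MahlerVolume

/-- A function on a punctured disc with bounded differential has a limit at the centre. -/
theorem exists_tendsto_of_norm_fderiv_le {f : ℂ → ℝ} {f' : ℂ → ℂ →L[ℝ] ℝ} {C : ℝ}
    (h : ∀ᶠ t in 𝓝[≠] (0 : ℂ), HasFDerivAt f (f' t) t ∧ ‖f' t‖ ≤ C) :
    ∃ L, Tendsto f (𝓝[≠] 0) (𝓝 L) := by
  rw [eventually_nhdsWithin_iff, Metric.eventually_nhds_iff] at h
  obtain ⟨r, hr, h⟩ := h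
  simp only [dist_zero_right, Set.mem_compl_iff, Set.mem_singleton_iff] at h
  have hC : 0 ≤ C := by
    have h1 := h (y := (r / 2 : ℝ)) (by simp [abs_of_pos hr]; linarith) (by simp [hr.ne'])
    exact (norm_nonneg _).trans h1.2
  have hseg : ∀ t t' : ℂ, ‖t‖ < r → ‖t'‖ < r → (0 : ℂ) ∉ segment ℝ t t' →
      |f t' - f t| ≤ C * ‖t' - t‖ := by
    intro t t' ht ht' h0
    refine (convex_segment t t').norm_image_sub_le_of_norm_hasFDerivWithin_le (f := f)
      (f' := f') (C := C) (fun u hu => ?_) (fun u hu => ?_) (left_mem_segment ℝ t t')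
      (right_mem_segment ℝ t t')
    all_goals
      have hu0 : u ≠ 0 := by rintro rfl; exact h0 hu
      have hur : ‖u‖ < r := by
        have := (convex_ball (0 : ℂ) r).segment_subset (x := t) (y := t') (by simpa using ht)
          (by simpa using ht') hu
        simpa using this
    · exact (h hur hu0).1.hasFDerivWithinAt
    · exact (h hur hu0).2
  have key : ∀ t t' : ℂ, ‖t‖ < r → ‖t'‖ < r → t ≠ 0 → t' ≠ 0 →
      |f t' - f t| ≤ C * (‖t‖ + 3 * ‖t'‖) := by
    intro t t' ht ht' ht0 ht0'
    -- When the segment meets the puncture, `t` is a negative multiple of `t'`. The detour through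
    -- `i t'` then consists of two segments avoiding `0`, which costs the factor 3 in the bound.
    by_cases h0 : (0 : ℂ) ∈ segment ℝ t t'
    · obtain ⟨a, c, ha, hc, hac, h1⟩ := h0
      have ha0 : a ≠ 0 := by
        rintro rfl
        rw [zero_add] at hac
        simp [hac, ht0'] at h1
      have hc0 : c ≠ 0 := by
        rintro rfl
        rw [add_zero] at hac
        simp [hac, ht0] at h1
      have hac0 : (a : ℂ) ≠ 0 := by exact_mod_cast ha0
      have h2 : t = -(c / a) * t' := by
        simp only [Complex.real_smul] at h1
        field_simp
        linear_combination h1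
      have hu : ‖Complex.I * t'‖ < r := by simpa using ht'
      have h3 : (0 : ℂ) ∉ segment ℝ t (Complex.I * t') := by
        rintro ⟨a', c', ha', hc', hac', h4⟩
        rw [h2] at h4
        simp only [Complex.real_smul] at h4
        have h5 : (-(a' * (c / a)) + c' * Complex.I : ℂ) = 0 := by
          apply mul_right_cancel₀ ht0'
          linear_combination h4
        have h6 := congrArg Complex.im h5
        have h7 := congrArg Complex.re h5
        have e1 : (-(a' * (c / a)) + c' * Complex.I : ℂ) =
            ((-(a' * (c / a)) : ℝ) : ℂ) + (c' : ℝ) * Complex.I := by push_cast; ring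
        rw [e1] at h6 h7
        simp at h6 h7
        subst h6
        rw [add_zero] at hac'
        rcases h7 with h7 | h7 | h7
        · rw [h7] at hac'; exact zero_ne_one hac'
        · exact hc0 h7
        · exact ha0 h7
      have h4 : (0 : ℂ) ∉ segment ℝ (Complex.I * t') t' := by
        rintro ⟨a', c', ha', hc', hac', h4⟩
        simp only [Complex.real_smul] at h4
        have h5 : (c' + a' * Complex.I : ℂ) = 0 := by
          apply mul_right_cancel₀ ht0'
          linear_combination h4
        have h6 := congrArg Complex.im h5
        have h7 := congrArg Complex.re h5
        simp at h6 h7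
        rw [h6, h7] at hac'
        norm_num at hac'
      have h5 := hseg _ _ ht hu h3
      have h6 := hseg _ _ hu ht' h4
      calc |f t' - f t| ≤ |f t' - f (Complex.I * t')| + |f (Complex.I * t') - f t| :=
            abs_sub_le _ _ _
        _ ≤ C * ‖t' - Complex.I * t'‖ + C * ‖Complex.I * t' - t‖ := add_le_add h6 h5
        _ ≤ C * (‖t'‖ + ‖t'‖) + C * (‖t'‖ + ‖t‖) := by
            gcongr
            · simpa using norm_sub_le t' (Complex.I * t')
            · simpa using norm_sub_le (Complex.I * t') t
        _ = _ := by ring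
    · refine (hseg t t' ht ht' h0).trans ?_
      gcongr
      have := norm_sub_le t' t
      have := norm_nonneg t'
      linarith
  refine cauchy_map_iff_exists_tendsto.1 (Metric.cauchy_iff.2 ⟨inferInstance, fun ε hε => ?_⟩)
  -- The 4 is `1 + 3` from `key`; `C + 1` keeps the denominator positive when `C = 0`.
  have hδ : 0 < min r (ε / (4 * (C + 1))) := by positivity
  refine ⟨f '' (Metric.ball 0 (min r (ε / (4 * (C + 1)))) ∩ {0}ᶜ), ?_, ?_⟩
  · exact image_mem_map (inter_mem (nhdsWithin_le_nhds (Metric.ball_mem_nhds _ hδ))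
      self_mem_nhdsWithin)
  · rintro _ ⟨t, ⟨ht, ht0⟩, rfl⟩ _ ⟨t', ⟨ht', ht0'⟩, rfl⟩
    rw [mem_ball_zero_iff, lt_min_iff] at ht ht'
    rw [dist_comm, Real.dist_eq]
    refine (key t t' ht.1 ht'.1 ht0 ht0').trans_lt ?_
    have h1 := ht.2
    have h2 := ht'.2
    rw [lt_div_iff₀ (by positivity)] at h1 h2
    nlinarith [norm_nonneg t, norm_nonneg t']

theorem hasFDerivAt_comp_smooth {P : Laurent} {V : ℂ × ℂ → ℝ} (hV : IsVolumeFunction P V)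
    {φ : ℂ → ℂ × ℂ} {t : ℂ} (hφ : DifferentiableAt ℂ φ t)
    (hs : ∀ᶠ u in 𝓝 t, φ u ∈ smoothLocus P) :
    HasFDerivAt (fun u => V (φ u)) ((eta (φ t)).comp ((fderiv ℂ φ t).restrictScalars ℝ)) t := by
  have h1 := hV _ hs.self_of_nhds
  have h2 : HasFDerivAt φ ((fderiv ℂ φ t).restrictScalars ℝ) t :=
    hφ.hasFDerivAt.restrictScalars ℝ
  have h3 := h1.comp (s := {u | φ u ∈ smoothLocus P}) t h2.hasFDerivWithinAt (fun u hu => hu)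
  exact h3.hasFDerivAt hs

theorem continuousAt_eta {p : ℂ × ℂ} (h1 : p.1 ≠ 0) (h2 : p.2 ≠ 0) : ContinuousAt eta p := by
  unfold eta
  have e1 : ContinuousAt (fun p : ℂ × ℂ => Real.log ‖p.1‖) p :=
    continuousAt_fst.norm.log (norm_ne_zero_iff.2 h1)
  have e2 : ContinuousAt (fun p : ℂ × ℂ => Real.log ‖p.2‖) p :=
    continuousAt_snd.norm.log (norm_ne_zero_iff.2 h2)
  have e3 : ContinuousAt (fun p : ℂ × ℂ => p.1⁻¹) p := continuousAt_fst.inv₀ h1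
  have e4 : ContinuousAt (fun p : ℂ × ℂ => p.2⁻¹) p := continuousAt_snd.inv₀ h2
  exact (e2.smul (continuousAt_const.clm_comp (e3.smul continuousAt_const))).sub
    (e1.smul (continuousAt_const.clm_comp (e4.smul continuousAt_const)))

/-- Off the centre the differential of `V ∘ φ` is `η ∘ dφ`. This expression is continuous at `t =
0`, because both coordinates are nonzero there, so it is bounded nearby. -/
theorem exists_tendsto_volume {P : Laurent} {V : ℂ × ℂ → ℝ} (hV : IsVolumeFunction P V)
    (φ : BranchParam P) (hs : ∀ᶠ t in 𝓝[≠] (0 : ℂ), φ.toFun t ∈ smoothLocus P) :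
    ∃ L, Tendsto (fun t => V (φ.toFun t)) (𝓝[≠] 0) (𝓝 L) := by
  have hcont : ContinuousAt
      (fun t => (eta (φ.toFun t)).comp ((fderiv ℂ φ.toFun t).restrictScalars ℝ)) 0 := by
    have h1 : ContinuousAt (fun t => eta (φ.toFun t)) 0 :=
      ContinuousAt.comp (continuousAt_eta φ.fst_ne_zero φ.snd_ne_zero) φ.analytic.continuousAt
    have h2 : ContinuousAt (fun t => (fderiv ℂ φ.toFun t).restrictScalars ℝ) 0 :=
      ContinuousAt.comp (g := ContinuousLinearMap.restrictScalars ℝ)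
        (ContinuousLinearMap.continuous_restrictScalars ℝ).continuousAt
        φ.analytic.fderiv.continuousAt
    exact h1.clm_comp h2
  obtain ⟨C, hb⟩ : ∃ C, ∀ᶠ t in 𝓝 (0 : ℂ),
      ‖(eta (φ.toFun t)).comp ((fderiv ℂ φ.toFun t).restrictScalars ℝ)‖ < C :=
    ⟨_, hcont.norm.eventually_lt_const (lt_add_one _)⟩
  have hs' : ∀ᶠ t in 𝓝[≠] (0 : ℂ), ∀ᶠ u in 𝓝 t, φ.toFun u ∈ smoothLocus P := by
    rw [← eventually_eventually_nhdsWithin] at hs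
    filter_upwards [hs, self_mem_nhdsWithin] with t h1 h2
    rwa [isOpen_compl_singleton.nhdsWithin_eq h2] at h1
  refine exists_tendsto_of_norm_fderiv_le
    (f' := fun t => (eta (φ.toFun t)).comp ((fderiv ℂ φ.toFun t).restrictScalars ℝ)) (C := C) ?_
  filter_upwards [hs', nhdsWithin_le_nhds hb, nhdsWithin_le_nhds φ.analytic.eventually_analyticAt]
    with t h1 h2 h3
  exact ⟨hasFDerivAt_comp_smooth hV h3.differentiableAt h1, h2.le⟩

theorem BranchParam.Equivalent.map_eq {P : Laurent} {φ ψ : BranchParam P} (H : φ.Equivalent ψ)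
    {α : Type*} (V : ℂ × ℂ → α) : map (fun t => V (ψ.toFun t)) (𝓝[≠] (0 : ℂ)) =
      map (fun t => V (φ.toFun t)) (𝓝[≠] (0 : ℂ)) := by
  obtain ⟨h, ha, h0, hd, he⟩ := H
  have key : (fun t => V (ψ.toFun t)) =ᶠ[𝓝[≠] 0] ((fun t => V (φ.toFun t)) ∘ h) := by
    filter_upwards [he.filter_mono nhdsWithin_le_nhds] with t ht
    simp [ht]
  rw [map_congr key, ← map_map, map_punctured_nhds ha h0 hd]

/-- The extension of a function on the curve to the normalization by its limits. -/
def extension {P : Laurent} (V : ℂ × ℂ → ℝ) (z : Normalization P) : ℝ :=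
  Quotient.lift (fun φ : BranchParam P => limUnder (𝓝[≠] (0 : ℂ)) fun t => V (φ.toFun t))
    (fun φ ψ H => by
      simp only [limUnder]
      rw [BranchParam.Equivalent.map_eq (show φ.Equivalent ψ from H) V]) z

/-- Every branch is equivalent to a Puiseux branch, and a punctured Puiseux branch lies in the
smooth locus, where `V` is known to be differentiable. -/
theorem Chart.isExtension_extension {P : Laurent} (ch : Chart P) {V : ℂ × ℂ → ℝ}
    (hV : IsVolumeFunction P V) : IsExtension P V (extension V) := by
  intro ψ
  have hy := ch.N_snd_ne_zero ψ.fst_ne_zero ψ.snd_ne_zero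
  obtain ⟨D⟩ := ch.nonempty_local hy
  obtain ⟨j, hj, H⟩ := Chart.exists_branch_equivalent hy D ψ rfl
  obtain ⟨L, hL⟩ := exists_tendsto_volume hV _ (Chart.branch_mem_smoothLocus hy D hj)
  have hL' : Tendsto (fun t => V (ψ.toFun t)) (𝓝[≠] 0) (𝓝 L) := by
    rw [Tendsto, H.map_eq]
    exact hL
  have : extension V ψ.point = L := hL'.limUnder_eq
  rwa [this]

section LogDeriv

variable {𝕜 : Type*} [NontriviallyNormedField 𝕜] [NormedAlgebra 𝕜 ℂ]

theorem hasDerivAt_monomial {X Y : 𝕜 → ℂ} {X' Y' : ℂ} {t : 𝕜} (hX : HasDerivAt X X' t)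
    (hY : HasDerivAt Y Y' t) (hX0 : X t ≠ 0) (hY0 : Y t ≠ 0) (p q : ℤ) :
    HasDerivAt (fun t => X t ^ p * Y t ^ q)
      (X t ^ p * Y t ^ q * (p * (X' / X t) + q * (Y' / Y t))) t := by
  have h1 := (hasDerivAt_zpow p (X t) (Or.inl hX0)).scomp t hX
  have h2 := (hasDerivAt_zpow q (Y t) (Or.inl hY0)).scomp t hY
  refine (h1.mul h2).congr_deriv ?_
  simp only [Function.comp, smul_eq_mul]
  rw [zpow_sub_one₀ hX0, zpow_sub_one₀ hY0]
  field_simp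

end LogDeriv

theorem log_norm_monomial {x y : ℂ} (hx : x ≠ 0) (hy : y ≠ 0) (p q : ℤ) :
    Real.log ‖x ^ p * y ^ q‖ = p * Real.log ‖x‖ + q * Real.log ‖y‖ := by
  rw [norm_mul, norm_zpow, norm_zpow, Real.log_mul (zpow_ne_zero _ (norm_ne_zero_iff.2 hx))
    (zpow_ne_zero _ (norm_ne_zero_iff.2 hy)), Real.log_zpow, Real.log_zpow]

/-- The derivative of a volume function along a curve, in the coordinates of a chart. -/
theorem Chart.hasDerivAt_volume {P : Laurent} (ch : Chart P) {V : ℂ × ℂ → ℝ}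
    (hV : IsVolumeFunction P V) {X Y : ℝ → ℂ} {X' Y' : ℂ} {t : ℝ} (hX : HasDerivAt X X' t)
    (hY : HasDerivAt Y Y' t) (hX0 : X t ≠ 0) (hY0 : Y t ≠ 0)
    (hs : ∀ᶠ u in 𝓝 t, ch.M (X u, Y u) ∈ smoothLocus P) :
    HasDerivAt (fun u => V (ch.M (X u, Y u)))
      (Real.log ‖Y t‖ * (X' / X t).im - Real.log ‖X t‖ * (Y' / Y t).im) t := by
  have h1 := hV _ hs.self_of_nhds
  have h2 := (hasDerivAt_monomial hX hY hX0 hY0 ch.p ch.q).prodMk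
    (hasDerivAt_monomial hX hY hX0 hY0 ch.r ch.s)
  have h3 := h1.comp_hasDerivWithinAt (s := {u | ch.M (X u, Y u) ∈ smoothLocus P}) t
    h2.hasDerivWithinAt (fun u hu => hu)
  refine (h3.hasDerivAt hs).congr_deriv ?_
  rw [eta_apply]
  have e1 : X t ^ ch.p * Y t ^ ch.q ≠ 0 := mul_ne_zero (zpow_ne_zero _ hX0) (zpow_ne_zero _ hY0)
  have e2 : X t ^ ch.r * Y t ^ ch.s ≠ 0 := mul_ne_zero (zpow_ne_zero _ hX0) (zpow_ne_zero _ hY0)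
  simp only [M, monomialMap]
  rw [mul_div_cancel_left₀ _ e1, mul_div_cancel_left₀ _ e2, log_norm_monomial hX0 hY0,
    log_norm_monomial hX0 hY0]
  -- The form `η` is alternating in the two logarithmic coordinates, so the monomial change of
  -- variables multiplies it by its determinant, which is 1.
  have hd : (ch.p * ch.s - ch.q * ch.r : ℝ) = 1 := by exact_mod_cast ch.det
  have him : ∀ (a c : ℤ) (u v : ℂ), (a * u + c * v).im = a * u.im + c * v.im := by
    intro a c u v
    simp
  rw [him, him]
  linear_combination (Real.log ‖Y t‖ * (X' / X t).im - Real.log ‖X t‖ * (Y' / Y t).im) * hd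

end MahlerVolume

/-! ### Points of the projective line and asymptotics of germs. -/

namespace MahlerVolume

/-- The point `[u : v]` of the projective line. -/
def ratio (u v : ℂ) : OnePoint ℂ :=
  open Classical in if v = 0 then OnePoint.infty else ((u / v : ℂ) : OnePoint ℂ)

theorem ratio_zero (u : ℂ) : ratio u 0 = OnePoint.infty := by simp [ratio]

theorem ratio_of_ne {v : ℂ} (u : ℂ) (hv : v ≠ 0) : ratio u v = ((u / v : ℂ) : OnePoint ℂ) := by
  simp [ratio, hv]

theorem gauss_eq_ratio (P : Laurent) (p : ℂ × ℂ) : gauss P p = ratio (xDx P p) (yDy P p) := rfl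

theorem ratio_mul_left {c : ℂ} (hc : c ≠ 0) (u v : ℂ) : ratio (c * u) (c * v) = ratio u v := by
  by_cases hv : v = 0
  · simp [hv, ratio_zero]
  · rw [ratio_of_ne _ hv, ratio_of_ne _ (mul_ne_zero hc hv), mul_div_mul_left _ _ hc]

theorem ratio_eq_of_add_eq_zero {u v a b : ℂ} (h : u * a + v * b = 0) (huv : u ≠ 0 ∨ v ≠ 0)
    (hab : a ≠ 0 ∨ b ≠ 0) : ratio u v = ratio (-b) a := by
  by_cases hv : v = 0
  · subst hv
    have hu : u ≠ 0 := by simpa using huv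
    have ha : a = 0 := by simpa [hu] using h
    rw [ha, ratio_zero, ratio_zero]
  · have ha : a ≠ 0 := by
      rintro rfl
      simp only [mul_zero, zero_add, mul_eq_zero, hv, false_or] at h
      simp [h] at hab
    rw [ratio_of_ne _ hv, ratio_of_ne _ ha]
    congr 1
    rw [div_eq_div_iff hv ha]
    linear_combination h

theorem ratio_ofReal_mem_range (u v : ℝ) :
    ratio u v ∈ Set.range (OnePoint.map ((↑) : ℝ → ℂ)) := by
  by_cases hv : v = 0
  · exact ⟨OnePoint.infty, by rw [hv, Complex.ofReal_zero, ratio_zero]; rfl⟩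
  · refine ⟨((u / v : ℝ) : OnePoint ℝ), ?_⟩
    rw [ratio_of_ne _ (by exact_mod_cast hv), OnePoint.map_some]
    push_cast
    rfl

theorem tendsto_ratio {l : Filter ℂ} {u v : ℂ → ℂ} {u₀ v₀ : ℂ} (hu : Tendsto u l (𝓝 u₀))
    (hv : Tendsto v l (𝓝 v₀)) (h : u₀ ≠ 0 ∨ v₀ ≠ 0) :
    Tendsto (fun t => ratio (u t) (v t)) l (𝓝 (ratio u₀ v₀)) := by
  by_cases hv0 : v₀ = 0
  · subst hv0
    have hu0 : u₀ ≠ 0 := by simpa using h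
    rw [ratio_zero, Tendsto, OnePoint.le_nhds_infty]
    intro K _ hK
    obtain ⟨R, hR⟩ := hK.isBounded.exists_norm_le
    have hu1 : 0 < ‖u₀‖ := norm_pos_iff.2 hu0
    have h1 : ∀ᶠ t in l, ‖u₀‖ / 2 < ‖u t‖ := hu.norm.eventually_const_lt (by linarith)
    have h2 : ∀ᶠ t in l, R * ‖v t‖ < ‖u₀‖ / 2 := by
      have := hv.norm.const_mul R
      rw [norm_zero, mul_zero] at this
      exact this.eventually_lt_const (by linarith)
    refine mem_map.2 ?_
    filter_upwards [h1, h2] with t h3 h4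
    by_cases hv0 : v t = 0
    · exact Or.inr (show ratio (u t) (v t) = _ by rw [hv0, ratio_zero])
    · refine Or.inl ⟨u t / v t, fun hz => ?_, (ratio_of_ne _ hv0).symm⟩
      have h5 := hR _ hz
      rw [norm_div, div_le_iff₀ (norm_pos_iff.2 hv0)] at h5
      linarith
  · rw [ratio_of_ne _ hv0]
    have h1 : Tendsto (fun t => ((u t / v t : ℂ) : OnePoint ℂ)) l
        (𝓝 ((u₀ / v₀ : ℂ) : OnePoint ℂ)) :=
      (OnePoint.continuous_coe.tendsto _).comp (hu.div hv hv0)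
    refine h1.congr' ?_
    filter_upwards [hv.eventually_ne hv0] with t ht
    rw [ratio_of_ne _ ht]

/-- Integration of an asymptotic equivalent of a logarithmic derivative. -/
theorem tendsto_div_pow_of_deriv {u : ℂ → ℂ} (hu : AnalyticAt ℂ u 0) (hu0 : u 0 = 0) {k : ℕ}
    (hk : 0 < k) {β : ℂ}
    (h : Tendsto (fun t => deriv u t / (k * t ^ (k - 1))) (𝓝[≠] 0) (𝓝 β)) :
    Tendsto (fun t => u t / t ^ k) (𝓝[≠] 0) (𝓝 β) := by
  have hk0 : (k : ℂ) ≠ 0 := by exact_mod_cast hk.ne'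
  have hk1 : (0 : ℝ) < k := by exact_mod_cast hk
  rw [Metric.tendsto_nhds]
  intro ε hε
  have h1 : ∀ᶠ t in 𝓝[≠] (0 : ℂ), ‖deriv u t - β * (k * t ^ (k - 1))‖ ≤
      ε / (2 * k) * (k * ‖t‖ ^ (k - 1)) := by
    filter_upwards [Metric.tendsto_nhds.1 h (ε / (2 * k)) (by positivity), self_mem_nhdsWithin]
      with t ht ht0
    have ht0' : (t : ℂ) ^ (k - 1) ≠ 0 := pow_ne_zero _ ht0
    have h2 : deriv u t - β * (k * t ^ (k - 1)) =
        (deriv u t / (k * t ^ (k - 1)) - β) * (k * t ^ (k - 1)) := by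
      field_simp
    rw [h2, norm_mul, norm_mul, norm_pow, Complex.norm_natCast]
    rw [dist_eq_norm] at ht
    gcongr
  -- The mean value inequality is applied on a disc containing `0`, so the bound known on the
  -- punctured disc must first be extended to the centre by continuity.
  have h2 : ‖deriv u 0 - β * (k * 0 ^ (k - 1))‖ ≤ ε / (2 * k) * (k * ‖(0 : ℂ)‖ ^ (k - 1)) := by
    have c1 : ContinuousAt (fun t => ‖deriv u t - β * (k * t ^ (k - 1))‖) 0 :=
      (hu.deriv.continuousAt.sub (by fun_prop)).norm
    have c2 : ContinuousAt (fun t : ℂ => ε / (2 * k) * (k * ‖t‖ ^ (k - 1))) 0 := by fun_prop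
    exact le_of_tendsto_of_tendsto (c1.tendsto.mono_left nhdsWithin_le_nhds)
      (c2.tendsto.mono_left nhdsWithin_le_nhds) h1
  have h3 : ∀ᶠ t in 𝓝 (0 : ℂ), ‖deriv u t - β * (k * t ^ (k - 1))‖ ≤
      ε / (2 * k) * (k * ‖t‖ ^ (k - 1)) ∧ DifferentiableAt ℂ u t := by
    rw [eventually_nhdsWithin_iff] at h1
    filter_upwards [h1, hu.eventually_analyticAt] with t ht hta
    refine ⟨?_, hta.differentiableAt⟩
    by_cases ht0 : t = 0
    · rw [ht0]; exact h2
    · exact ht ht0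
  obtain ⟨δ, hδ, h3⟩ := Metric.eventually_nhds_iff.1 h3
  simp only [dist_zero_right] at h3
  filter_upwards [nhdsWithin_le_nhds (Metric.ball_mem_nhds (0 : ℂ) hδ), self_mem_nhdsWithin]
    with t ht ht0
  rw [mem_ball_zero_iff] at ht
  have ht1 : 0 < ‖t‖ := norm_pos_iff.2 ht0
  have h4 := (convex_closedBall (0 : ℂ) ‖t‖).norm_image_sub_le_of_norm_hasDerivWithin_le
    (f := fun s => u s - β * s ^ k) (f' := fun s => deriv u s - β * (k * s ^ (k - 1)))
    (C := ε / (2 * k) * (k * ‖t‖ ^ (k - 1))) (x := 0) (y := t)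
    (fun s hs => ?_) (fun s hs => ?_) (by simp) (by simp)
  · simp only [hu0, zero_pow hk.ne', mul_zero, sub_zero] at h4
    have ht2 : (t : ℂ) ^ k ≠ 0 := pow_ne_zero _ ht0
    rw [dist_eq_norm, show u t / t ^ k - β = (u t - β * t ^ k) / t ^ k by field_simp, norm_div,
      norm_pow, div_lt_iff₀ (by positivity)]
    refine h4.trans_lt ?_
    have h5 : ‖t‖ ^ k = ‖t‖ ^ (k - 1) * ‖t‖ := by
      rw [← pow_succ, Nat.sub_add_cancel hk]
    rw [h5]
    have h6 : 0 < ‖t‖ ^ (k - 1) * ‖t‖ := by positivity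
    calc ε / (2 * k) * (k * ‖t‖ ^ (k - 1)) * ‖t‖ = ε / 2 * (‖t‖ ^ (k - 1) * ‖t‖) := by
          field_simp
      _ < ε * (‖t‖ ^ (k - 1) * ‖t‖) := by nlinarith
  · rw [mem_closedBall_zero_iff] at hs
    have h5 := (h3 (hs.trans_lt ht)).2.hasDerivAt
    exact (h5.sub ((hasDerivAt_pow k s).const_mul β)).hasDerivWithinAt
  · rw [mem_closedBall_zero_iff] at hs
    refine (h3 (hs.trans_lt ht)).1.trans ?_
    gcongr

theorem exists_log_quotient {X : ℂ → ℂ} (hX : AnalyticAt ℂ X 0) (hX0 : X 0 ≠ 0) :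
    ∃ u : ℂ → ℂ, AnalyticAt ℂ u 0 ∧ u 0 = 0 ∧ (∀ᶠ t in 𝓝 0, X t = X 0 * Complex.exp (u t)) ∧
      ∀ᶠ t in 𝓝 0, deriv u t = deriv X t / X t := by
  have hu : AnalyticAt ℂ (fun t => Complex.log (X t / X 0)) 0 :=
    (hX.div analyticAt_const hX0).clog (by simp [hX0])
  have hne : ∀ᶠ t in 𝓝 0, X t ≠ 0 := hX.continuousAt.eventually_ne hX0
  have hexp : ∀ᶠ t in 𝓝 0, X t = X 0 * Complex.exp (Complex.log (X t / X 0)) := by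
    filter_upwards [hne] with t ht
    rw [Complex.exp_log (div_ne_zero ht hX0), mul_div_cancel₀ _ hX0]
  refine ⟨_, hu, by simp [hX0], hexp, ?_⟩
  filter_upwards [hexp.eventually_nhds, hu.eventually_analyticAt, hne] with t h1 h2 h3
  have h4 := (h2.differentiableAt.hasDerivAt.cexp.const_mul (X 0)).congr_of_eventuallyEq h1
  rw [h4.deriv, ← mul_assoc, ← h1.self_of_nhds, mul_div_cancel_left₀ _ h3]

theorem tendsto_exp_sub_one_div {c : ℂ → ℂ} {c₀ : ℂ} {k : ℕ} (hk : 0 < k)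
    (hc : Tendsto c (𝓝[≠] 0) (𝓝 c₀)) :
    Tendsto (fun t => (Complex.exp (t ^ k * c t) - 1) / t ^ k) (𝓝[≠] 0) (𝓝 c₀) := by
  have h1 : Tendsto (fun t : ℂ => t ^ k * c t) (𝓝[≠] 0) (𝓝 0) := by
    have : Tendsto (fun t : ℂ => t ^ k) (𝓝[≠] 0) (𝓝 0) := by
      have h := ((continuous_pow k).tendsto (0 : ℂ)).mono_left (nhdsWithin_le_nhds (s := {0}ᶜ))
      simpa [hk.ne'] using h
    simpa using this.mul hc
  have h2 : ContinuousAt (dslope Complex.exp 0) 0 :=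
    continuousAt_dslope_same.2 Complex.differentiableAt_exp
  have h3 : Tendsto (fun t : ℂ => c t * dslope Complex.exp 0 (t ^ k * c t)) (𝓝[≠] 0) (𝓝 c₀) := by
    have := hc.mul (h2.tendsto.comp h1)
    simpa [dslope_same] using this
  refine h3.congr' ?_
  filter_upwards [self_mem_nhdsWithin] with t ht
  have ht' : t ^ k ≠ 0 := pow_ne_zero _ ht
  have h4 := sub_smul_dslope Complex.exp 0 (t ^ k * c t)
  rw [sub_zero, Complex.exp_zero, smul_eq_mul] at h4
  rw [← h4]
  field_simp

/-- A finite nonzero limit means meromorphic order `0` for `t^{-k} f`, and orders add. -/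
theorem analyticOrderNatAt_eq_of_tendsto {E : Type*} [NormedAddCommGroup E] [NormedSpace ℂ E]
    {f : ℂ → E} (hf : AnalyticAt ℂ f 0) {k : ℕ} {v : E} (hv : v ≠ 0)
    (h : Tendsto (fun t => (t ^ k)⁻¹ • f t) (𝓝[≠] 0) (𝓝 v)) : analyticOrderNatAt f 0 = k := by
  have h1 : MeromorphicAt (fun t : ℂ => (t ^ k)⁻¹) 0 := by fun_prop
  have h2 : MeromorphicAt (fun t => (t ^ k)⁻¹ • f t) 0 := h1.smul hf.meromorphicAt
  have h3 : meromorphicOrderAt (fun t => (t ^ k)⁻¹ • f t) 0 = 0 :=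
    (tendsto_ne_zero_iff_meromorphicOrderAt_eq_zero h2).1 ⟨v, hv, h⟩
  have h4 : meromorphicOrderAt (fun t : ℂ => (t ^ k)⁻¹) 0 = ((-(k : ℤ) : ℤ) : WithTop ℤ) := by
    rw [meromorphicOrderAt_eq_int_iff h1]
    exact ⟨1, analyticAt_const, one_ne_zero, Eventually.of_forall fun t => by simp⟩
  have h5 := meromorphicOrderAt_smul h1 hf.meromorphicAt
  rw [show ((fun t : ℂ => (t ^ k)⁻¹) • f) = fun t => (t ^ k)⁻¹ • f t from rfl, h3, h4,
    hf.meromorphicOrderAt_eq] at h5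
  rw [analyticOrderNatAt]
  cases hn : analyticOrderAt f 0 with
  | top => rw [hn] at h5; simp at h5
  | coe n =>
    rw [hn] at h5
    simp only [ENat.map_natCast] at h5
    have h6 : (0 : ℤ) = -(k : ℤ) + n := by
      have : ((0 : ℤ) : WithTop ℤ) = ((-(k : ℤ) + n : ℤ) : WithTop ℤ) := by
        rw [WithTop.coe_add]; exact h5
      exact_mod_cast this
    simp
    omega

end MahlerVolume

/-! ### The slope of a branch at a point over the torus. -/

namespace MahlerVolume

open Polynomial Function.Periodic

namespace Chart

variable {P : Laurent} {ch : Chart P}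

theorem log_norm_M_eq_zero_iff (ch : Chart P) {x y : ℂ} (hx : x ≠ 0) (hy : y ≠ 0) :
    (Real.log ‖(ch.M (x, y)).1‖, Real.log ‖(ch.M (x, y)).2‖) = ((0, 0) : ℝ × ℝ) ↔
      ‖x‖ = 1 ∧ ‖y‖ = 1 := by
  have hd : (ch.p * ch.s - ch.q * ch.r : ℝ) = 1 := by exact_mod_cast ch.det
  have h0 : ∀ z : ℂ, z ≠ 0 → (Real.log ‖z‖ = 0 ↔ ‖z‖ = 1) := by
    intro z hz
    have := norm_pos_iff.2 hz
    constructor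
    · intro h
      rw [← Real.exp_log this, h, Real.exp_zero]
    · intro h
      rw [h, Real.log_one]
  simp only [M, monomialMap]
  rw [log_norm_monomial hx hy, log_norm_monomial hx hy, Prod.mk.injEq, ← h0 x hx, ← h0 y hy]
  constructor
  · rintro ⟨h1, h2⟩
    exact ⟨by linear_combination (-Real.log ‖x‖) * hd + ch.s * h1 - ch.q * h2,
      by linear_combination (-Real.log ‖y‖) * hd - ch.r * h1 + ch.p * h2⟩
  · rintro ⟨h1, h2⟩
    rw [h1, h2]
    simp

variable {y : ℂ}

theorem branch_mem_toricPoints_iff (hy : y ≠ 0) (D : ch.Local y) {j : Fin ch.d}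
    (hj : D.X j 0 ≠ 0) :
    (branch hy D j hj).point ∈ toricPoints P ↔ ‖D.X j 0‖ = 1 ∧ ‖y‖ = 1 := by
  change mu _ = _ ↔ _
  rw [mu, coords_branch, ch.log_norm_M_eq_zero_iff hj hy]

/-- The logarithmic derivative of `X` with respect to `Y` along a Puiseux branch. -/
def logSlope (D : ch.Local y) (j : Fin ch.d) (t : ℂ) : ℂ :=
  deriv (D.X j) t / D.X j t / (D.k j * t ^ (D.k j - 1))

/-- Differentiating `P = 0` along the branch and dividing by `k t^{k-1}` gives a linear relation
between `x∂P/∂x`, `y∂P/∂y` and the logarithmic velocities `pλ + q`, `rλ + s`, where `λ` is the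
slope. It determines their ratio as an integral Möbius transform of `λ`. -/
theorem gauss_branch (hy : y ≠ 0) (D : ch.Local y) {j : Fin ch.d} (hj : D.X j 0 ≠ 0) :
    ∀ᶠ t in 𝓝[≠] (0 : ℂ), gauss P ((branch hy D j hj).toFun t) =
      ratio (-(ch.r * logSlope D j t + ch.s)) (ch.p * logSlope D j t + ch.q) := by
  have hd : (ch.p * ch.s - ch.q * ch.r : ℂ) = 1 := by exact_mod_cast ch.det
  filter_upwards [branch_mem_smoothLocus hy D hj, self_mem_nhdsWithin,
    nhdsWithin_le_nhds (eventually_X_ne_zero hy D hj),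
    nhdsWithin_le_nhds (D.analyticAt_X (ch.entireFamily hy) j).eventually_analyticAt,
    nhdsWithin_le_nhds (branch hy D j hj).eval_eq_zero.eventually_nhds] with t h1 h2 h3 h4 h5
  have hY0 : y * Complex.exp (t ^ D.k j) ≠ 0 := mul_ne_zero hy (Complex.exp_ne_zero _)
  have hX := h4.differentiableAt.hasDerivAt
  have hY : HasDerivAt (fun t : ℂ => y * Complex.exp (t ^ D.k j))
      (y * (Complex.exp (t ^ D.k j) * (D.k j * t ^ (D.k j - 1)))) t :=
    (hasDerivAt_pow (D.k j) t).cexp.const_mul y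
  have h6 := hasDerivAt_monomial hX hY h3 hY0 ch.p ch.q
  have h7 := hasDerivAt_monomial hX hY h3 hY0 ch.r ch.s
  have hm1 : D.X j t ^ ch.p * (y * Complex.exp (t ^ D.k j)) ^ ch.q ≠ 0 :=
    mul_ne_zero (zpow_ne_zero _ h3) (zpow_ne_zero _ hY0)
  have hm2 : D.X j t ^ ch.r * (y * Complex.exp (t ^ D.k j)) ^ ch.s ≠ 0 :=
    mul_ne_zero (zpow_ne_zero _ h3) (zpow_ne_zero _ hY0)
  have h8 := hasDerivAt_eval P h6 h7 hm1 hm2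
  have h9 := h8.unique ((hasDerivAt_const t (0 : ℂ)).congr_of_eventuallyEq h5)
  rw [mul_div_cancel_left₀ _ hm1, mul_div_cancel_left₀ _ hm2] at h9
  have hk : (D.k j : ℂ) * t ^ (D.k j - 1) ≠ 0 :=
    mul_ne_zero (Nat.cast_ne_zero.2 (D.k_pos j).ne') (pow_ne_zero _ h2)
  have hXs : deriv (D.X j) t / D.X j t = D.k j * t ^ (D.k j - 1) * logSlope D j t := by
    rw [logSlope, mul_div_cancel₀ _ hk]
  have hYs : y * (Complex.exp (t ^ D.k j) * (D.k j * t ^ (D.k j - 1))) /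
      (y * Complex.exp (t ^ D.k j)) = D.k j * t ^ (D.k j - 1) := by
    rw [← mul_assoc, mul_div_cancel_left₀ _ hY0]
  rw [hXs, hYs] at h9
  have hab : ch.p * logSlope D j t + ch.q ≠ 0 ∨ ch.r * logSlope D j t + ch.s ≠ 0 := by
    by_contra! h
    apply one_ne_zero (α := ℂ)
    linear_combination -hd + ch.p * h.2 - ch.r * h.1
  rw [gauss_eq_ratio]
  refine ratio_eq_of_add_eq_zero ?_ h1.2.2.2 hab
  apply mul_left_cancel₀ hk
  have h10 : xDx P ((branch hy D j hj).toFun t) *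
        (ch.p * (D.k j * t ^ (D.k j - 1) * logSlope D j t) + ch.q * (D.k j * t ^ (D.k j - 1))) +
      yDy P ((branch hy D j hj).toFun t) *
        (ch.r * (D.k j * t ^ (D.k j - 1) * logSlope D j t) + ch.s * (D.k j * t ^ (D.k j - 1))) =
      0 := h9
  linear_combination h10

theorem meromorphicAt_logSlope (hy : y ≠ 0) (D : ch.Local y) (j : Fin ch.d) :
    MeromorphicAt (logSlope D j) 0 := by
  have hX := D.analyticAt_X (ch.entireFamily hy) j
  exact (hX.deriv.meromorphicAt.div hX.meromorphicAt).div (by fun_prop)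

/-- At a toric point of a regular curve, the logarithmic slope has a non-real limit. -/
theorem exists_tendsto_logSlope (hreg : IsLogRegular P) (hy : y ≠ 0) (hy1 : ‖y‖ = 1)
    (D : ch.Local y) {j : Fin ch.d} (hj : D.X j 0 ≠ 0) (hj1 : ‖D.X j 0‖ = 1) :
    ∃ β : ℂ, β.im ≠ 0 ∧ Tendsto (logSlope D j) (𝓝[≠] 0) (𝓝 β) ∧
      epsilon (branch hy D j hj).point = -Real.sign β.im := by
  have hd : (ch.p * ch.s - ch.q * ch.r : ℝ) = 1 := by exact_mod_cast ch.det
  have hz := hreg _ ((branch_mem_toricPoints_iff hy D hj).2 ⟨hj1, hy1⟩)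
  have hlim : ∀ {c : OnePoint ℂ}, Tendsto (fun t => ratio (-(ch.r * logSlope D j t + ch.s))
      (ch.p * logSlope D j t + ch.q)) (𝓝[≠] 0) (𝓝 c) → gaussExt (branch hy D j hj).point = c := by
    intro c hc
    exact (hc.congr' ((gauss_branch hy D hj).mono fun t ht => ht.symm)).limUnder_eq
  rcases lt_or_ge (meromorphicOrderAt (logSlope D j) 0) 0 with ho | ho
  -- If the slope had a pole, `γ` would be the image of `∞` under a real Möbius transformation,
  -- hence in `ℙ¹(ℝ)`, which regularity forbids. A finite real limit is excluded in the same way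
  -- below.
  · exfalso
    have h1 := tendsto_cobounded_of_meromorphicOrderAt_neg ho
    have h2 : Tendsto (fun t => (logSlope D j t)⁻¹) (𝓝[≠] 0) (𝓝 0) := tendsto_inv₀_cobounded.comp h1
    have h3 : ∀ᶠ t in 𝓝[≠] (0 : ℂ), logSlope D j t ≠ 0 :=
      h1.eventually (Bornology.eventually_ne_cobounded 0)
    have h4 : Tendsto (fun t => ratio (-(ch.r * logSlope D j t + ch.s))
        (ch.p * logSlope D j t + ch.q)) (𝓝[≠] 0)
        (𝓝 (ratio (-((ch.r : ℂ) + ch.s * 0)) (ch.p + ch.q * 0))) := by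
      refine (tendsto_ratio ((h2.const_mul _).const_add _).neg ((h2.const_mul _).const_add _)
        ?_).congr' ?_
      · by_contra! h
        simp only [mul_zero, add_zero, neg_eq_zero, Int.cast_eq_zero] at h
        have := ch.det
        simp [h.1, h.2] at this
      · filter_upwards [h3] with t ht
        rw [← ratio_mul_left ht]
        congr 1 <;> field_simp
    rw [hlim h4] at hz
    refine hz ?_
    have := ratio_ofReal_mem_range (-(ch.r : ℝ)) (ch.p : ℝ)
    simpa using this
  · obtain ⟨β, hβ⟩ := tendsto_nhds_of_meromorphicOrderAt_nonneg (meromorphicAt_logSlope hy D j) ho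
    have h4 : Tendsto (fun t => ratio (-(ch.r * logSlope D j t + ch.s))
        (ch.p * logSlope D j t + ch.q)) (𝓝[≠] 0)
        (𝓝 (ratio (-(ch.r * β + ch.s)) (ch.p * β + ch.q))) := by
      refine tendsto_ratio ((hβ.const_mul _).add_const _).neg ((hβ.const_mul _).add_const _) ?_
      by_contra! h
      have hd' : (ch.p * ch.s - ch.q * ch.r : ℂ) = 1 := by exact_mod_cast ch.det
      apply one_ne_zero (α := ℂ)
      linear_combination -hd' - ch.p * h.1 - ch.r * h.2
    have h5 := hlim h4
    have hβi : β.im ≠ 0 := by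
      intro h0
      rw [h5] at hz
      have h6 : β = (β.re : ℂ) := Complex.ext rfl (by simpa using h0)
      refine hz ?_
      have := ratio_ofReal_mem_range (-(ch.r * β.re + ch.s)) (ch.p * β.re + ch.q)
      rw [h6]
      push_cast at this
      exact this
    refine ⟨β, hβi, hβ, ?_⟩
    have hv : (ch.p * β + ch.q : ℂ) ≠ 0 := by
      intro h
      have h6 := congrArg Complex.im h
      have h7 := congrArg Complex.re h
      simp [hβi] at h6
      simp [h6] at h7
      have := ch.det
      simp [h6, h7] at this
    rw [epsilon, h5, ratio_of_ne _ hv]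
    congr 1
    change Real.sign (-(ch.r * β + ch.s) / (ch.p * β + ch.q) : ℂ).im = _
    -- The Möbius transformation is real of determinant 1, so it multiplies the imaginary part by
    -- `|pβ + q|^{-2}` and preserves its sign.
    have h8 : (-(ch.r * β + ch.s) / (ch.p * β + ch.q) : ℂ).im =
        β.im * (Complex.normSq (ch.p * β + ch.q))⁻¹ := by
      rw [Complex.div_im]
      simp only [Complex.neg_im, Complex.neg_re, Complex.add_im, Complex.add_re, Complex.mul_im,
        Complex.mul_re, Complex.intCast_re, Complex.intCast_im]
      linear_combination β.im * (Complex.normSq (ch.p * β + ch.q))⁻¹ * hd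
    rw [h8]
    have h9 : 0 < (Complex.normSq (ch.p * β + ch.q))⁻¹ := inv_pos.2 (Complex.normSq_pos.2 hv)
    rcases lt_or_gt_of_ne hβi with h | h
    · rw [Real.sign_of_neg h, Real.sign_of_neg (mul_neg_of_neg_of_pos h h9)]
    · rw [Real.sign_of_pos h, Real.sign_of_pos (mul_pos h h9)]

/-- Integrating the slope, `log (X / X(0))` is `t^k` times a function tending to the same limit `β`.
-/
theorem exists_X_eq_exp (hy : y ≠ 0) (D : ch.Local y) {j : Fin ch.d} (hj : D.X j 0 ≠ 0) {β : ℂ}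
    (hβ : Tendsto (logSlope D j) (𝓝[≠] 0) (𝓝 β)) :
    ∃ v : ℂ → ℂ, Tendsto v (𝓝[≠] 0) (𝓝 β) ∧
      ∀ᶠ t in 𝓝[≠] (0 : ℂ), D.X j t = D.X j 0 * Complex.exp (t ^ D.k j * v t) := by
  obtain ⟨u, hu, hu0, hX, hu'⟩ :=
    exists_log_quotient (D.analyticAt_X (ch.entireFamily hy) j) hj
  refine ⟨fun t => u t / t ^ D.k j, tendsto_div_pow_of_deriv hu hu0 (D.k_pos j) ?_, ?_⟩
  · refine hβ.congr' ?_
    filter_upwards [nhdsWithin_le_nhds hu'] with t ht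
    rw [ht, logSlope]
  · filter_upwards [nhdsWithin_le_nhds hX, self_mem_nhdsWithin] with t h1 h2
    rw [mul_div_cancel₀ _ (pow_ne_zero _ h2)]
    exact h1

/-- After division by `t^k` the displacement of `(x, y)` tends to a vector proportional, coordinate
by coordinate, to `(pβ + q, rβ + s)`. This is nonzero since the determinant is 1, so the order of
vanishing is exactly `k`. -/
theorem ramification_branch (hy : y ≠ 0) (D : ch.Local y) {j : Fin ch.d} (hj : D.X j 0 ≠ 0) {β : ℂ}
    (hβ : Tendsto (logSlope D j) (𝓝[≠] 0) (𝓝 β)) :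
    ramification (branch hy D j hj).point = D.k j := by
  obtain ⟨v, hv, hX⟩ := exists_X_eq_exp hy D hj hβ
  have key : ∀ p q : ℤ, Tendsto (fun t => (t ^ D.k j)⁻¹ *
      (D.X j t ^ p * (y * Complex.exp (t ^ D.k j)) ^ q - D.X j 0 ^ p * y ^ q)) (𝓝[≠] 0)
      (𝓝 (D.X j 0 ^ p * y ^ q * (p * β + q))) := by
    intro p q
    have h1 := (tendsto_exp_sub_one_div (D.k_pos j) ((hv.const_mul (p : ℂ)).add_const (q : ℂ)))
    refine (h1.const_mul (D.X j 0 ^ p * y ^ q)).congr' ?_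
    filter_upwards [hX] with t ht
    rw [ht, mul_zpow, mul_zpow, ← Complex.exp_int_mul, ← Complex.exp_int_mul]
    have : Complex.exp (t ^ D.k j * (p * v t + q)) =
        Complex.exp (p * (t ^ D.k j * v t)) * Complex.exp (q * t ^ D.k j) := by
      rw [← Complex.exp_add]; ring_nf
    rw [this]
    ring
  have h0 : (branch hy D j hj).toFun 0 = ch.M (D.X j 0, y) := coords_branch hy D hj
  change analyticOrderNatAt
    (fun t => (branch hy D j hj).toFun t - (branch hy D j hj).toFun 0) 0 = _
  refine analyticOrderNatAt_eq_of_tendsto ((branch hy D j hj).analytic.sub analyticAt_const)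
    (v := (D.X j 0 ^ ch.p * y ^ ch.q * (ch.p * β + ch.q),
      D.X j 0 ^ ch.r * y ^ ch.s * (ch.r * β + ch.s))) ?_ ?_
  · intro h
    rw [Prod.mk_eq_zero] at h
    simp only [mul_eq_zero, zpow_ne_zero _ hj, zpow_ne_zero _ hy, false_or] at h
    have hd' : (ch.p * ch.s - ch.q * ch.r : ℂ) = 1 := by exact_mod_cast ch.det
    apply one_ne_zero (α := ℂ)
    linear_combination -hd' + ch.p * h.2 - ch.r * h.1
  · rw [h0]
    exact (key ch.p ch.q).prodMk_nhds (key ch.r ch.s)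

end Chart

end MahlerVolume

/-! ### Local extrema of the volume function. -/

namespace MahlerVolume

open Polynomial Function.Periodic

theorem hasDerivAt_comp_line {f : ℂ → ℂ} {f' t : ℂ} {u : ℝ} (h : HasDerivAt f f' (u * t)) :
    HasDerivAt (fun u : ℝ => f (u * t)) (f' * t) u := by
  have h1 : HasDerivAt (fun u : ℝ => (u : ℂ) * t) t u := by
    simpa using (Complex.ofRealCLM.hasDerivAt (x := u)).mul_const t
  have h2 := h.scomp u h1
  rwa [smul_eq_mul, mul_comm] at h2

namespace Chart

variable {P : Laurent} {ch : Chart P} {y : ℂ}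

theorem tendsto_extension {V : ℂ × ℂ → ℝ} (hV : IsVolumeFunction P V) (hy : y ≠ 0)
    (D : ch.Local y) {j : Fin ch.d} (hj : D.X j 0 ≠ 0) :
    Tendsto (fun t => V (ch.M (chartPoint y D j t))) (𝓝[≠] 0)
      (𝓝 (extension V (branch hy D j hj).point)) :=
  ch.isExtension_extension hV (branch hy D j hj)

/-- Along the ray `u ↦ ut`, with `w = (ut)^k`, `log Y` and `log X` vary like `w` and `βw`. The
derivative of `V` is then close to `(k/u) |w|² Im β`, so `c V` is monotone on the ray and is
compared with its limit at the centre. The sign `c` treats maxima and minima together. -/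
theorem eventually_extension_le {V : ℂ × ℂ → ℝ} (hV : IsVolumeFunction P V) (hy : y ≠ 0)
    (hy1 : ‖y‖ = 1) (D : ch.Local y) {j : Fin ch.d} (hj : D.X j 0 ≠ 0) (hj1 : ‖D.X j 0‖ = 1)
    {β : ℂ} (hβ : Tendsto (logSlope D j) (𝓝[≠] 0) (𝓝 β)) {c : ℝ} (hc : |c| = 1)
    (hcβ : 0 < c * β.im) :
    ∀ᶠ t in 𝓝[≠] (0 : ℂ), c * extension V (branch hy D j hj).point ≤
      c * V ((branch hy D j hj).toFun t) := by
  obtain ⟨v, hv, hX⟩ := exists_X_eq_exp hy D hj hβ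
  have hev : ∀ᶠ t in 𝓝[≠] (0 : ℂ), ‖logSlope D j t - β‖ < c * β.im / 2 ∧
      ‖v t - β‖ < c * β.im / 2 ∧ D.X j t = D.X j 0 * Complex.exp (t ^ D.k j * v t) ∧
      (branch hy D j hj).toFun t ∈ smoothLocus P ∧ DifferentiableAt ℂ (D.X j) t ∧ D.X j t ≠ 0 := by
    filter_upwards [Metric.tendsto_nhds.1 hβ _ (half_pos hcβ),
      Metric.tendsto_nhds.1 hv _ (half_pos hcβ), hX, branch_mem_smoothLocus hy D hj,
      nhdsWithin_le_nhds (D.analyticAt_X (ch.entireFamily hy) j).eventually_analyticAt,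
      nhdsWithin_le_nhds (eventually_X_ne_zero hy D hj)] with t h1 h2 h3 h4 h5 h6
    rw [dist_eq_norm] at h1 h2
    exact ⟨h1, h2, h3, h4, h5.differentiableAt, h6⟩
  rw [eventually_nhdsWithin_iff, Metric.eventually_nhds_iff] at hev
  obtain ⟨r, hr, hev⟩ := hev
  simp only [dist_zero_right, Set.mem_compl_iff, Set.mem_singleton_iff] at hev
  filter_upwards [nhdsWithin_le_nhds (Metric.ball_mem_nhds (0 : ℂ) hr), self_mem_nhdsWithin]
    with t ht ht0
  rw [mem_ball_zero_iff] at ht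
  have ht0' : t ≠ 0 := ht0
  have hu : ∀ u : ℝ, 0 < u → ‖(u : ℂ) * t‖ < r → _ := fun u h0 h1 =>
    hev h1 (mul_ne_zero (by exact_mod_cast h0.ne') ht0')
  have hlt : ∀ u : ℝ, 0 < u → u ≤ 1 → ‖(u : ℂ) * t‖ < r := by
    intro u h0 h1
    rw [norm_mul, Complex.norm_real, Real.norm_of_nonneg h0.le]
    exact (mul_le_of_le_one_left (norm_nonneg t) h1).trans_lt ht
  have hnhds : ∀ u : ℝ, 0 < u → u ≤ 1 →
      ∀ᶠ u' : ℝ in 𝓝 u, 0 < u' ∧ ‖(u' : ℂ) * t‖ < r := by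
    intro u h0 h1
    refine (eventually_gt_nhds h0).and ?_
    have : ContinuousAt (fun u : ℝ => ‖(u : ℂ) * t‖) u := by fun_prop
    exact this.eventually_lt_const (hlt u h0 h1)
  set F : ℝ → ℝ := fun u => c * V ((branch hy D j hj).toFun (u * t)) with hF
  have hderiv : ∀ u : ℝ, 0 < u → u ≤ 1 → ∃ F', HasDerivAt F F' u ∧ 0 ≤ F' := by
    intro u h0 h1
    obtain ⟨hB, hv, hX, hs, hXd, hXne⟩ := hu u h0 (hlt u h0 h1)
    have hu0 : (u : ℂ) ≠ 0 := by exact_mod_cast h0.ne'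
    set w : ℂ := ((u : ℂ) * t) ^ D.k j with hw
    have hX' := hasDerivAt_comp_line hXd.hasDerivAt
    have hY' := hasDerivAt_comp_line (u := u) (t := t)
      ((hasDerivAt_pow (D.k j) (u * t)).cexp.const_mul y)
    have hY0 : y * Complex.exp w ≠ 0 := mul_ne_zero hy (Complex.exp_ne_zero _)
    have hd := (ch.hasDerivAt_volume hV hX' hY' hXne hY0
      ((hnhds u h0 h1).mono fun u' hu' => (hu u' hu'.1 hu'.2).2.2.2.1)).const_mul c
    refine ⟨_, hd, ?_⟩
    have e1 : Real.log ‖y * Complex.exp w‖ = w.re := by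
      rw [norm_mul, hy1, one_mul, Complex.norm_exp, Real.log_exp]
    have e2 : Real.log ‖D.X j (u * t)‖ = (w * v (u * t)).re := by
      rw [hX, norm_mul, hj1, one_mul, Complex.norm_exp, Real.log_exp]
    have hk1 : ((u : ℂ) * t) ^ (D.k j - 1) * t = w / u := by
      rw [eq_div_iff hu0, mul_assoc, mul_comm t, ← pow_succ, Nat.sub_add_cancel (D.k_pos j)]
    have hk2 : (D.k j : ℂ) * (u * t) ^ (D.k j - 1) ≠ 0 :=
      mul_ne_zero (Nat.cast_ne_zero.2 (D.k_pos j).ne')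
        (pow_ne_zero _ (mul_ne_zero hu0 ht0'))
    have e3 : deriv (D.X j) (u * t) * t / D.X j (u * t) =
        ((D.k j / u : ℝ) : ℂ) * (logSlope D j (u * t) * w) := by
      have : deriv (D.X j) (u * t) / D.X j (u * t) =
          logSlope D j (u * t) * (D.k j * (u * t) ^ (D.k j - 1)) := by
        rw [logSlope, div_mul_cancel₀ _ hk2]
      rw [mul_div_right_comm, this, mul_assoc, mul_assoc, hk1]
      push_cast
      ring
    have e4 : y * (Complex.exp w * (D.k j * (u * t) ^ (D.k j - 1))) * t / (y * Complex.exp w) =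
        ((D.k j / u : ℝ) : ℂ) * w := by
      have : y * (Complex.exp w * (D.k j * (u * t) ^ (D.k j - 1))) * t =
          y * Complex.exp w * (D.k j * ((u * t) ^ (D.k j - 1) * t)) := by ring
      rw [this, mul_div_cancel_left₀ _ hY0, hk1]
      push_cast
      ring
    rw [e1, e2, e3, e4, Complex.im_ofReal_mul,
      Complex.im_ofReal_mul]
    have hku : 0 ≤ (D.k j / u : ℝ) := by positivity
    set B := logSlope D j (u * t)
    set v₁ := v (u * t)
    have key : 0 ≤ c * (w.re * (B * w).im - (w * v₁).re * w.im) := by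
      -- For `B = v₁ = β` the expression is exactly `|w|² Im β`. The two errors cost at most `(c Im
      -- β / 2)|w|²` each, which the main term just absorbs.
      have i1 : w.re * (B * w).im - (w * v₁).re * w.im =
          ‖w‖ ^ 2 * β.im + (w.re * ((B - β) * w).im - (w * (v₁ - β)).re * w.im) := by
        rw [← Complex.normSq_eq_norm_sq, Complex.normSq_apply]
        simp only [Complex.mul_im, Complex.mul_re, Complex.sub_im, Complex.sub_re]
        ring
      have i2 : |w.re * ((B - β) * w).im| ≤ ‖w‖ * (c * β.im / 2 * ‖w‖) := by
        rw [abs_mul]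
        refine mul_le_mul (Complex.abs_re_le_norm w) ?_ (abs_nonneg _) (norm_nonneg _)
        refine (Complex.abs_im_le_norm _).trans ?_
        rw [norm_mul]
        gcongr
      have i3 : |(w * (v₁ - β)).re * w.im| ≤ (c * β.im / 2 * ‖w‖) * ‖w‖ := by
        rw [abs_mul]
        refine mul_le_mul ?_ (Complex.abs_im_le_norm w) (abs_nonneg _) (by positivity)
        refine (Complex.abs_re_le_norm _).trans ?_
        rw [norm_mul, mul_comm]
        gcongr
      have i4 : |c * (w.re * ((B - β) * w).im - (w * (v₁ - β)).re * w.im)| ≤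
          c * β.im * ‖w‖ ^ 2 := by
        rw [abs_mul, hc, one_mul]
        refine (abs_sub _ _).trans ?_
        linarith
      rw [i1, mul_add]
      have := neg_abs_le (c * (w.re * ((B - β) * w).im - (w * (v₁ - β)).re * w.im))
      linarith
    have : c * (w.re * ((D.k j / u : ℝ) * (B * w).im) -
        (w * v₁).re * ((D.k j / u : ℝ) * w.im)) =
        (D.k j / u : ℝ) * (c * (w.re * (B * w).im - (w * v₁).re * w.im)) := by ring
    rw [this]
    exact mul_nonneg hku key
  have hmono : MonotoneOn F (Set.Ioc 0 1) := by
    refine monotoneOn_of_deriv_nonneg (convex_Ioc 0 1) ?_ ?_ ?_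
    · intro u hu
      obtain ⟨F', h, -⟩ := hderiv u hu.1 hu.2
      exact h.continuousAt.continuousWithinAt
    · rw [interior_Ioc]
      intro u hu
      obtain ⟨F', h, -⟩ := hderiv u hu.1 hu.2.le
      exact h.differentiableAt.differentiableWithinAt
    · rw [interior_Ioc]
      intro u hu
      obtain ⟨F', h, h'⟩ := hderiv u hu.1 hu.2.le
      rwa [h.deriv]
  have hline : Tendsto (fun u : ℝ => (u : ℂ) * t) (𝓝[>] 0) (𝓝[≠] 0) := by
    refine tendsto_nhdsWithin_iff.2 ⟨?_, ?_⟩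
    · have : ContinuousAt (fun u : ℝ => (u : ℂ) * t) 0 := by fun_prop
      have h := this.tendsto.mono_left (nhdsWithin_le_nhds (s := Set.Ioi 0))
      simpa using h
    · filter_upwards [self_mem_nhdsWithin] with u hu
      exact mul_ne_zero (by exact_mod_cast (ne_of_gt hu)) ht0'
  have hlim : Tendsto F (𝓝[>] 0) (𝓝 (c * extension V (branch hy D j hj).point)) :=
    ((tendsto_extension hV hy D hj).comp hline).const_mul c
  have h1 : F 1 = c * V ((branch hy D j hj).toFun t) := by simp [hF]
  rw [← h1]
  refine le_of_tendsto hlim ?_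
  filter_upwards [Ioc_mem_nhdsGT (zero_lt_one (α := ℝ))] with u hu
  exact hmono hu ⟨one_pos, le_rfl⟩ hu.2

end Chart

theorem eventually_of_point_eq {P : Laurent} {φ ψ : BranchParam P} (h : ψ.point = φ.point)
    {p : ℂ × ℂ → Prop} (hp : ∀ᶠ t in 𝓝[≠] (0 : ℂ), p (φ.toFun t)) :
    ∀ᶠ t in 𝓝[≠] (0 : ℂ), p (ψ.toFun t) := by
  have H := BranchParam.Equivalent.map_eq (show ψ.Equivalent φ from Quotient.exact h) id
  exact (H ▸ (show ∀ᶠ z in map (fun t => id (φ.toFun t)) (𝓝[≠] (0 : ℂ)), p z from hp) :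
    ∀ᶠ z in map (fun t => id (ψ.toFun t)) (𝓝[≠] (0 : ℂ)), p z)

theorem Chart.epsilon_and_isLocalExtr {P : Laurent} (ch : Chart P) (hreg : IsLogRegular P)
    {V : ℂ × ℂ → ℝ} (hV : IsVolumeFunction P V) (z : Normalization P) (hz : z ∈ toricPoints P) :
    (epsilon z = 1 ∧ IsLocalMaxAt V (extension V) z) ∨
      (epsilon z = -1 ∧ IsLocalMinAt V (extension V) z) := by
  obtain ⟨ψ, rfl⟩ := Quotient.exists_rep z
  have hy := ch.N_snd_ne_zero ψ.fst_ne_zero ψ.snd_ne_zero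
  obtain ⟨D⟩ := ch.nonempty_local hy
  obtain ⟨j, hj, H⟩ := Chart.exists_branch_equivalent hy D ψ rfl
  have hpt : (branch hy D j hj).point = Quotient.mk _ ψ := Quotient.sound H
  rw [← hpt] at hz ⊢
  obtain ⟨hj1, hy1⟩ := (branch_mem_toricPoints_iff hy D hj).1 hz
  obtain ⟨β, hβi, hβ, hε⟩ := exists_tendsto_logSlope hreg hy hy1 D hj hj1
  rcases lt_or_gt_of_ne hβi with h | h
  · left
    rw [hε, Real.sign_of_neg h]
    refine ⟨by norm_num, fun φ hφ => eventually_of_point_eq hφ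
      (p := fun p => V p ≤ extension V (branch hy D j hj).point) ?_⟩
    filter_upwards [eventually_extension_le hV hy hy1 D hj hj1 hβ (c := -1) (by simp)
      (by linarith)] with t ht
    linarith
  · right
    rw [hε, Real.sign_of_pos h]
    refine ⟨rfl, fun φ hφ => eventually_of_point_eq hφ
      (p := fun p => extension V (branch hy D j hj).point ≤ V p) ?_⟩
    filter_upwards [eventually_extension_le hV hy hy1 D hj hj1 hβ (c := 1) (by simp)
      (by linarith)] with t ht
    linarith

end MahlerVolume

/-! ### Roots over the circle `|Y| = 1` and their contributions. -/

namespace MahlerVolume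

open Polynomial Function.Periodic Real

/-- The logarithm of the parameter `w = iδ`. -/
def tauOf (δ : ℝ) : ℂ := invQParam 1 (Complex.I * δ)

theorem qParam_tauOf {δ : ℝ} (hδ : δ ≠ 0) : qParam 1 (tauOf δ) = Complex.I * δ :=
  qParam_right_inv one_ne_zero (mul_ne_zero Complex.I_ne_zero (by exact_mod_cast hδ))

theorem tendsto_I_mul : Tendsto (fun δ : ℝ => Complex.I * δ) (𝓝[≠] 0) (𝓝[≠] 0) := by
  refine tendsto_nhdsWithin_iff.2 ⟨?_, ?_⟩
  · have : ContinuousAt (fun δ : ℝ => Complex.I * δ) 0 := by fun_prop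
    have h := this.tendsto.mono_left (nhdsWithin_le_nhds (s := {0}ᶜ))
    simpa using h
  · filter_upwards [self_mem_nhdsWithin] with δ hδ
    exact mul_ne_zero Complex.I_ne_zero (by exact_mod_cast hδ)

theorem tendsto_tauOf : Tendsto tauOf (𝓝[≠] 0) (comap Complex.im atTop) :=
  (invQParam_tendsto one_pos).comp tendsto_I_mul

/-- For real `δ ≠ 0` the point `iδ` avoids the cut of the principal logarithm, so one choice of `τ`
serves on both sides of `δ = 0`. -/
theorem differentiableAt_tauOf {δ : ℝ} (hδ : δ ≠ 0) : DifferentiableAt ℝ tauOf δ := by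
  have h1 : DifferentiableAt ℝ (fun δ : ℝ => Complex.I * δ) δ := by fun_prop
  have h2 : Complex.I * δ ∈ Complex.slitPlane := by
    rw [Complex.mem_slitPlane_iff]
    right
    simpa using hδ
  have h3 : DifferentiableAt ℝ (fun δ : ℝ => Complex.log (Complex.I * δ)) δ :=
    DifferentiableAt.comp (g := Complex.log) δ
      ((Complex.differentiableAt_log h2).restrictScalars ℝ) h1
  exact h3.const_mul _

namespace Chart

variable {P : Laurent} {ch : Chart P} {y : ℂ}

/-- The `j`-th root of the slice over `y * exp (iδ)`. -/
def rootAt (D : ch.Local y) (j : Fin ch.d) (δ : ℝ) : ℂ := D.x j (tauOf δ)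

/-- The parameter on the `j`-th Puiseux branch of the root over `y * exp (iδ)`. -/
def paramAt (D : ch.Local y) (j : Fin ch.d) (δ : ℝ) : ℂ := qParam (D.k j) (tauOf δ)

theorem X_paramAt (D : ch.Local y) (j : Fin ch.d) (δ : ℝ) :
    D.X j (paramAt D j δ) = rootAt D j δ := D.X_qParam j _

theorem paramAt_pow (D : ch.Local y) (j : Fin ch.d) {δ : ℝ} (hδ : δ ≠ 0) :
    paramAt D j δ ^ D.k j = Complex.I * δ := by
  rw [paramAt, D.qParam_pow, qParam_tauOf hδ]

theorem tendsto_paramAt (D : ch.Local y) (j : Fin ch.d) :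
    Tendsto (paramAt D j) (𝓝[≠] 0) (𝓝[≠] 0) :=
  (qParam_tendsto (D.k_pos' j)).comp tendsto_tauOf

theorem tendsto_rootAt (hy : y ≠ 0) (D : ch.Local y) (j : Fin ch.d) :
    Tendsto (rootAt D j) (𝓝[≠] 0) (𝓝 (D.X j 0)) := by
  have h := ((D.analyticAt_X (ch.entireFamily hy) j).continuousAt.tendsto.mono_left
    nhdsWithin_le_nhds).comp (tendsto_paramAt D j)
  exact h.congr fun δ => X_paramAt D j δ

/-- The values of `δ` covered by the Puiseux parametrizations. -/
def Good (D : ch.Local y) (δ : ℝ) : Prop := δ ≠ 0 ∧ D.A < (tauOf δ).im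

theorem eventually_good (D : ch.Local y) : ∀ᶠ δ in 𝓝[≠] (0 : ℝ), Good D δ := by
  filter_upwards [self_mem_nhdsWithin,
    tendsto_tauOf.eventually (PuiseuxData.eventually_lt_im D.A)] with δ h1 h2
  exact ⟨h1, h2⟩

theorem eventually_nhds_good (D : ch.Local y) {δ : ℝ} (h : Good D δ) :
    ∀ᶠ δ' in 𝓝 δ, Good D δ' := by
  refine (eventually_ne_nhds h.1).and ?_
  have := (differentiableAt_tauOf h.1).continuousAt
  exact (Complex.continuous_im.continuousAt.comp this).eventually_const_lt h.2

theorem differentiableAt_rootAt (D : ch.Local y) (j : Fin ch.d) {δ : ℝ} (h : Good D δ) :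
    DifferentiableAt ℝ (rootAt D j) δ :=
  ((D.differentiableAt j _ h.2).restrictScalars ℝ).comp δ (differentiableAt_tauOf h.1)

theorem eval_slice_eq_zero_iff_rootAt (D : ch.Local y) {δ : ℝ} (h : Good D δ) (x : ℂ) :
    (ch.slice (y * Complex.exp (Complex.I * δ))).eval x = 0 ↔ ∃ j, rootAt D j δ = x := by
  have := D.eval_eq_zero_iff _ h.2 x
  rwa [qParam_tauOf h.1] at this

theorem rootAt_injective (D : ch.Local y) {δ : ℝ} (h : Good D δ) :
    Function.Injective fun j => rootAt D j δ := D.injective _ h.2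

theorem mem_smoothLocus_rootAt (hy : y ≠ 0) (D : ch.Local y) (j : Fin ch.d) {δ : ℝ}
    (h : Good D δ) (hx : rootAt D j δ ≠ 0) :
    ch.M (rootAt D j δ, y * Complex.exp (Complex.I * δ)) ∈ smoothLocus P := by
  have h1 := (eval_slice_eq_zero_iff_rootAt D h _).2 ⟨j, rfl⟩
  have h2 := D.simple _ h.2
  rw [qParam_tauOf h.1] at h2
  exact ch.mem_smoothLocus hx (mul_ne_zero hy (Complex.exp_ne_zero _)) h1 (h2 _ h1)

/-- The contribution of the `j`-th root to the sum of the values of `V` at the roots `x` with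
`|x| > 1`. -/
def contribution (V : ℂ × ℂ → ℝ) (D : ch.Local y) (j : Fin ch.d) (δ : ℝ) : ℝ :=
  if 1 < ‖rootAt D j δ‖ then V (ch.M (rootAt D j δ, y * Complex.exp (Complex.I * δ))) else 0

/-- On `|Y| = 1` one has `log|Y| = 0` and `d arg Y = dδ`, so `η` becomes `-log|X| dδ`. A root inside
the unit disc contributes zero, just as its `log⁺` does. -/
theorem hasDerivAt_contribution {V : ℂ × ℂ → ℝ} (hV : IsVolumeFunction P V) (hy1 : ‖y‖ = 1)
    (D : ch.Local y) (j : Fin ch.d) {δ : ℝ} (h : Good D δ) (hx : ‖rootAt D j δ‖ ≠ 1) :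
    HasDerivAt (contribution V D j) (-log⁺ ‖rootAt D j δ‖) δ := by
  have hy : y ≠ 0 := by rintro rfl; simp at hy1
  have hd := differentiableAt_rootAt D j h
  have hc : ContinuousAt (fun δ => ‖rootAt D j δ‖) δ := hd.continuousAt.norm
  rcases lt_or_gt_of_ne hx with h1 | h1
  · have h2 : log⁺ ‖rootAt D j δ‖ = 0 := by
      rw [posLog_eq_zero_iff, abs_norm]; exact h1.le
    rw [h2, neg_zero]
    refine (hasDerivAt_const δ (0 : ℝ)).congr_of_eventuallyEq ?_
    filter_upwards [hc.eventually_lt_const h1] with δ' h3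
    exact if_neg h3.not_gt
  · have h2 : log⁺ ‖rootAt D j δ‖ = log ‖rootAt D j δ‖ :=
      posLog_eq_log (by rw [abs_norm]; exact h1.le)
    rw [h2]
    have hx0 : rootAt D j δ ≠ 0 := by
      intro h0
      rw [h0, norm_zero] at h1
      linarith
    have hY0 : y * Complex.exp (Complex.I * δ) ≠ 0 := mul_ne_zero hy (Complex.exp_ne_zero _)
    have hY : HasDerivAt (fun δ : ℝ => y * Complex.exp (Complex.I * δ))
        (y * (Complex.exp (Complex.I * δ) * Complex.I)) δ := by
      have h3 : HasDerivAt (fun δ : ℝ => Complex.I * (δ : ℂ)) Complex.I δ := by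
        simpa using (Complex.ofRealCLM.hasDerivAt (x := δ)).const_mul Complex.I
      exact h3.cexp.const_mul y
    have hnear : ∀ᶠ δ' in 𝓝 δ, Good D δ' ∧ 1 < ‖rootAt D j δ'‖ :=
      (eventually_nhds_good D h).and (hc.eventually_const_lt h1)
    have h4 := ch.hasDerivAt_volume hV hd.hasDerivAt hY hx0 hY0 (by
      filter_upwards [hnear] with δ' h5
      refine mem_smoothLocus_rootAt hy D j h5.1 ?_
      intro h0
      have := h5.2
      rw [h0, norm_zero] at this
      linarith)
    have h6 : ‖y * Complex.exp (Complex.I * δ)‖ = 1 := by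
      rw [norm_mul, hy1, one_mul, mul_comm, Complex.norm_exp_ofReal_mul_I]
    have h7 : y * (Complex.exp (Complex.I * δ) * Complex.I) / (y * Complex.exp (Complex.I * δ)) =
        Complex.I := by
      rw [← mul_assoc, mul_div_cancel_left₀ _ hY0]
    rw [h6, h7, Real.log_one, zero_mul, zero_sub, Complex.I_im, mul_one] at h4
    refine h4.congr_of_eventuallyEq ?_
    filter_upwards [hnear] with δ' h5
    exact if_pos h5.2

theorem tendsto_volume_rootAt {V : ℂ × ℂ → ℝ} (hV : IsVolumeFunction P V) (hy : y ≠ 0)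
    (D : ch.Local y) {j : Fin ch.d} (hj : D.X j 0 ≠ 0) :
    Tendsto (fun δ => V (ch.M (rootAt D j δ, y * Complex.exp (Complex.I * δ)))) (𝓝[≠] 0)
      (𝓝 (extension V (branch hy D j hj).point)) := by
  refine ((tendsto_extension hV hy D hj).comp (tendsto_paramAt D j)).congr' ?_
  filter_upwards [self_mem_nhdsWithin] with δ hδ
  rw [Function.comp, chartPoint, X_paramAt, paramAt_pow D j hδ]

/-- The one-sided limits of the contribution of a root. -/
theorem exists_tendsto_contribution (hreg : IsLogRegular P) {V : ℂ × ℂ → ℝ}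
    (hV : IsVolumeFunction P V) (hy : y ≠ 0) (hy1 : ‖y‖ = 1) (D : ch.Local y) (j : Fin ch.d) :
    ∃ a b : ℝ, Tendsto (contribution V D j) (𝓝[>] 0) (𝓝 a) ∧
      Tendsto (contribution V D j) (𝓝[<] 0) (𝓝 b) ∧ (∀ᶠ δ in 𝓝[≠] 0, ‖rootAt D j δ‖ ≠ 1) ∧
      (‖D.X j 0‖ ≠ 1 → a = b) ∧
      ∀ (hj : D.X j 0 ≠ 0), ‖D.X j 0‖ = 1 →
        a - b = epsilon (branch hy D j hj).point * extension V (branch hy D j hj).point := by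
  have hGT : 𝓝[>] (0 : ℝ) ≤ 𝓝[≠] 0 := nhdsWithin_mono _ fun x hx => ne_of_gt hx
  have hLT : 𝓝[<] (0 : ℝ) ≤ 𝓝[≠] 0 := nhdsWithin_mono _ fun x hx => ne_of_lt hx
  have hn : Tendsto (fun δ => ‖rootAt D j δ‖) (𝓝[≠] 0) (𝓝 ‖D.X j 0‖) := (tendsto_rootAt hy D j).norm
  have hin : ∀ l : Filter ℝ, l ≤ 𝓝[≠] 0 → (∀ᶠ δ in l, ‖rootAt D j δ‖ < 1) →
      Tendsto (contribution V D j) l (𝓝 0) := by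
    intro l hl h
    refine tendsto_const_nhds.congr' ?_
    filter_upwards [h] with δ hδ
    exact (if_neg hδ.not_gt).symm
  have hout : ∀ l : Filter ℝ, l ≤ 𝓝[≠] 0 → (∀ᶠ δ in l, 1 < ‖rootAt D j δ‖) →
      ∀ hj : D.X j 0 ≠ 0,
      Tendsto (contribution V D j) l (𝓝 (extension V (branch hy D j hj).point)) := by
    intro l hl h hj
    refine ((tendsto_volume_rootAt hV hy D hj).mono_left hl).congr' ?_
    filter_upwards [h] with δ hδ
    exact (if_pos hδ).symm
  rcases lt_trichotomy ‖D.X j 0‖ 1 with h | h | h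
  · have h1 := hn.eventually_lt_const h
    exact ⟨0, 0, hin _ hGT (hGT h1), hin _ hLT (hLT h1), h1.mono fun δ hδ => hδ.ne,
      fun _ => rfl, fun _ h' => absurd h' h.ne⟩
  · have hj : D.X j 0 ≠ 0 := by
      intro h0
      rw [h0, norm_zero] at h
      exact zero_ne_one h
    obtain ⟨β, hβi, hβ, hε⟩ := exists_tendsto_logSlope hreg hy hy1 D hj h
    obtain ⟨v, hv, hX⟩ := exists_X_eq_exp hy D hj hβ
    -- With `t^k = iδ`, the factor `exp(t^k v)` has modulus `exp(-δ Im v)`. Hence the sign of `Im β`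
    -- decides on which side of `δ = 0` the root lies outside the unit circle.
    have hlog : ∀ᶠ δ in 𝓝[≠] (0 : ℝ),
        ‖rootAt D j δ‖ = rexp (-(δ * (v (paramAt D j δ)).im)) := by
      filter_upwards [(tendsto_paramAt D j).eventually hX, self_mem_nhdsWithin] with δ h1 h2
      rw [← X_paramAt, h1, norm_mul, h, one_mul, paramAt_pow D j h2, Complex.norm_exp]
      simp
    have hvim : Tendsto (fun δ => (v (paramAt D j δ)).im) (𝓝[≠] 0) (𝓝 β.im) :=
      (Complex.continuous_im.tendsto _).comp (hv.comp (tendsto_paramAt D j))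
    rcases lt_or_gt_of_ne hβi with hβ0 | hβ0
    · have h1 := hvim.eventually_lt_const hβ0
      have h2 : ∀ᶠ δ in 𝓝[>] (0 : ℝ), 1 < ‖rootAt D j δ‖ := by
        filter_upwards [hGT hlog, hGT h1, self_mem_nhdsWithin] with δ h3 h4 h5
        rw [h3, Real.one_lt_exp_iff]
        have := mul_neg_of_pos_of_neg (show 0 < δ from h5) h4
        linarith
      have h2' : ∀ᶠ δ in 𝓝[<] (0 : ℝ), ‖rootAt D j δ‖ < 1 := by
        filter_upwards [hLT hlog, hLT h1, self_mem_nhdsWithin] with δ h3 h4 h5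
        rw [h3, Real.exp_lt_one_iff]
        have := mul_pos_of_neg_of_neg (show δ < 0 from h5) h4
        linarith
      refine ⟨_, 0, hout _ hGT h2 hj, hin _ hLT h2', ?_, fun h' => absurd h h', fun _ _ => ?_⟩
      · rw [← nhdsLT_sup_nhdsGT, eventually_sup]
        exact ⟨h2'.mono fun δ h => h.ne, h2.mono fun δ h => h.ne'⟩
      · rw [hε, Real.sign_of_neg hβ0]
        ring
    · have h1 := hvim.eventually_const_lt hβ0
      have h2 : ∀ᶠ δ in 𝓝[>] (0 : ℝ), ‖rootAt D j δ‖ < 1 := by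
        filter_upwards [hGT hlog, hGT h1, self_mem_nhdsWithin] with δ h3 h4 h5
        rw [h3, Real.exp_lt_one_iff]
        have := mul_pos (show 0 < δ from h5) h4
        linarith
      have h2' : ∀ᶠ δ in 𝓝[<] (0 : ℝ), 1 < ‖rootAt D j δ‖ := by
        filter_upwards [hLT hlog, hLT h1, self_mem_nhdsWithin] with δ h3 h4 h5
        rw [h3, Real.one_lt_exp_iff]
        have := mul_neg_of_neg_of_pos (show δ < 0 from h5) h4
        linarith
      refine ⟨0, _, hin _ hGT h2, hout _ hLT h2' hj, ?_, fun h' => absurd h h', fun _ _ => ?_⟩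
      · rw [← nhdsLT_sup_nhdsGT, eventually_sup]
        exact ⟨h2'.mono fun δ h => h.ne', h2.mono fun δ h => h.ne⟩
      · rw [hε, Real.sign_of_pos hβ0]
        ring
  · have hj : D.X j 0 ≠ 0 := by
      intro h0
      rw [h0, norm_zero] at h
      linarith
    have h1 := hn.eventually_const_lt h
    exact ⟨_, _, hout _ hGT (hGT h1) hj, hout _ hLT (hLT h1) hj, h1.mono fun δ hδ => hδ.ne',
      fun _ => rfl, fun _ h' => absurd h' h.ne'⟩

end Chart

end MahlerVolume

/-! ### The sum over the roots and its jumps. -/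

namespace MahlerVolume

open Polynomial Real

theorem coords_fst_ne_zero {P : Laurent} (z : Normalization P) : (coords z).1 ≠ 0 := by
  induction z using Quotient.inductionOn with
  | _ ψ => exact ψ.fst_ne_zero

theorem coords_snd_ne_zero {P : Laurent} (z : Normalization P) : (coords z).2 ≠ 0 := by
  induction z using Quotient.inductionOn with
  | _ ψ => exact ψ.snd_ne_zero

theorem eval_coords {P : Laurent} (z : Normalization P) : eval P (coords z) = 0 := by
  induction z using Quotient.inductionOn with
  | _ ψ => exact ψ.eval_eq_zero.self_of_nhds

namespace Chart

variable {P : Laurent} {ch : Chart P} {y : ℂ}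

theorem norm_N_coords {z : Normalization P} (hz : z ∈ toricPoints P) :
    ‖(ch.N (coords z)).1‖ = 1 ∧ ‖(ch.N (coords z)).2‖ = 1 := by
  have h1 := coords_fst_ne_zero z
  have h2 := coords_snd_ne_zero z
  rw [← ch.log_norm_M_eq_zero_iff (ch.N_fst_ne_zero h1 h2) (ch.N_snd_ne_zero h1 h2), Prod.mk.eta,
    ch.M_N h1 h2]
  exact hz

theorem eval_slice_N_coords (z : Normalization P) :
    (ch.slice (ch.N (coords z)).2).eval (ch.N (coords z)).1 = 0 := by
  have h1 := coords_fst_ne_zero z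
  have h2 := coords_snd_ne_zero z
  rw [ch.eval_slice_eq_zero_iff (ch.N_fst_ne_zero h1 h2) (ch.N_snd_ne_zero h1 h2), Prod.mk.eta,
    ch.M_N h1 h2, eval_coords]

variable (ch) in
/-- The sum of the values of `V` at the points over `Y = y` with `|X| > 1`. -/
def rootSum (V : ℂ × ℂ → ℝ) (y : ℂ) : ℝ :=
  ∑ x ∈ (ch.slice y).roots.toFinset with 1 < ‖x‖, V (ch.M (x, y))

variable (ch) in
/-- The sum of `log⁺ |X|` over the points over `Y = y`. -/
def posLogSum (y : ℂ) : ℝ := ((ch.slice y).roots.map fun x => log⁺ ‖x‖).sum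

theorem roots_slice (hy : y ≠ 0) (D : ch.Local y) {δ : ℝ} (h : Good D δ) :
    (ch.slice (y * Complex.exp (Complex.I * δ))).roots =
      Finset.univ.val.map fun j => rootAt D j δ := by
  have hs := D.simple _ h.2
  rw [qParam_tauOf h.1] at hs
  refine (Multiset.Nodup.ext ((ch.entireFamily hy).card_roots_of_simple hs).1
    (Finset.univ.nodup.map (rootAt_injective D h))).2 fun x => ?_
  rw [mem_roots (ch.slice_ne_zero (mul_ne_zero hy (Complex.exp_ne_zero _))), IsRoot,
    eval_slice_eq_zero_iff_rootAt D h]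
  simp

theorem rootSum_eq (V : ℂ × ℂ → ℝ) (hy : y ≠ 0) (D : ch.Local y) {δ : ℝ} (h : Good D δ) :
    ch.rootSum V (y * Complex.exp (Complex.I * δ)) = ∑ j, contribution V D j δ := by
  have h1 : (ch.slice (y * Complex.exp (Complex.I * δ))).roots.toFinset =
      Finset.univ.image fun j => rootAt D j δ := by
    rw [roots_slice hy D h]; rfl
  rw [rootSum, h1, Finset.sum_filter, Finset.sum_image (rootAt_injective D h).injOn]
  rfl

theorem posLogSum_eq (hy : y ≠ 0) (D : ch.Local y) {δ : ℝ} (h : Good D δ) :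
    ch.posLogSum (y * Complex.exp (Complex.I * δ)) = ∑ j, log⁺ ‖rootAt D j δ‖ := by
  rw [posLogSum, roots_slice hy D h, Multiset.map_map]
  rfl

/-- The term of a point over the torus in the formula for the Mahler measure. -/
def pointTerm (V : ℂ × ℂ → ℝ) (z : Normalization P) : ℝ :=
  ramification z * epsilon z * extension V z

variable (ch) in
/-- The points over the torus with a given value of `Y`. -/
def toricFibre (y : ℂ) : Set (Normalization P) := {z ∈ toricPoints P | (ch.N (coords z)).2 = y}

variable (hy : y ≠ 0) (D : ch.Local y)

theorem X_zpow_zero (hy : y ≠ 0) (D : ch.Local y) (j : Fin ch.d) (n : ℤ) :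
    D.X ((D.σ ^ n) j) 0 = D.X j 0 := by
  obtain ⟨ζ, -, -, he⟩ := D.exists_rotation (ch.entireFamily hy) j n
  simpa using he.self_of_nhds

theorem X_ne_zero_of_norm {D : ch.Local y} (j : {j : Fin ch.d // ‖D.X j 0‖ = 1}) :
    D.X j.1 0 ≠ 0 := by
  intro h
  have := j.2
  rw [h, norm_zero] at this
  exact zero_ne_one this

/-- The point over the torus on a Puiseux branch. -/
def toricPoint (j : {j : Fin ch.d // ‖D.X j 0‖ = 1}) : Normalization P :=
  (branch hy D j.1 (X_ne_zero_of_norm j)).point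

theorem range_toricPoint (hy1 : ‖y‖ = 1) : Set.range (toricPoint hy D) = ch.toricFibre y := by
  ext z
  constructor
  · rintro ⟨j, rfl⟩
    refine ⟨(branch_mem_toricPoints_iff hy D _).2 ⟨j.2, hy1⟩, ?_⟩
    rw [toricPoint, coords_branch, ch.N_M (X_ne_zero_of_norm j) hy]
  · rintro ⟨hz, h⟩
    induction z using Quotient.inductionOn with
    | _ ψ =>
      obtain ⟨j, hj, he⟩ := exists_branch_equivalent hy D ψ h
      have hp : (branch hy D j hj).point = ψ.point := Quotient.sound he
      refine ⟨⟨j, ?_⟩, hp⟩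
      have : (branch hy D j hj).point ∈ toricPoints P := by rw [hp]; exact hz
      exact ((branch_mem_toricPoints_iff hy D hj).1 this).1

/-- Indices giving the same point form a monodromy cycle. The whole cycle is present because `X(0)`
is constant on it. -/
theorem card_fibre_toricPoint (j : {j : Fin ch.d // ‖D.X j 0‖ = 1})
    [DecidablePred fun i => toricPoint hy D i = toricPoint hy D j] :
    (Finset.univ.filter fun i => toricPoint hy D i = toricPoint hy D j).card = D.k j.1 := by
  classical
  rw [← D.card_cycle j.1]
  refine Finset.card_bij (fun i _ => i.1) ?_ (fun i _ i' _ h => Subtype.ext h) ?_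
  · intro i hi
    rw [Finset.mem_filter] at hi ⊢
    exact ⟨Finset.mem_univ _, (branch_point_eq_iff hy D _ _).1 hi.2.symm⟩
  · intro i hi
    rw [Finset.mem_filter] at hi
    obtain ⟨n, hn⟩ := hi.2
    refine ⟨⟨i, by rw [← hn, X_zpow_zero hy]; exact j.2⟩, ?_, rfl⟩
    rw [Finset.mem_filter]
    exact ⟨Finset.mem_univ _, ((branch_point_eq_iff hy D _ _).2 ⟨n, hn⟩).symm⟩

/-- Grouping the roots by their limit point turns a sum over indices into a sum over points weighted
by cycle lengths, which are the ramification orders. -/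
theorem sum_toricPoint (hreg : IsLogRegular P) (V : ℂ × ℂ → ℝ) (hy1 : ‖y‖ = 1) :
    ∑ j, epsilon (toricPoint hy D j) * extension V (toricPoint hy D j) =
      ∑ᶠ z ∈ ch.toricFibre y, pointTerm V z := by
  classical
  have h1 : ch.toricFibre y = ((Finset.univ.image (toricPoint hy D) : Finset _) : Set _) := by
    rw [Finset.coe_image, Finset.coe_univ, Set.image_univ, range_toricPoint hy D hy1]
  rw [h1, finsum_mem_coe_finset,
    Finset.sum_comp (fun z => epsilon z * extension V z) (toricPoint hy D)]
  refine Finset.sum_congr rfl fun z hz => ?_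
  obtain ⟨j, -, rfl⟩ := Finset.mem_image.1 hz
  obtain ⟨β, -, hβ, -⟩ := exists_tendsto_logSlope hreg hy hy1 D (X_ne_zero_of_norm j) j.2
  rw [card_fibre_toricPoint, pointTerm, nsmul_eq_mul, mul_assoc]
  congr 2
  exact (ramification_branch hy D _ hβ).symm

/-- The behaviour of the sum of `V` over the roots outside the unit circle around `Y = y`. -/
theorem exists_jump (hreg : IsLogRegular P) {V : ℂ × ℂ → ℝ} (hV : IsVolumeFunction P V)
    (hy1 : ‖y‖ = 1) : (ch.toricFibre y).Finite ∧
    (∀ᶠ δ : ℝ in 𝓝[≠] 0, ch.toricFibre (y * Complex.exp (Complex.I * δ)) = ∅ ∧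
      HasDerivAt (fun δ : ℝ => ch.rootSum V (y * Complex.exp (Complex.I * δ)))
        (-ch.posLogSum (y * Complex.exp (Complex.I * δ))) δ) ∧
    ∃ a b : ℝ,
      Tendsto (fun δ : ℝ => ch.rootSum V (y * Complex.exp (Complex.I * δ))) (𝓝[>] 0) (𝓝 a) ∧
      Tendsto (fun δ : ℝ => ch.rootSum V (y * Complex.exp (Complex.I * δ))) (𝓝[<] 0) (𝓝 b) ∧
      a - b = ∑ᶠ z ∈ ch.toricFibre y, pointTerm V z := by
  have hy : y ≠ 0 := by rintro rfl; simp at hy1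
  obtain ⟨D⟩ := ch.nonempty_local hy
  have hGT : 𝓝[>] (0 : ℝ) ≤ 𝓝[≠] 0 := nhdsWithin_mono _ fun x hx => ne_of_gt hx
  have hLT : 𝓝[<] (0 : ℝ) ≤ 𝓝[≠] 0 := nhdsWithin_mono _ fun x hx => ne_of_lt hx
  have heq : ∀ᶠ δ in 𝓝[≠] (0 : ℝ),
      ∑ j, contribution V D j δ = ch.rootSum V (y * Complex.exp (Complex.I * δ)) :=
    (eventually_good D).mono fun δ h => (rootSum_eq V hy D h).symm
  choose a b ha hb hne heq0 hjump using exists_tendsto_contribution hreg hV hy hy1 D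
  refine ⟨?_, ?_, ∑ j, a j, ∑ j, b j, ?_, ?_, ?_⟩
  · rw [← range_toricPoint hy D hy1]
    exact Set.finite_range _
  · filter_upwards [eventually_good D, eventually_all.2 hne] with δ h1 h2
    constructor
    · rw [Set.eq_empty_iff_forall_notMem]
      rintro z ⟨hz, hzy⟩
      have h3 := eval_slice_N_coords (ch := ch) z
      rw [hzy] at h3
      obtain ⟨j, hj⟩ := (eval_slice_eq_zero_iff_rootAt D h1 _).1 h3
      exact h2 j (by rw [hj]; exact (norm_N_coords hz).1)
    · have h3 := HasDerivAt.fun_sum (u := Finset.univ) fun j _ =>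
        hasDerivAt_contribution hV hy1 D j h1 (h2 j)
      rw [Finset.sum_neg_distrib, ← posLogSum_eq hy D h1] at h3
      refine h3.congr_of_eventuallyEq ?_
      filter_upwards [eventually_nhds_good D h1] with δ' h4
      exact rootSum_eq V hy D h4
  · exact (tendsto_finsetSum _ fun j _ => ha j).congr' (hGT heq)
  · exact (tendsto_finsetSum _ fun j _ => hb j).congr' (hLT heq)
  · rw [← sum_toricPoint hy D hreg V hy1, ← Finset.sum_sub_distrib]
    classical
    -- Roots whose limit is off the unit circle have equal one-sided limits and drop out of the
    -- jump.
    rw [← Finset.sum_filter_add_sum_filter_not Finset.univ fun j => ‖D.X j 0‖ = 1]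
    rw [Finset.sum_eq_zero (s := Finset.univ.filter fun j => ¬‖D.X j 0‖ = 1), add_zero]
    · rw [← Finset.sum_subtype_eq_sum_filter]
      simp only [Finset.subtype_univ]
      exact Finset.sum_congr rfl fun j _ => hjump j.1 (X_ne_zero_of_norm j) j.2
    · intro j hj
      rw [heq0 j (Finset.mem_filter.1 hj).2, sub_self]

end Chart

end MahlerVolume

/-! ### Integrating a derivative across finitely many jumps. -/

namespace MahlerVolume

open Set

theorem finite_of_eventually_nhdsNE {K E : Set ℝ} (hK : IsCompact K) (hE : E ⊆ K)
    (h : ∀ x ∈ K, ∀ᶠ y in 𝓝[≠] x, y ∉ E) : E.Finite := by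
  by_contra hinf
  obtain ⟨x, hx, hacc⟩ := Set.Infinite.exists_accPt_of_subset_isCompact hinf hK hE
  exact accPt_iff_frequently_nhdsNE.1 hacc (h x hx)

/-- The fundamental theorem of calculus for functions with finitely many jumps. -/
theorem integral_eq_sub_sub_sum_jumps {G g J : ℝ → ℝ}
    (hJ : ∀ s, ∃ u v, Tendsto G (𝓝[>] s) (𝓝 u) ∧ Tendsto G (𝓝[<] s) (𝓝 v) ∧ u - v = J s)
    (a : ℝ) (S : Finset ℝ) : ∀ {b la lb : ℝ}, a < b → (S : Set ℝ) ⊆ Ioo a b →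
    (∀ x ∈ Ioo a b, x ∉ S → HasDerivAt G (g x) x) →
    IntervalIntegrable g MeasureTheory.volume a b →
    Tendsto G (𝓝[>] a) (𝓝 la) → Tendsto G (𝓝[<] b) (𝓝 lb) →
    ∫ x in a..b, g x = lb - la - ∑ s ∈ S, J s := by
  -- The interval is split at the largest jump point: induction applies on its left, and no jump
  -- remains on its right.
  induction S using Finset.induction_on_max with
  | empty =>
    intro b la lb hab _ hd hg ha hb
    rw [Finset.sum_empty, sub_zero]
    exact intervalIntegral.integral_eq_sub_of_hasDerivAt_of_tendsto hab
      (fun x hx => hd x hx (Finset.notMem_empty _)) hg ha hb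
  | insert m S hm ih =>
    intro b la lb hab hS hd hg ha hb
    have hm' : m ∈ Ioo a b := hS (Finset.mem_coe.2 (Finset.mem_insert_self _ _))
    obtain ⟨u, v, hu, hv, huv⟩ := hJ m
    have hg1 : IntervalIntegrable g MeasureTheory.volume a m := hg.mono_set (by
      rw [uIcc_of_le hm'.1.le, uIcc_of_le hab.le]; exact Icc_subset_Icc_right hm'.2.le)
    have hg2 : IntervalIntegrable g MeasureTheory.volume m b := hg.mono_set (by
      rw [uIcc_of_le hm'.2.le, uIcc_of_le hab.le]; exact Icc_subset_Icc_left hm'.1.le)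
    have h1 := ih hm'.1
      (fun s hs => ⟨(hS (Finset.mem_coe.2 (Finset.mem_insert_of_mem hs))).1, hm s hs⟩)
      (fun x hx hxS => hd x ⟨hx.1, hx.2.trans hm'.2⟩ (by
        rw [Finset.mem_insert, not_or]; exact ⟨hx.2.ne, hxS⟩)) hg1 ha hv
    have h2 := intervalIntegral.integral_eq_sub_of_hasDerivAt_of_tendsto hm'.2
      (fun x hx => hd x ⟨hm'.1.trans hx.1, hx.2⟩ (by
        rw [Finset.mem_insert, not_or]
        exact ⟨hx.1.ne', fun h => (hm x h).not_gt hx.1⟩)) hg2 hu hb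
    rw [← intervalIntegral.integral_add_adjacent_intervals hg1 hg2, h1, h2,
      Finset.sum_insert fun h => (hm m h).ne rfl, ← huv]
    ring

/-- The integral over a period of the derivative of a periodic function with finitely many jumps. -/
theorem integral_eq_neg_sum_jumps {G g J : ℝ → ℝ} {T : ℝ} {p : ℝ → Prop} (hT : 0 < T)
    (hG : Function.Periodic G T) (hg : IntervalIntegrable g MeasureTheory.volume 0 T)
    (hJ : ∀ s, ∃ u v, Tendsto G (𝓝[>] s) (𝓝 u) ∧ Tendsto G (𝓝[<] s) (𝓝 v) ∧ u - v = J s)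
    (hp : ∀ s, ∀ᶠ x in 𝓝[≠] s, p x ∧ HasDerivAt G (g x) x) :
    ∃ S : Finset ℝ, (S : Set ℝ) ⊆ Ico 0 T ∧ (∀ x ∈ Ico 0 T, x ∉ S → p x) ∧
      ∫ x in 0..T, g x = -∑ s ∈ S, J s := by
  have hfin : {x ∈ Ioo 0 T | ¬(p x ∧ HasDerivAt G (g x) x)}.Finite :=
    finite_of_eventually_nhdsNE (K := Icc 0 T) isCompact_Icc
      (fun x hx => Ioo_subset_Icc_self hx.1) fun s _ => (hp s).mono fun x hx h => h.2 hx
  obtain ⟨u, v, hu, hv, huv⟩ := hJ 0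
  -- By periodicity the left limit at `T` is the left limit at `0`, so the boundary terms amount to
  -- minus the jump at `0`. This is why `0` is adjoined to the interior jump points.
  have hv' : Tendsto G (𝓝[<] T) (𝓝 v) := by
    have h1 : Tendsto (fun x => x - T) (𝓝[<] T) (𝓝[<] 0) := by
      refine tendsto_nhdsWithin_iff.2 ⟨?_, ?_⟩
      · have : ContinuousAt (fun x => x - T) T := by fun_prop
        simpa using this.tendsto.mono_left nhdsWithin_le_nhds
      · filter_upwards [self_mem_nhdsWithin] with x hx
        exact sub_neg.2 (Set.mem_Iio.1 hx)
    exact (hv.comp h1).congr fun x => hG.sub_eq x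
  have hmem : ∀ x, x ∈ hfin.toFinset ↔ x ∈ Ioo 0 T ∧ ¬(p x ∧ HasDerivAt G (g x) x) := fun x => by
    rw [Set.Finite.mem_toFinset]; rfl
  have h0 : (0 : ℝ) ∉ hfin.toFinset := fun h => ((hmem 0).1 h).1.1.false
  have hint := integral_eq_sub_sub_sum_jumps hJ 0 hfin.toFinset hT
    (fun x hx => ((hmem x).1 hx).1)
    (fun x hx hxS => (by_contra fun h => hxS ((hmem x).2 ⟨hx, fun h' => h h'.2⟩))) hg hu hv'
  refine ⟨insert 0 hfin.toFinset, ?_, ?_, ?_⟩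
  · intro x hx
    rcases Finset.mem_insert.1 (Finset.mem_coe.1 hx) with rfl | h
    · exact ⟨le_rfl, hT⟩
    · exact ⟨((hmem x).1 h).1.1.le, ((hmem x).1 h).1.2⟩
  · intro x hx hxS
    rw [Finset.mem_insert, not_or] at hxS
    by_contra h
    exact hxS.2 ((hmem x).2 ⟨⟨lt_of_le_of_ne hx.1 (Ne.symm hxS.1), hx.2⟩, fun h' => h h'.1⟩)
  · rw [hint, Finset.sum_insert h0, ← huv]
    ring

namespace Chart

variable {P : Laurent} {ch : Chart P}

theorem exp_I_mul_add (s δ : ℝ) : Complex.exp (Complex.I * s) * Complex.exp (Complex.I * δ) =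
    Complex.exp (Complex.I * (s + δ : ℝ)) := by
  rw [← Complex.exp_add]
  push_cast
  ring_nf

theorem norm_exp_I_mul (s : ℝ) : ‖Complex.exp (Complex.I * s)‖ = 1 := by
  rw [mul_comm, Complex.norm_exp_ofReal_mul_I]

theorem tendsto_sub_nhdsNE (s : ℝ) : Tendsto (fun x => x - s) (𝓝[≠] s) (𝓝[≠] 0) := by
  refine tendsto_nhdsWithin_iff.2 ⟨?_, ?_⟩
  · have : ContinuousAt (fun x => x - s) s := by fun_prop
    simpa using this.tendsto.mono_left nhdsWithin_le_nhds
  · filter_upwards [self_mem_nhdsWithin] with x hx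
    exact sub_ne_zero.2 hx

theorem exists_angle {y : ℂ} (hy : ‖y‖ = 1) :
    ∃ s ∈ Ico 0 (2 * Real.pi), Complex.exp (Complex.I * s) = y := by
  refine ⟨toIcoMod Real.two_pi_pos 0 y.arg, by simpa using toIcoMod_mem_Ico Real.two_pi_pos 0 y.arg,
    ?_⟩
  rw [toIcoMod, Complex.ofReal_sub, mul_sub, Complex.exp_sub, mul_comm Complex.I (y.arg : ℂ)]
  have h1 := Complex.norm_mul_exp_arg_mul_I y
  rw [hy, Complex.ofReal_one, one_mul] at h1
  rw [h1]
  have h2 : Complex.exp (Complex.I * ((toIcoDiv Real.two_pi_pos 0 y.arg • (2 * Real.pi) : ℝ) : ℂ)) =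
      1 := by
    rw [Complex.exp_eq_one_iff]
    exact ⟨toIcoDiv Real.two_pi_pos 0 y.arg, by push_cast [zsmul_eq_mul]; ring⟩
  rw [h2, div_one]

/-- The points over the torus are finite in number, and they compute the integral of the sum of
`log⁺ |X|`. -/
theorem finite_toricPoints_and_integral (hreg : IsLogRegular P) {V : ℂ × ℂ → ℝ}
    (hV : IsVolumeFunction P V)
    (hg : IntervalIntegrable (fun s : ℝ => ch.posLogSum (Complex.exp (Complex.I * s)))
      MeasureTheory.volume 0 (2 * Real.pi)) :
    (toricPoints P).Finite ∧
    ∫ s in 0..2 * Real.pi, ch.posLogSum (Complex.exp (Complex.I * s)) =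
      ∑ᶠ z ∈ toricPoints P, pointTerm V z := by
  have hjump := fun s : ℝ => exists_jump (ch := ch) hreg hV (norm_exp_I_mul s)
  obtain ⟨S, hS, hSp, hint⟩ := integral_eq_neg_sum_jumps
    (G := fun s : ℝ => ch.rootSum V (Complex.exp (Complex.I * s)))
    (J := fun s : ℝ => ∑ᶠ z ∈ ch.toricFibre (Complex.exp (Complex.I * s)), pointTerm V z)
    (p := fun s : ℝ => ch.toricFibre (Complex.exp (Complex.I * s)) = ∅) Real.two_pi_pos
    (by
      intro s
      simp only
      congr 1
      push_cast
      rw [mul_add, mul_comm Complex.I (2 * Real.pi : ℂ)]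
      exact Complex.exp_periodic _) hg.neg
    (by
      intro s
      obtain ⟨-, -, a, b, ha, hb, hab⟩ := hjump s
      refine ⟨a, b, ?_, ?_, hab⟩
      · have h1 : Tendsto (fun x => x - s) (𝓝[>] s) (𝓝[>] 0) :=
          tendsto_nhdsWithin_iff.2 ⟨((tendsto_sub_nhdsNE s).mono_left
            (nhdsWithin_mono _ fun x hx => ne_of_gt hx)).mono_right nhdsWithin_le_nhds, by
            filter_upwards [self_mem_nhdsWithin] with x hx
            exact sub_pos.2 (Set.mem_Ioi.1 hx)⟩
        refine (ha.comp h1).congr fun x => ?_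
        simp only [Function.comp]
        rw [exp_I_mul_add, add_sub_cancel]
      · have h1 : Tendsto (fun x => x - s) (𝓝[<] s) (𝓝[<] 0) :=
          tendsto_nhdsWithin_iff.2 ⟨((tendsto_sub_nhdsNE s).mono_left
            (nhdsWithin_mono _ fun x hx => ne_of_lt hx)).mono_right nhdsWithin_le_nhds, by
            filter_upwards [self_mem_nhdsWithin] with x hx
            exact sub_neg.2 (Set.mem_Iio.1 hx)⟩
        refine (hb.comp h1).congr fun x => ?_
        simp only [Function.comp]
        rw [exp_I_mul_add, add_sub_cancel])
    (by
      intro s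
      filter_upwards [(tendsto_sub_nhdsNE s).eventually (hjump s).2.1] with x ⟨h1, h2⟩
      simp only [exp_I_mul_add] at h1 h2
      rw [add_sub_cancel] at h1 h2
      refine ⟨h1, ?_⟩
      have h3 := h2.comp_sub_const x s
      simpa using h3)
  -- Each point over the torus has `Y = e^{is}` for some `s` in `[0, 2π)`, and outside `S` the fibre
  -- is empty.
  have hU : toricPoints P = ⋃ s ∈ S, ch.toricFibre (Complex.exp (Complex.I * s)) := by
    ext z
    simp only [mem_iUnion]
    constructor
    · intro hz
      obtain ⟨s, hs, he⟩ := exists_angle (norm_N_coords (ch := ch) hz).2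
      have hz' : z ∈ ch.toricFibre (Complex.exp (Complex.I * s)) := ⟨hz, he.symm⟩
      refine ⟨s, by_contra fun h => ?_, hz'⟩
      rw [hSp s hs h] at hz'
      exact hz'
    · rintro ⟨s, -, hz⟩
      exact hz.1
  have hfin : ∀ s ∈ (S : Set ℝ), (ch.toricFibre (Complex.exp (Complex.I * s))).Finite :=
    fun s _ => (hjump s).1
  constructor
  · rw [hU]
    exact S.finite_toSet.biUnion hfin
  -- The angles lie in a half-open period, so distinct ones give distinct values of `Y`.
  · have hdisj : (S : Set ℝ).PairwiseDisjoint
        fun s => ch.toricFibre (Complex.exp (Complex.I * s)) := by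
      intro s hs t ht hst
      rw [Function.onFun, Set.disjoint_left]
      rintro z ⟨-, h1⟩ ⟨-, h2⟩
      refine hst ?_
      have h3 := h1.symm.trans h2
      obtain ⟨n, hn⟩ := Complex.exp_eq_exp_iff_exists_int.1 h3
      have h4 : s = t + n * (2 * Real.pi) := by
        have h5 : Complex.I * (s : ℂ) = Complex.I * (t + n * (2 * Real.pi) : ℝ) := by
          rw [hn]; push_cast; ring
        exact_mod_cast mul_left_cancel₀ Complex.I_ne_zero h5
      have h6 := hS hs
      have h7 := hS ht
      have hpi := Real.two_pi_pos
      have h8 : (n : ℝ) < 1 := by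
        by_contra! h
        nlinarith [h6.2, h7.1]
      have h9 : (-1 : ℝ) < n := by
        by_contra! h
        nlinarith [h6.1, h7.2]
      have h10 : n = 0 := by
        have h11 : n < 1 := by exact_mod_cast h8
        have h12 : -1 < n := by exact_mod_cast h9
        omega
      rw [h4, h10]
      simp
    have h1 := finsum_mem_biUnion (f := pointTerm (P := P) V) hdisj S.finite_toSet hfin
    rw [finsum_mem_coe_finset] at h1
    have h2 : ⋃ s ∈ (S : Set ℝ), ch.toricFibre (Complex.exp (Complex.I * s)) = toricPoints P :=
      hU.symm
    rw [h2] at h1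
    rw [h1, ← neg_inj, ← intervalIntegral.integral_neg]
    exact hint

end Chart

end MahlerVolume

/-! ### Jensen's formula and integration over the torus. -/

namespace MahlerVolume

open Polynomial Real MeasureTheory

instance factTwoPiPos : Fact (0 < 2 * π) := ⟨two_pi_pos⟩

/-- The circle `ℝ / 2πℤ` of angles. -/
abbrev Torus1 : Type := AddCircle (2 * π)

/-- The point of the unit circle of a given angle. -/
def unitPoint (a : Torus1) : ℂ := AddCircle.toCircle a

theorem unitPoint_coe (s : ℝ) : unitPoint s = Complex.exp (Complex.I * s) := by
  rw [unitPoint, AddCircle.toCircle_apply_mk, div_self two_pi_pos.ne', one_mul, Circle.coe_exp,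
    mul_comm]

theorem norm_unitPoint (a : Torus1) : ‖unitPoint a‖ = 1 := Circle.norm_coe _

theorem unitPoint_ne_zero (a : Torus1) : unitPoint a ≠ 0 := Circle.coe_ne_zero _

@[fun_prop]
theorem continuous_unitPoint : Continuous unitPoint :=
  continuous_subtype_val.comp AddCircle.continuous_toCircle

theorem unitPoint_add_zsmul (p q : ℤ) (a b : Torus1) :
    unitPoint (p • a + q • b) = unitPoint a ^ p * unitPoint b ^ q := by
  simp [unitPoint, AddCircle.toCircle_add, AddCircle.toCircle_zsmul]

/-- `log |P|` on the torus. -/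
def logNormTorus (P : Laurent) (a : Torus1 × Torus1) : ℝ :=
  log ‖eval P (unitPoint a.1, unitPoint a.2)‖

theorem logNormTorus_coe (P : Laurent) (s t : ℝ) :
    logNormTorus P ((s : Torus1), (t : Torus1)) = logAbsOnTorus P (s, t) := by
  rw [logNormTorus, unitPoint_coe, unitPoint_coe, logAbsOnTorus]

theorem measurable_logNormTorus (P : Laurent) : Measurable (logNormTorus P) := by
  refine Real.measurable_log.comp (Continuous.measurable (Continuous.norm ?_))
  simp only [eval_eq_sum]
  refine continuous_finsetSum _ fun n _ => (continuous_const.mul ?_).mul ?_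
  · exact (continuous_unitPoint.comp continuous_fst).zpow₀ _ fun a => Or.inl (unitPoint_ne_zero _)
  · exact (continuous_unitPoint.comp continuous_snd).zpow₀ _ fun a => Or.inl (unitPoint_ne_zero _)

theorem measurePreserving_torus : MeasurePreserving
    (Prod.map (fun s : ℝ => (s : Torus1)) fun s : ℝ => (s : Torus1))
    ((volume : Measure (ℝ × ℝ)).restrict (Set.Icc 0 (2 * π) ×ˢ Set.Icc 0 (2 * π))) volume := by
  have h1 : MeasurePreserving (fun s : ℝ => (s : Torus1))
      (volume.restrict (Set.Icc 0 (2 * π))) volume := by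
    rw [← Measure.restrict_congr_set Ioc_ae_eq_Icc]
    simpa using AddCircle.measurePreserving_mk (2 * π) 0
  have h2 := h1.prod h1
  rwa [Measure.prod_restrict] at h2

theorem integrableOn_logAbsOnTorus {P : Laurent} (h : Integrable (logNormTorus P)) :
    IntegrableOn (logAbsOnTorus P) (Set.Icc 0 (2 * π) ×ˢ Set.Icc 0 (2 * π)) := by
  have h1 := measurePreserving_torus.integrable_comp_of_integrable h
  have h2 : logNormTorus P ∘ Prod.map (fun s : ℝ => (s : Torus1)) (fun s : ℝ => (s : Torus1)) =
      logAbsOnTorus P := funext fun a => logNormTorus_coe P a.1 a.2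
  rwa [h2] at h1

theorem intervalIntegral_eq_torus (f : Torus1 → ℝ) :
    ∫ s in 0..2 * π, f (s : Torus1) = ∫ a, f a := by
  have := AddCircle.intervalIntegral_preimage (2 * π) 0 f
  rwa [zero_add] at this

theorem intervalIntegrable_of_torus {f : Torus1 → ℝ} (h : Integrable f) :
    IntervalIntegrable (fun s : ℝ => f (s : Torus1)) volume 0 (2 * π) := by
  rw [intervalIntegrable_iff_integrableOn_Ioc_of_le two_pi_pos.le]
  have h1 := AddCircle.measurePreserving_mk (2 * π) 0
  rw [zero_add] at h1
  exact h1.integrable_comp_of_integrable h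

theorem mahler_eq_integral {P : Laurent} (h : Integrable (logNormTorus P)) :
    mahler P = 1 / (2 * π) ^ 2 * ∫ a, logNormTorus P a := by
  rw [mahler, Measure.volume_eq_prod, integral_prod _ h, ← intervalIntegral_eq_torus]
  simp only [← intervalIntegral_eq_torus, logNormTorus_coe]

/-- Jensen's formula on a circle. -/
theorem integral_log_norm_eval (p : ℂ[X]) :
    Integrable (fun a => log ‖p.eval (unitPoint a)‖) ∧
    ∫ a, log ‖p.eval (unitPoint a)‖ =
      2 * π * (log ‖p.leadingCoeff‖ + (p.roots.map fun x => log⁺ ‖x‖).sum) := by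
  have hc : ∀ s : ℝ, unitPoint s = circleMap 0 1 s := fun s => by
    rw [unitPoint_coe, circleMap]
    simp [mul_comm]
  constructor
  · have h1 : CircleIntegrable (fun z => log ‖p.eval z‖) 0 1 :=
      MeromorphicOn.circleIntegrable_log_norm fun z _ =>
        (p.differentiable.analyticAt z).meromorphicAt
    have h2 : IntervalIntegrable (fun s => log ‖p.eval (circleMap 0 1 s)‖) volume 0 (2 * π) := h1
    rw [intervalIntegrable_iff_integrableOn_Ioc_of_le two_pi_pos.le] at h2
    have h3 := AddCircle.measurePreserving_mk (2 * π) 0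
    rw [zero_add] at h3
    refine (h3.integrable_comp ?_).1 (h2.congr_fun (fun s _ => ?_) measurableSet_Ioc)
    · refine (Real.measurable_log.comp (Continuous.measurable ?_)).aestronglyMeasurable
      fun_prop
    · simp only [Function.comp, hc]
  · have h1 := Polynomial.logMahlerMeasure_eq_log_leadingCoeff_add_sum_log_roots p
    rw [logMahlerMeasure_def, circleAverage_def] at h1
    rw [← h1, ← intervalIntegral_eq_torus]
    simp only [hc, smul_eq_mul]
    rw [← mul_assoc, mul_inv_cancel₀ two_pi_pos.ne', one_mul]

namespace Chart

variable {P : Laurent} (ch : Chart P)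

/-- The monomial change of coordinates on the real torus. -/
def torusMap : Torus1 × Torus1 →+ Torus1 × Torus1 where
  toFun a := (ch.p • a.1 + ch.q • a.2, ch.r • a.1 + ch.s • a.2)
  map_zero' := by simp
  map_add' a b := by
    simp only [Prod.fst_add, Prod.snd_add, smul_add, Prod.mk_add_mk, Prod.mk.injEq]
    constructor <;> abel

/-- A continuous surjective endomorphism of a compact group preserves Haar measure; surjectivity
comes from the inverse integral matrix. -/
theorem measurePreserving_torusMap : MeasurePreserving ch.torusMap volume volume := by
  have : (volume : Measure (Torus1 × Torus1)).IsAddHaarMeasure := by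
    rw [Measure.volume_eq_prod]; infer_instance
  refine AddMonoidHom.measurePreserving ?_ ?_ rfl
  · change Continuous fun a : Torus1 × Torus1 =>
      (ch.p • a.1 + ch.q • a.2, ch.r • a.1 + ch.s • a.2)
    fun_prop
  · rintro ⟨a, b⟩
    refine ⟨(ch.s • a - ch.q • b, ch.p • b - ch.r • a), ?_⟩
    have hd := ch.det
    change (ch.p • (ch.s • a - ch.q • b) + ch.q • (ch.p • b - ch.r • a),
      ch.r • (ch.s • a - ch.q • b) + ch.s • (ch.p • b - ch.r • a)) = (a, b)
    exact Prod.ext (by linear_combination (norm := module) hd • a)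
      (by linear_combination (norm := module) hd • b)

/-- `log |P|` on the torus in the coordinates of the chart. -/
def logNormSlice (a : Torus1 × Torus1) : ℝ :=
  log ‖(ch.slice (unitPoint a.2)).eval (unitPoint a.1)‖

theorem logNormTorus_torusMap (a : Torus1 × Torus1) :
    logNormTorus P (ch.torusMap a) = ch.logNormSlice a := by
  rw [logNormSlice, ch.eval_slice (unitPoint_ne_zero _) (unitPoint_ne_zero _), norm_mul, norm_mul,
    norm_zpow, norm_zpow, norm_unitPoint, norm_unitPoint, one_zpow, one_zpow, one_mul, one_mul]
  simp only [logNormTorus, M, monomialMap, ← unitPoint_add_zsmul]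
  rfl

theorem posLogSum_nonneg (y : ℂ) : 0 ≤ ch.posLogSum y :=
  Multiset.sum_nonneg fun x hx => by
    obtain ⟨z, -, rfl⟩ := Multiset.mem_map.1 hx
    exact posLog_nonneg

/-- The leading coefficient `c Y^m` has modulus `|c|` on `|Y| = 1`, so the first term of Jensen's
formula does not depend on `Y`. -/
theorem integral_logNormSlice (b : Torus1) : Integrable (fun a => ch.logNormSlice (a, b)) ∧
    ∫ a, ch.logNormSlice (a, b) = 2 * π * (log ‖ch.c‖ + ch.posLogSum (unitPoint b)) := by
  have h := integral_log_norm_eval (ch.slice (unitPoint b))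
  rw [ch.leadingCoeff_slice (unitPoint_ne_zero b), norm_mul, norm_pow, norm_unitPoint, one_pow,
    mul_one] at h
  exact h

theorem continuous_eval_slice : Continuous fun a : Torus1 × Torus1 =>
    (ch.slice (unitPoint a.2)).eval (unitPoint a.1) := by
  simp only [slice, Polynomial.eval_map, eval₂_eq_sum_range, coe_evalRingHom]
  fun_prop

theorem exists_logNormSlice_le : ∃ K, 0 ≤ K ∧ ∀ a, ch.logNormSlice a ≤ K := by
  obtain ⟨K, hK⟩ := (isCompact_range ch.continuous_eval_slice.norm).bddAbove
  refine ⟨log (max K 1), log_nonneg (le_max_right _ _), fun a => ?_⟩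
  rcases (norm_nonneg ((ch.slice (unitPoint a.2)).eval (unitPoint a.1))).eq_or_lt with h | h
  · rw [logNormSlice, ← h, log_zero]
    exact log_nonneg (le_max_right _ _)
  · exact log_le_log h ((hK (Set.mem_range_self a)).trans (le_max_left _ _))

/-- An upper bound `f ≤ K` with `K ≥ 0` gives `|f| ≤ 2K - f`, and Jensen's formula bounds `∫ f`
below by `2π log|c|`. Thus the `L¹` norms of the slices are uniformly bounded. -/
theorem integrable_logNormSlice : Integrable ch.logNormSlice := by
  obtain ⟨K, hK0, hK⟩ := ch.exists_logNormSlice_le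
  have hm : AEStronglyMeasurable ch.logNormSlice (volume.prod volume) :=
    (Real.measurable_log.comp ch.continuous_eval_slice.norm.measurable).aestronglyMeasurable
  rw [Measure.volume_eq_prod, integrable_prod_iff' hm]
  refine ⟨Eventually.of_forall fun b => (ch.integral_logNormSlice b).1, ?_⟩
  refine Integrable.of_bound (C := 2 * π * (2 * K - log ‖ch.c‖))
    hm.norm.prod_swap.integral_prod_right' (Eventually.of_forall fun b => ?_)
  obtain ⟨h1, h2⟩ := ch.integral_logNormSlice b
  rw [Real.norm_of_nonneg (integral_nonneg fun a => norm_nonneg _)]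
  calc ∫ a, ‖ch.logNormSlice (a, b)‖ ≤ ∫ a, (2 * K - ch.logNormSlice (a, b)) := by
        refine integral_mono h1.norm ((integrable_const _).sub h1) fun a => ?_
        have := hK (a, b)
        rw [Real.norm_eq_abs]
        exact abs_le.2 ⟨by linarith, by linarith⟩
    _ = 2 * π * (2 * K) - 2 * π * (log ‖ch.c‖ + ch.posLogSum (unitPoint b)) := by
        rw [integral_sub (integrable_const _) h1, h2, integral_const, smul_eq_mul]
        congr 2
        simp [Measure.real, pi_pos.le]
    _ ≤ _ := by
        have h3 := mul_nonneg two_pi_pos.le (ch.posLogSum_nonneg (unitPoint b))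
        linarith

theorem integrable_logNormTorus (ch : Chart P) : Integrable (logNormTorus P) := by
  rw [← ch.measurePreserving_torusMap.integrable_comp
    (measurable_logNormTorus P).aestronglyMeasurable]
  exact ch.integrable_logNormSlice.congr (Eventually.of_forall fun a =>
    (ch.logNormTorus_torusMap a).symm)

theorem integrable_posLogSum : Integrable fun b => ch.posLogSum (unitPoint b) := by
  have h1 := ch.integrable_logNormSlice
  rw [Measure.volume_eq_prod] at h1
  have h2 := (h1.integral_prod_right.const_mul (2 * π)⁻¹).sub (integrable_const (log ‖ch.c‖))
  refine h2.congr (Eventually.of_forall fun b => ?_)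
  have hpi := two_pi_pos.ne'
  simp only [Pi.sub_apply, (ch.integral_logNormSlice b).2]
  field_simp
  ring

theorem intervalIntegrable_posLogSum : IntervalIntegrable
    (fun s : ℝ => ch.posLogSum (Complex.exp (Complex.I * s))) volume 0 (2 * π) := by
  have h := intervalIntegrable_of_torus ch.integrable_posLogSum
  simpa only [unitPoint_coe] using h

theorem integral_logNormTorus :
    ∫ a, logNormTorus P a = ∫ a, ch.logNormSlice a := by
  have h1 := ch.measurePreserving_torusMap.map_eq
  have h2 := integral_map (μ := volume) (φ := ch.torusMap)
    ch.measurePreserving_torusMap.measurable.aemeasurable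
    (f := logNormTorus P) (measurable_logNormTorus P).aestronglyMeasurable
  rw [h1] at h2
  rw [h2]
  simp only [logNormTorus_torusMap]

/-- The Mahler measure in terms of the roots of the slices. -/
theorem mahler_eq : mahler P = log ‖ch.c‖ +
    1 / (2 * π) * ∫ s in 0..2 * π, ch.posLogSum (Complex.exp (Complex.I * s)) := by
  have h1 := ch.integrable_logNormSlice
  have hpi := two_pi_pos.ne'
  rw [mahler_eq_integral ch.integrable_logNormTorus, ch.integral_logNormTorus]
  rw [Measure.volume_eq_prod] at h1 ⊢
  rw [integral_prod_symm _ h1]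
  simp only [(ch.integral_logNormSlice _).2]
  rw [integral_const_mul, integral_add (integrable_const _) ch.integrable_posLogSum, integral_const,
    ← intervalIntegral_eq_torus]
  simp only [unitPoint_coe, smul_eq_mul]
  have h3 : volume.real (Set.univ : Set Torus1) = 2 * π := by
    simp [Measure.real, pi_pos.le]
  rw [h3]
  field_simp

end Chart

end MahlerVolume

/-! ### Algebraic construction of a chart. -/

namespace MahlerVolume

open Polynomial

/-- By Gauss's lemma a square factor over `ℂ(Y)` descends to a primitive one over `ℂ[Y]`, so `B` is
squarefree over `ℂ(Y)`. In characteristic zero it is then separable, and clearing denominators in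
the Bézout relation with its derivative produces `D`. -/
theorem exists_bezout_of_not_sq_dvd {B : ℂ[X][X]}
    (h : ∀ G : ℂ[X][X], 0 < G.natDegree → ¬G * G ∣ B) :
    ∃ (A A' : ℂ[X][X]) (D : ℂ[X]), D ≠ 0 ∧ A * B + A' * derivative B = C D := by
  let K := FractionRing ℂ[X]
  let φ : ℂ[X] →+* K := algebraMap ℂ[X] K
  have hφ : Function.Injective φ := IsFractionRing.injective ℂ[X] K
  have hmap : Function.Injective (Polynomial.map φ) := map_injective φ hφ
  have : CharZero K := charZero_of_injective_algebraMap hφ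
  obtain ⟨inst⟩ : Nonempty (NormalizedGCDMonoid ℂ[X]) := inferInstance
  have hsq : Squarefree (B.map φ) := by
    intro g hg
    by_contra hu
    have hB : B ≠ 0 := by
      rintro rfl
      exact h X (by simp) (dvd_zero _)
    have hg0 : g ≠ 0 := by
      rintro rfl
      rw [mul_zero, zero_dvd_iff] at hg
      exact hB (hmap (by rw [hg, Polynomial.map_zero]))
    have hdeg : 0 < g.natDegree := by
      rw [Nat.pos_iff_ne_zero]
      intro h0
      rw [eq_C_of_natDegree_eq_zero h0] at hu hg0
      exact hu (isUnit_C.2 (isUnit_iff_ne_zero.2 fun h => hg0 (by rw [h, C_0])))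
    set G₀ := IsLocalization.integerNormalization (nonZeroDivisors ℂ[X]) g
    obtain ⟨b, hb, hbg⟩ := IsLocalization.integerNormalization_spec (nonZeroDivisors ℂ[X]) g
    have hb0 : φ b ≠ 0 := fun h => nonZeroDivisors.ne_zero hb (hφ (by rw [h, map_zero]))
    have hbg' : G₀.map φ = C (φ b) * g := by
      rw [← smul_eq_C_mul]
      exact hbg.trans (algebraMap_smul K b g).symm
    have hG₀ : G₀.natDegree = g.natDegree := by
      rw [← natDegree_map_eq_of_injective hφ G₀, hbg', natDegree_C_mul hb0]
    set G := G₀.primPart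
    have hGg : C (φ G₀.content) * G.map φ = C (φ b) * g := by
      rw [← hbg']
      conv_rhs => rw [eq_C_content_mul_primPart G₀]
      rw [Polynomial.map_mul, map_C]
    have hG : G.IsPrimitive := isPrimitive_primPart _
    have hdvd : (G * G).map φ ∣ B.map φ := by
      have h1 : G.map φ ∣ g := by
        refine ⟨C ((φ b)⁻¹ * φ G₀.content), ?_⟩
        rw [C_mul, mul_comm (G.map φ), mul_assoc, hGg, ← mul_assoc, ← C_mul, inv_mul_cancel₀ hb0,
          C_1, one_mul]
      rw [Polynomial.map_mul]
      exact (mul_dvd_mul h1 h1).trans hg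
    refine h G (by rw [natDegree_primPart, hG₀]; exact hdeg) ?_
    obtain ⟨q, hq⟩ := hdvd
    have h2 : q ∈ lifts φ := ((hG.mul hG).map_mul_mem_lifts_iff (K := K)).1 (by
      rw [← hq]; exact ⟨B, rfl⟩)
    obtain ⟨Q, rfl⟩ := h2
    exact ⟨Q, hmap (hq.trans (Polynomial.map_mul φ).symm)⟩
  obtain ⟨a, a', haa⟩ := PerfectField.separable_iff_squarefree.2 hsq
  obtain ⟨b, hb, hba⟩ := IsLocalization.integerNormalization_spec (nonZeroDivisors ℂ[X]) a
  obtain ⟨b', hb', hba'⟩ := IsLocalization.integerNormalization_spec (nonZeroDivisors ℂ[X]) a'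
  set A := IsLocalization.integerNormalization (nonZeroDivisors ℂ[X]) a
  set A' := IsLocalization.integerNormalization (nonZeroDivisors ℂ[X]) a'
  have h1 : A.map φ = C (φ b) * a := by
    rw [← smul_eq_C_mul]
    exact hba.trans (algebraMap_smul K b a).symm
  have h2 : A'.map φ = C (φ b') * a' := by
    rw [← smul_eq_C_mul]
    exact hba'.trans (algebraMap_smul K b' a').symm
  refine ⟨C b' * A, C b * A', b * b',
    mul_ne_zero (nonZeroDivisors.ne_zero hb) (nonZeroDivisors.ne_zero hb'), hmap ?_⟩
  simp only [Polynomial.map_add, Polynomial.map_mul, map_C, h1, h2, ← derivative_map, map_mul]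
  linear_combination (C (φ b) * C (φ b')) * haa

/-- For `y ≠ 0` avoiding the zeros of the leading and constant coefficients, the specialized
polynomial has a root, and that root is not `0`. -/
theorem exists_zero_of_natDegree_pos {G : ℂ[X][X]} (hd : 0 < G.natDegree) (h0 : G.coeff 0 ≠ 0) :
    ∃ x y : ℂ, x ≠ 0 ∧ y ≠ 0 ∧ (G.map (evalRingHom y)).eval x = 0 := by
  have hlc : G.leadingCoeff ≠ 0 := by
    rw [leadingCoeff_ne_zero]
    rintro rfl
    simp at hd
  have hne : X * G.leadingCoeff * G.coeff 0 ≠ 0 := mul_ne_zero (mul_ne_zero X_ne_zero hlc) h0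
  obtain ⟨y, hy⟩ := Infinite.exists_notMem_finset (X * G.leadingCoeff * G.coeff 0).roots.toFinset
  rw [Multiset.mem_toFinset, mem_roots hne, IsRoot, eval_mul, eval_mul, eval_X, mul_eq_zero,
    mul_eq_zero, not_or, not_or] at hy
  obtain ⟨x, hx⟩ := IsAlgClosed.exists_root (G.map (evalRingHom y)) (by
    rw [degree_map_eq_of_leadingCoeff_ne_zero _ hy.1.2]
    exact (natDegree_pos_iff_degree_pos.1 hd).ne')
  refine ⟨x, y, ?_, hy.1.1, hx⟩
  rintro rfl
  rw [IsRoot, ← coeff_zero_eq_eval_zero, coeff_map] at hx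
  exact hy.2 hx

/-- The substitution of monomials for `X` and `Y`. -/
def chartHom (p q r s : ℤ) : ℂ[X][X] →+* Laurent :=
  eval₂RingHom (eval₂RingHom (AddMonoidAlgebra.singleZeroRingHom (R := ℂ) (M := ℤ × ℤ))
    (AddMonoidAlgebra.single (-r, p) 1)) (AddMonoidAlgebra.single (s, -q) 1)

theorem chartHom_monomial (p q r s : ℤ) (a b : ℕ) (c : ℂ) :
    chartHom p q r s (monomial a (monomial b c)) =
      AddMonoidAlgebra.single (a * s - b * r, b * p - a * q) c := by
  rw [chartHom, coe_eval₂RingHom, eval₂_monomial, coe_eval₂RingHom, eval₂_monomial,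
    AddMonoidAlgebra.single_pow, AddMonoidAlgebra.single_pow]
  change AddMonoidAlgebra.single 0 c * _ * _ = _
  rw [AddMonoidAlgebra.single_mul_single, AddMonoidAlgebra.single_mul_single, one_pow, one_pow,
    mul_one, mul_one]
  congr 1
  ext
  · simp only [zero_add, Prod.fst_add, Prod.smul_fst, ← natCast_zsmul, smul_eq_mul]
    ring
  · simp only [zero_add, Prod.snd_add, Prod.smul_snd, ← natCast_zsmul, smul_eq_mul]
    ring

/-- The evaluation of Laurent polynomials at a monomial image of `(x, y)`. -/
def chartEval (p q r s : ℤ) {x y : ℂ} (hx : x ≠ 0) (hy : y ≠ 0) : Laurent →ₐ[ℂ] ℂ :=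
  AddMonoidAlgebra.lift ℂ ℂ (ℤ × ℤ)
    { toFun m := x ^ (p * m.toAdd.1 + r * m.toAdd.2) * y ^ (q * m.toAdd.1 + s * m.toAdd.2)
      map_one' := by simp
      map_mul' m n := by
        simp only [toAdd_mul, Prod.fst_add, Prod.snd_add, mul_add, zpow_add₀ hx, zpow_add₀ hy]
        ring }

theorem chartEval_single (p q r s : ℤ) {x y : ℂ} (hx : x ≠ 0) (hy : y ≠ 0) (m : ℤ × ℤ) (c : ℂ) :
    chartEval p q r s hx hy (AddMonoidAlgebra.single m c) =
      c * (x ^ (p * m.1 + r * m.2) * y ^ (q * m.1 + s * m.2)) := by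
  rw [chartEval, AddMonoidAlgebra.lift_single]
  rfl

theorem chartEval_eq (p q r s : ℤ) {x y : ℂ} (hx : x ≠ 0) (hy : y ≠ 0) (P : Laurent) :
    chartEval p q r s hx hy P = eval P (monomialMap p q r s (x, y)) := by
  conv_lhs => rw [← AddMonoidAlgebra.sum_coeff_single P, Finsupp.sum, map_sum]
  rw [eval_eq_sum]
  refine Finset.sum_congr rfl fun m _ => ?_
  rw [chartEval_single, mul_assoc]
  simp only [monomialMap, mul_zpow, ← zpow_mul, zpow_add₀ hx, zpow_add₀ hy]
  ring

theorem chartEval_chartHom {p q r s : ℤ} (hdet : p * s - q * r = 1) {x y : ℂ} (hx : x ≠ 0)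
    (hy : y ≠ 0) (G : ℂ[X][X]) :
    chartEval p q r s hx hy (chartHom p q r s G) = (G.map (evalRingHom y)).eval x := by
  have h : ((chartEval p q r s hx hy : Laurent →+* ℂ).comp (chartHom p q r s)) =
      (evalRingHom x).comp (mapRingHom (evalRingHom y)) := by
    ext
    · simp [chartHom, chartEval_single]
    · simp only [chartHom, RingHom.comp_apply, coe_eval₂RingHom, eval₂_C, eval₂_X,
        RingHom.coe_coe, chartEval_single]
      rw [show p * -r + r * p = 0 by ring, show q * -r + s * p = 1 by linarith]
      simp
    · simp only [chartHom, RingHom.comp_apply, coe_eval₂RingHom, eval₂_X, RingHom.coe_coe,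
        chartEval_single]
      rw [show p * s + r * -q = 1 by linarith, show q * s + s * -q = 0 by ring]
      simp
  exact RingHom.congr_fun h G

/-- The polynomial with the coefficients of `P` at the exponents `(a m, b m)`. -/
def chartPoly (P : Laurent) (a b : ℤ × ℤ → ℕ) : ℂ[X][X] :=
  ∑ m ∈ P.coeff.support, monomial (a m) (monomial (b m) (P.coeff m))

theorem coeff_chartPoly (P : Laurent) (a b : ℤ × ℤ → ℕ) (i : ℕ) : (chartPoly P a b).coeff i =
    ∑ m ∈ P.coeff.support, if a m = i then monomial (b m) (P.coeff m) else 0 := by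
  simp only [chartPoly, finsetSum_coeff, coeff_monomial]

theorem coeff_coeff_chartPoly (P : Laurent) {a b : ℤ × ℤ → ℕ}
    (h : ∀ m ∈ P.coeff.support, ∀ m' ∈ P.coeff.support, a m = a m' → b m = b m' → m = m')
    {m : ℤ × ℤ} (hm : m ∈ P.coeff.support) :
    ((chartPoly P a b).coeff (a m)).coeff (b m) = P.coeff m := by
  rw [coeff_chartPoly, finsetSum_coeff, Finset.sum_eq_single_of_mem m hm]
  · simp
  · intro m' hm' hne
    split_ifs with h1
    · rw [coeff_monomial, if_neg fun h2 => hne (h m' hm' m hm h1 h2)]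
    · simp

theorem leadingCoeff_chartPoly (P : Laurent) {a b : ℤ × ℤ → ℕ} {n : ℤ × ℤ}
    (hn : n ∈ P.coeff.support) (h : ∀ m ∈ P.coeff.support, m ≠ n → a m < a n) :
    (chartPoly P a b).leadingCoeff = C (P.coeff n) * X ^ b n := by
  have h1 : (chartPoly P a b).coeff (a n) = C (P.coeff n) * X ^ b n := by
    rw [coeff_chartPoly, Finset.sum_eq_single_of_mem n hn, if_pos rfl, C_mul_X_pow_eq_monomial]
    exact fun m hm hne => if_neg (h m hm hne).ne
  have h2 : C (P.coeff n) * (X : ℂ[X]) ^ b n ≠ 0 := by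
    rw [C_mul_X_pow_eq_monomial, Ne, monomial_eq_zero_iff]
    exact Finsupp.mem_support_iff.1 hn
  have h3 : (chartPoly P a b).natDegree = a n := by
    refine le_antisymm ?_ (le_natDegree_of_ne_zero (by rw [h1]; exact h2))
    refine natDegree_sum_le_of_forall_le _ _ fun m hm => (natDegree_monomial_le _).trans ?_
    by_cases hmn : m = n
    · rw [hmn]
    · exact (h m hm hmn).le
  rw [leadingCoeff, h3, h1]

/-- A linear form with a unique maximum on the support of `P` gives monomial coordinates. -/
theorem exists_chart_of_forall_lt {P : Laurent} (hP : Squarefree P) {p q r s : ℤ}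
    (hdet : p * s - q * r = 1) {n : ℤ × ℤ} (hn : n ∈ P.coeff.support)
    (h : ∀ m ∈ P.coeff.support, m ≠ n → p * m.1 + r * m.2 < p * n.1 + r * n.2) :
    ∃ ch : Chart P, ch.c = P.coeff n := by
  obtain ⟨m₀, hm₀, hmin⟩ := P.coeff.support.exists_min_image (fun m => p * m.1 + r * m.2) ⟨n, hn⟩
  obtain ⟨m₁, -, hmin'⟩ := P.coeff.support.exists_min_image (fun m => q * m.1 + s * m.2) ⟨n, hn⟩
  -- The shifts `e` and `f` make all exponents non-negative. The smallest `X`-exponent becomes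
  -- exactly `0`, so `X` does not divide `B`; this is what `hB0` records.
  set e := -(p * m₀.1 + r * m₀.2) with he
  set f := -(q * m₁.1 + s * m₁.2) with hf
  set a : ℤ × ℤ → ℕ := fun m => (p * m.1 + r * m.2 + e).toNat with ha
  set b : ℤ × ℤ → ℕ := fun m => (q * m.1 + s * m.2 + f).toNat with hb
  have ha' : ∀ m ∈ P.coeff.support, (a m : ℤ) = p * m.1 + r * m.2 + e := fun m hm =>
    Int.toNat_of_nonneg (by have := hmin m hm; linarith)
  have hb' : ∀ m ∈ P.coeff.support, (b m : ℤ) = q * m.1 + s * m.2 + f := fun m hm =>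
    Int.toNat_of_nonneg (by have := hmin' m hm; linarith)
  have hinj : ∀ m ∈ P.coeff.support, ∀ m' ∈ P.coeff.support, a m = a m' → b m = b m' →
      m = m' := by
    intro m hm m' hm' h1 h2
    have h3 : p * m.1 + r * m.2 = p * m'.1 + r * m'.2 := by
      have := ha' m hm
      rw [h1, ha' m' hm'] at this
      linarith
    have h4 : q * m.1 + s * m.2 = q * m'.1 + s * m'.2 := by
      have := hb' m hm
      rw [h2, hb' m' hm'] at this
      linarith
    exact Prod.ext (by linear_combination (m'.1 - m.1) * hdet + s * h3 - r * h4)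
      (by linear_combination (m'.2 - m.2) * hdet - q * h3 + p * h4)
  set B := chartPoly P a b with hB
  have hΨ : chartHom p q r s B =
      AddMonoidAlgebra.single (e * s - f * r, f * p - e * q) 1 * P := by
    conv_rhs => rw [← AddMonoidAlgebra.sum_coeff_single P, Finsupp.sum, Finset.mul_sum]
    rw [hB, chartPoly, map_sum]
    refine Finset.sum_congr rfl fun m hm => ?_
    rw [chartHom_monomial, AddMonoidAlgebra.single_mul_single, one_mul, ha' m hm, hb' m hm]
    congr 1
    exact Prod.ext (by simp only [Prod.fst_add]; linear_combination m.1 * hdet)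
      (by simp only [Prod.snd_add]; linear_combination m.2 * hdet)
  have hB0 : B.coeff 0 ≠ 0 := by
    intro h0
    have h1 := coeff_coeff_chartPoly P hinj hm₀
    have h2 : a m₀ = 0 := by
      have := ha' m₀ hm₀
      rw [he] at this
      omega
    rw [h2, ← hB, h0, coeff_zero] at h1
    exact Finsupp.mem_support_iff.1 hm₀ h1.symm
  have hu : IsUnit (AddMonoidAlgebra.single (e * s - f * r, f * p - e * q) 1 : Laurent) :=
    IsUnit.of_mul_eq_one (AddMonoidAlgebra.single (-(e * s - f * r, f * p - e * q)) 1) (by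
      rw [AddMonoidAlgebra.single_mul_single, add_neg_cancel, one_mul, AddMonoidAlgebra.one_def])
  -- A square factor of `B` of positive `X`-degree gives a square factor of `P`, whose base is a
  -- unit since `P` is squarefree. But the base vanishes somewhere on `(ℂ^*)²`, which is impossible
  -- for a unit.
  have hsq : ∀ G : ℂ[X][X], 0 < G.natDegree → ¬G * G ∣ B := by
    intro G hG hdvd
    have h1 : chartHom p q r s G * chartHom p q r s G ∣ P := by
      rw [← map_mul, ← hu.dvd_mul_left, ← hΨ]
      exact map_dvd _ hdvd
    have h2 : G.coeff 0 ≠ 0 := by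
      intro h0
      obtain ⟨Q, hQ⟩ := hdvd
      rw [hQ, mul_coeff_zero, mul_coeff_zero, h0, zero_mul, zero_mul] at hB0
      exact hB0 rfl
    obtain ⟨x, y, hx, hy, h3⟩ := exists_zero_of_natDegree_pos hG h2
    have h4 := (hP _ h1).map (chartEval p q r s hx hy)
    rw [chartEval_chartHom hdet, h3] at h4
    exact not_isUnit_zero h4
  obtain ⟨A, A', D, hD, hAB⟩ := exists_bezout_of_not_sq_dvd hsq
  exact ⟨{
    p := p
    q := q
    r := r
    s := s
    det := hdet
    B := B
    c := P.coeff n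
    c_ne_zero := Finsupp.mem_support_iff.1 hn
    m := b n
    leadingCoeff_eq := leadingCoeff_chartPoly P hn fun m hm hne => by
      have h1 := ha' m hm
      have h2 := ha' n hn
      have h3 := h m hm hne
      omega
    e := e
    f := f
    eval_map := fun x y hx hy => by
      rw [← chartEval_chartHom hdet hx hy, hΨ, map_mul, chartEval_single, chartEval_eq, one_mul]
      congr 3
      · linear_combination e * hdet
      · linear_combination f * hdet
    disc := D
    disc_ne_zero := hD
    simple := fun y _ hDy x h0 h1 => by
      have h2 := congrArg (fun Q : ℂ[X][X] => (Q.map (evalRingHom y)).eval x) hAB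
      simp only [Polynomial.map_add, Polynomial.map_mul, eval_add, eval_mul, map_C, eval_C, h0,
        ← derivative_map, h1, mul_zero, add_zero, coe_evalRingHom] at h2
      exact hDy h2.symm }, rfl⟩

end MahlerVolume

/-! ### Corners of the Newton polygon and linear forms. -/

namespace MahlerVolume

/-- The support of `P` in the real plane. -/
def realSupport (P : Laurent) : Set (ℝ × ℝ) :=
  (fun m : ℤ × ℤ => ((m.1 : ℝ), (m.2 : ℝ))) '' {m | P.coeff m ≠ 0}

theorem finite_realSupport (P : Laurent) : (realSupport P).Finite :=
  (P.coeff.support.finite_toSet.subset fun _ hm => Finsupp.mem_support_iff.2 hm).image _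

theorem intCast_prod_injective :
    Function.Injective fun m : ℤ × ℤ => (((m.1 : ℝ), (m.2 : ℝ)) : ℝ × ℝ) := fun m n h => by
  simp only [Prod.mk.injEq, Int.cast_inj] at h
  exact Prod.ext h.1 h.2

theorem IsCorner.mem_support {P : Laurent} {n : ℤ × ℤ} (hn : IsCorner P n) :
    n ∈ P.coeff.support := by
  obtain ⟨m, hm, he⟩ := extremePoints_convexHull_subset hn
  rw [← intCast_prod_injective he]
  exact Finsupp.mem_support_iff.2 hm

theorem exists_isCorner {P : Laurent} (hP : P ≠ 0) : ∃ n, IsCorner P n := by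
  have hne : (realSupport P).Nonempty := by
    obtain ⟨m, hm⟩ := Finsupp.ne_iff.1 fun h : P.coeff = 0 => hP (AddMonoidAlgebra.coeff_inj.1 h)
    exact ⟨_, m, hm, rfl⟩
  obtain ⟨x, hx⟩ := ((finite_realSupport P).isCompact_convexHull (𝕜 := ℝ)).extremePoints_nonempty
    hne.convexHull
  obtain ⟨m, hm, rfl⟩ := extremePoints_convexHull_subset hx
  exact ⟨m, hx⟩

/-- A corner is the unique maximum of a real linear form. -/
theorem IsCorner.exists_real {P : Laurent} {n : ℤ × ℤ} (hn : IsCorner P n) :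
    ∃ α β : ℝ, ∀ m ∈ P.coeff.support, m ≠ n → α * m.1 + β * m.2 < α * n.1 + β * n.2 := by
  have h1 := ((convex_convexHull ℝ _).mem_extremePoints_iff_mem_sdiff_convexHull_sdiff.1 hn).2
  have h2 : ((n.1 : ℝ), (n.2 : ℝ)) ∉ convexHull ℝ (realSupport P \ {((n.1 : ℝ), (n.2 : ℝ))}) :=
    fun h => h1 (convexHull_mono (Set.sdiff_subset_sdiff_left (subset_convexHull ℝ _)) h)
  obtain ⟨g, u, hg, hu⟩ := geometric_hahn_banach_closed_point (convex_convexHull ℝ _)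
    ((finite_realSupport P).sdiff.isClosed_convexHull (𝕜 := ℝ)) h2
  have hlin : ∀ m : ℤ × ℤ, g ((m.1 : ℝ), (m.2 : ℝ)) = g (1, 0) * m.1 + g (0, 1) * m.2 := by
    intro m
    have : ((m.1 : ℝ), (m.2 : ℝ)) = (m.1 : ℝ) • ((1, 0) : ℝ × ℝ) + (m.2 : ℝ) • (0, 1) := by
      simp
    rw [this, map_add, map_smul, map_smul]
    simp [mul_comm]
  refine ⟨g (1, 0), g (0, 1), fun m hm hmn => ?_⟩
  rw [← hlin, ← hlin]
  refine (hg _ (subset_convexHull ℝ _ ⟨⟨m, Finsupp.mem_support_iff.1 hm, rfl⟩, fun h => ?_⟩)).trans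
    hu
  exact hmn (intCast_prod_injective h)

/-- A corner is the unique maximum of a primitive integral linear form. -/
theorem IsCorner.exists_int {P : Laurent} {n : ℤ × ℤ} (hn : IsCorner P n) :
    ∃ p q r s : ℤ, p * s - q * r = 1 ∧
      ∀ m ∈ P.coeff.support, m ≠ n → p * m.1 + r * m.2 < p * n.1 + r * n.2 := by
  obtain ⟨α, β, hαβ⟩ := hn.exists_real
  -- Finitely many strict inequalities define an open set of linear forms, so a rational form can
  -- replace the real one; denominators are then cleared.
  have hopen : IsOpen {w : ℝ × ℝ | ∀ m ∈ P.coeff.support, m ≠ n →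
      w.1 * m.1 + w.2 * m.2 < w.1 * n.1 + w.2 * n.2} := by
    simp only [Set.ofPred_forall]
    refine P.coeff.support.finite_toSet.isOpen_biInter fun m _ => isOpen_iInter_of_finite fun _ => ?_
    exact isOpen_lt (by fun_prop) (by fun_prop)
  obtain ⟨⟨x, y⟩, hxy⟩ := (Rat.denseRange_cast (𝕜 := ℝ)).prodMap (Rat.denseRange_cast (𝕜 := ℝ))
    |>.exists_mem_open hopen ⟨(α, β), hαβ⟩
  simp only [Prod.map, Set.mem_ofPred_eq] at hxy
  have hint : ∃ i j : ℤ, ∀ m ∈ P.coeff.support, m ≠ n → i * m.1 + j * m.2 < i * n.1 + j * n.2 := by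
    refine ⟨x.num * y.den, y.num * x.den, fun m hm hmn => ?_⟩
    have h1 : x * m.1 + y * m.2 < x * n.1 + y * n.2 := by exact_mod_cast hxy m hm hmn
    have hx : (0 : ℚ) < x.den := by exact_mod_cast x.den_pos
    have hy : (0 : ℚ) < y.den := by exact_mod_cast y.den_pos
    have h2 := mul_lt_mul_of_pos_right h1 (mul_pos hx hy)
    have h3 : ((x.num * y.den : ℤ) : ℚ) = x * (x.den * y.den) := by
      push_cast
      rw [← mul_assoc, Rat.mul_den_eq_num]
    have h4 : ((y.num * x.den : ℤ) : ℚ) = y * (x.den * y.den) := by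
      push_cast
      rw [mul_comm (x.den : ℚ), ← mul_assoc, Rat.mul_den_eq_num]
    have h5 : ((x.num * y.den * m.1 + y.num * x.den * m.2 : ℤ) : ℚ) <
        (x.num * y.den * n.1 + y.num * x.den * n.2 : ℤ) := by
      rw [Int.cast_add, Int.cast_add, Int.cast_mul, Int.cast_mul _ m.2, Int.cast_mul _ n.1,
        Int.cast_mul _ n.2, h3, h4]
      linarith
    exact_mod_cast h5
  obtain ⟨i, j, hij⟩ := hint
  by_cases h0 : Int.gcd i j = 0
  · rw [Int.gcd_eq_zero_iff] at h0
    -- A zero form can have a strict maximum at `n` only if `n` is the whole support, so any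
    -- unimodular matrix will do.
    refine ⟨1, 0, 0, 1, by norm_num, fun m hm hmn => ?_⟩
    have := hij m hm hmn
    simp [h0.1, h0.2] at this
  · obtain ⟨p, hp⟩ := Int.gcd_dvd_left i j
    obtain ⟨r, hr⟩ := Int.gcd_dvd_right i j
    have hg : (0 : ℤ) < Int.gcd i j := by
      have := Nat.pos_of_ne_zero h0
      exact_mod_cast this
    have hbez := Int.gcd_eq_gcd_ab i j
    -- Dividing the form by its gcd makes it primitive, and the Bézout coefficients complete it to
    -- determinant 1.
    refine ⟨p, -Int.gcdB i j, r, Int.gcdA i j, ?_, fun m hm hmn => ?_⟩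
    · refine mul_left_cancel₀ hg.ne' ?_
      linear_combination (-1 : ℤ) * hbez - Int.gcdA i j * hp - Int.gcdB i j * hr
    · have h1 := hij m hm hmn
      refine lt_of_mul_lt_mul_left ?_ hg.le
      calc _ = i * m.1 + j * m.2 := by linear_combination (-m.1) * hp - m.2 * hr
        _ < i * n.1 + j * n.2 := h1
        _ = _ := by linear_combination n.1 * hp + n.2 * hr

theorem IsCorner.exists_chart {P : Laurent} (hP : Squarefree P) {n : ℤ × ℤ} (hn : IsCorner P n) :
    ∃ ch : Chart P, ch.c = P.coeff n := by
  obtain ⟨p, q, r, s, hdet, h⟩ := hn.exists_int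
  exact exists_chart_of_forall_lt hP hdet hn.mem_support h

end MahlerVolume

end

/-! ### Assembly and comparison of the corners. -/

open MahlerVolume in
theorem mainTheorem3 (P : Laurent) (hP : Squarefree P) (hreg : IsLogRegular P)
    (V : ℂ × ℂ → ℝ) (hV : IsVolumeFunction P V) :
    MeasureTheory.IntegrableOn (logAbsOnTorus P)
      (Set.Icc 0 (2 * Real.pi) ×ˢ Set.Icc 0 (2 * Real.pi)) ∧
    (toricPoints P).Finite ∧
    ∃ (W : Normalization P → ℝ) (c : ℝ),
      IsExtension P V W ∧
      (∀ z ∈ toricPoints P,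
        (epsilon z = 1 ∧ IsLocalMaxAt V W z) ∨ (epsilon z = -1 ∧ IsLocalMinAt V W z)) ∧
      0 < c ∧ (∀ n : ℤ × ℤ, IsCorner P n → ‖P.coeff n‖ = c) ∧
      mahler P = Real.log c +
        1 / (2 * Real.pi) * ∑ᶠ z ∈ toricPoints P, (ramification z : ℝ) * epsilon z * W z := by
  obtain ⟨n₀, hn₀⟩ := exists_isCorner hP.ne_zero
  have key : ∀ n, IsCorner P n → 0 < ‖P.coeff n‖ ∧ mahler P = Real.log ‖P.coeff n‖ +
      1 / (2 * Real.pi) * ∑ᶠ z ∈ toricPoints P, Chart.pointTerm V z := by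
    intro n hn
    obtain ⟨ch, hc⟩ := hn.exists_chart hP
    rw [← hc, ch.mahler_eq, (Chart.finite_toricPoints_and_integral hreg hV
      ch.intervalIntegrable_posLogSum).2]
    exact ⟨norm_pos_iff.2 ch.c_ne_zero, rfl⟩
  obtain ⟨ch, hc⟩ := hn₀.exists_chart hP
  refine ⟨integrableOn_logAbsOnTorus (Chart.integrable_logNormTorus ch),
    (Chart.finite_toricPoints_and_integral hreg hV ch.intervalIntegrable_posLogSum).1,
    extension V, ‖P.coeff n₀‖, ch.isExtension_extension hV,
    fun z hz => ch.epsilon_and_isLocalExtr hreg hV z hz, (key n₀ hn₀).1, fun n hn => ?_,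
    (key n₀ hn₀).2⟩
  -- The sum over the torus is the same for both corners, so their logarithmic terms agree.
  have h := (key n hn).2
  rw [(key n₀ hn₀).2, add_left_inj] at h
  exact (Real.log_injOn_pos (key n₀ hn₀).1 (key n hn).1 h).symm
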